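/- **Setting.** In a single-hop radio network time is divided into slots; in each slot each device transmits a message (of unbounded size), listens, or stays idle. Transmitting and listening cost one unit of energy each; local computation is free. A listener hears the message if exactly one device transmits and silence if none does. If two or more transmit, a listener hears noise in the models Strong-CD and Receiver-CD, and silence in Sender-CD and No-CD. In Strong-CD and Sender-CD a transmitter hears what a listener would hear; in Receiver-CD and No-CD it receives no signal. The time and energy of an execution are the maxima over all devices. *A leader is elected* means that, when all devices have halted, exactly one is designated leader and all others are designated followers; *no leader is elected* means that all are followers. Let $\alpha(x)=\min\{k\ge 1: A(k,k)\ge x\}$ with $A$ the Ackermann function. **Dense Census.** A dense Census algorithm with parameter $c$ is a family, indexed by $N\ge 1$, of deterministic No-CD algorithms for devices with distinct IDs in $\{0,\dots,N-1\}$, in which two devices never transmit in the same slot, and which, whenever at least $cN$ devices are present, elects a leader that knows the list of all IDs present and announces it in the last slot while all other devices listen, in $O(N)$ time with $O(\alpha(N))$ energy. **Algorithm Test-Network-Size$(\tilde n)$.** It is run by $n$ identical devices without IDs, which have independent private random bits and know $\tilde n$ but not $n$. Let $N=\lceil K\log\tilde n\rceil$. 1. *ID assignment in Strong-CD and Sender-CD*: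 in each of $N$ slots each device transmits with probability $1/\tilde n$; a device that hears its own message in the $i$-th slot takes ID $i$. *ID assignment in Receiver-CD and No-CD*: there are $2N$ such slots, numbered $0,\dots,2N-1$, and ID $i\in\{0,\dots,N-1\}$ is taken by a device $u$ if $u$ is the only device transmitting in slot $2i$ and some other device is the only one transmitting in slot $2i+1$. This is verified in two additional slots for each $i$: in the first the transmitters of slot $2i$ speak and the other transmitters of slot $2i+1$ listen; in the second those listeners that received a message speak, and the devices that transmitted in slot $2i$ but not in slot $2i+1$ listen, and take ID $i$ if they receive a message. In all models the random choices are made in advance, and a device selected to transmit in at least $\beta$ of these slots does not participate: it never transmits or listens, and it ends as a follower. 2. A dense Census algorithm with parameter $c$ is run on ID space $\{0,\dots,N-1\}$ by the devices that took an ID, where $c=0.325$ in Strong-CD and Sender-CD, and $c=0.325^2$ in Receiver-CD and No-CD. A device with several IDs simulates one device for each of them. A leader whose list has fewer than $cN$ IDs resets itself to follower. All other devices are followers. **Theorem.** For each of the four collision detection models there are a dense Census algorithm with the parameter $c$ above and constants $K,C,\varepsilon>0$ and $\beta\in\mathbb N$ such that for all integers $n\ge 1$ and all real $\tilde n\ge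 100$, with probability at least $1-\min\{n^{-\varepsilon},\tilde n^{-\varepsilon}\}$, Test-Network-Size$(\tilde n)$ run by $n$ devices halts on all devices within time $C\log\tilde n$ and with energy at most $C\,\alpha(\tilde n)$ for every device, and - if $n/1.5\le\tilde n\le 1.5\,n$, then a leader is elected; - if $\tilde n\ge 1.9\,n$ or $\tilde n\le n/1.9$, then no leader is elected. -/

import Mathlib

namespace RadioNetwork

/-! ### The single-hop radio network -/

/-- The four collision detection models. -/
inductive CDModel where
  | strongCD
  | senderCD
  | receiverCD
  | noCD

/-- What a device does in one time slot; `M` is the message space. -/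
inductive Action (M : Type) where
  | idle
  | listen
  | transmit (m : M)

/-- What a device hears in one time slot; `nothing` means that it receives no signal at all. -/
inductive Signal (M : Type) where
  | nothing
  | silence
  | noise
  | message (m : M)

/-- Listening and transmitting cost one unit of energy, idling is free. -/
def Action.cost {M : Type} : Action M → ℕ
  | .idle => 0
  | .listen => 1
  | .transmit _ => 1

/-- Device `i` transmits `m` and no other device transmits. -/
def IsSoleTransmitter {ι M : Type} (a : ι → Action M) (i : ι) (m : M) : Prop :=
  a i = .transmit m ∧ ∀ j, j ≠ i → ∀ m', a j ≠ .transmit m'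

open Classical in
/-- The true state of the channel when each device `i` performs `a i`: the message if exactly one
device transmits, noise if at least two do, silence if none does. -/
noncomputable def channel {ι M : Type} (a : ι → Action M) : Signal M :=
  if h : ∃ m i, IsSoleTransmitter a i m then .message h.choose
  else if ∃ i m, a i = .transmit m then .noise
  else .silence

/-- In the models that do not distinguish noise from silence, noise is heard as silence. -/
def CDModel.perceive {M : Type} : CDModel → Signal M → Signal M
  | .senderCD, .noise => .silence
  | .noCD, .noise => .silence
  | _, s => s

/-- The signal that a device performing action `b` receives when the true state of the channel
is `ch`: senders hear the channel only in the first two models. -/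
def CDModel.hear {M : Type} (c : CDModel) (ch : Signal M) (b : Action M) : Signal M :=
  match b, c with
  | .idle, _ => .nothing
  | .listen, c => c.perceive ch
  | .transmit _, .strongCD => CDModel.strongCD.perceive ch
  | .transmit _, .senderCD => CDModel.senderCD.perceive ch
  | .transmit _, .receiverCD => .nothing
  | .transmit _, .noCD => .nothing

/-- A protocol, run by all devices alike. A device starts from its private input in `X` (its ID in
the deterministic setting, its random bits in the randomized setting). In each slot its local state
determines an action, or says that the device has halted with an output in `O`; the signal that it
receives then updates the state. Local computation is free and unrestricted. -/
structure Protocol (X M O : Type) where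
  State : Type
  init : X → State
  next : State → Action M ⊕ O
  update : State → Signal M → State

namespace Protocol

variable {X M O Y : Type}

/-- A halted device stays idle. -/
def action (P : Protocol X M O) (s : P.State) : Action M :=
  match P.next s with
  | .inl a => a
  | .inr _ => .idle

/-- One step of a single device; a halted device keeps its state. -/
def step (P : Protocol X M O) (s : P.State) (sig : Signal M) : P.State :=
  match P.next s with
  | .inl _ => P.update s sig
  | .inr _ => s

/-- The states of all devices after `t` time slots, device `i` having private input `x i`. -/
noncomputable def run (P : Protocol X M O) (c : CDModel) {ι : Type} (x : ι → X) :
    ℕ → ι → P.State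
  | 0 => fun i => P.init (x i)
  | t + 1 => fun i =>
      P.step (P.run c x t i)
        (c.hear (channel fun j => P.action (P.run c x t j)) (P.action (P.run c x t i)))

/-- The action of device `i` in time slot `t` (slots are numbered from `0`). -/
noncomputable def actionAt (P : Protocol X M O) (c : CDModel) {ι : Type} (x : ι → X)
    (t : ℕ) (i : ι) : Action M :=
  P.action (P.run c x t i)

/-- After `t` time slots device `i` has halted with output `o`. -/
def OutputAt (P : Protocol X M O) (c : CDModel) {ι : Type} (x : ι → X)
    (t : ℕ) (i : ι) (o : O) : Prop :=
  P.next (P.run c x t i) = .inr o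

/-- The energy spent by device `i` in the first `T` time slots. -/
noncomputable def energy (P : Protocol X M O) (c : CDModel) {ι : Type} (x : ι → X)
    (T : ℕ) (i : ι) : ℕ :=
  ∑ t ∈ Finset.range T, (P.actionAt c x t i).cost

/-- Start the second protocol from the output of the first if the first has halted. -/
def handOver (P : Protocol X M Y) (Q : Protocol Y M O) (s : P.State) : P.State ⊕ Q.State :=
  match P.next s with
  | .inl _ => .inl s
  | .inr y => .inr (Q.init y)

/-- Sequential composition: when a device halts in `P` with output `y`, it continues with `Q` on
input `y` in the next time slot. -/
def seq (P : Protocol X M Y) (Q : Protocol Y M O) : Protocol X M O where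
  State := P.State ⊕ Q.State
  init x := handOver P Q (P.init x)
  next
    | .inl s => .inl (P.action s)
    | .inr s => Q.next s
  update
    | .inl s, sig => handOver P Q (P.update s sig)
    | .inr s, sig => .inr (Q.update s sig)

end Protocol

/-! ### Inverse Ackermann function and dense Census -/

/-- The inverse Ackermann function: the least `k ≥ 1` with `x ≤ A(k, k)`. -/
noncomputable def invAck (x : ℝ) : ℕ :=
  sInf {k : ℕ | 1 ≤ k ∧ x ≤ (ack k k : ℝ)}

/-- An algorithm for Leader Election and Census on the ID space `{0, …, N - 1}`, for every `N`.
A device ends as the leader with a list `I` of IDs (output `some I`), or as a follower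
(output `none`). -/
abbrev CensusFamily (M : Type) : Type 1 :=
  ∀ N : ℕ, Protocol (Fin N) M (Option (Finset (Fin N)))

/-- The execution, with devices having exactly the IDs in `S`, solves Leader Election and Census in
`T` time slots: one device designates itself the leader and holds the list of all IDs, all others
designate themselves followers, and in the last slot the leader announces the list while all others
listen. The function `read` extracts the list from a message. -/
def SolvesCensus {M : Type} {N : ℕ} (P : Protocol (Fin N) M (Option (Finset (Fin N))))
    (read : M → Finset (Fin N)) (S : Finset (Fin N)) (T : ℕ) : Prop :=
  let x : S → Fin N := Subtype.val
  ∃ s : S, P.OutputAt .noCD x T s (some S) ∧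
    (∀ i, i ≠ s → P.OutputAt .noCD x T i none) ∧
    ∃ t m, T = t + 1 ∧ P.actionAt .noCD x t s = .transmit m ∧ read m = S ∧
      ∀ i, i ≠ s → P.actionAt .noCD x t i = .listen

/-- `D` is a deterministic `No-CD` algorithm that, whenever at least `c * N` of the `N` possible
devices are present, solves Leader Election and Census in time `O(N)` with energy `O(α(N))`.
It never lets two devices transmit in the same time slot. -/
def IsDenseCensus {M : Type} (c : ℝ) (D : CensusFamily M) : Prop :=
  ∃ (C : ℝ) (read : ∀ N : ℕ, M → Finset (Fin N)), ∀ N : ℕ, 1 ≤ N → ∀ S : Finset (Fin N),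
    (∀ (t : ℕ) (i j : S) (m m' : M),
      (D N).actionAt .noCD (Subtype.val : S → Fin N) t i = .transmit m →
      (D N).actionAt .noCD (Subtype.val : S → Fin N) t j = .transmit m' → i = j) ∧
    (c * N ≤ S.card → ∃ T : ℕ, (T : ℝ) ≤ C * N ∧ SolvesCensus (D N) (read N) S T ∧
      ∀ i : S, ((D N).energy .noCD (Subtype.val : S → Fin N) T i : ℝ) ≤ C * invAck N)

/-! ### Assigning IDs

Before the start each device tosses a coin for every slot in which it may have to transmit; these
slots are its tasks. A device with at least `β` tasks does not participate. In this phase the only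
message ever sent is the contentless message `none`. -/

open Classical in
/-- The slots in which a device transmits: those selected by its coins if these are fewer than `β`,
otherwise none. -/
noncomputable def tasks {L : ℕ} (β : ℕ) (coins : Fin L → Bool) : Finset ℕ :=
  let sel := (Finset.univ.filter fun j => coins j = true).image Fin.val
  if sel.card < β then sel else ∅

/-- The signal is a message. -/
def Signal.IsMessage {M : Type} (s : Signal M) : Prop := ∃ m, s = .message m

/-- Local state during the ID assignment. -/
structure AssignState (N : ℕ) where
  tasks : Finset ℕ
  slot : ℕ
  heard : Prop
  ids : Finset (Fin N)

open Classical in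
/-- ID assignment with sender-side collision detection, in `N` slots: a device that transmits in
slot `i` and hears its message takes the ID `i`. -/
noncomputable def assignDirect (M : Type) (N β : ℕ) :
    Protocol (Fin N → Bool) (Option M) (Finset (Fin N)) where
  State := AssignState N
  init coins := ⟨tasks β coins, 0, False, ∅⟩
  next s :=
    if s.slot < N then .inl (if s.slot ∈ s.tasks then .transmit none else .idle)
    else .inr s.ids
  update s sig :=
    { s with
      slot := s.slot + 1
      ids := if h : s.slot < N then
          (if s.slot ∈ s.tasks ∧ sig.IsMessage then insert ⟨s.slot, h⟩ s.ids else s.ids)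
        else s.ids }

open Classical in
/-- ID assignment without sender-side collision detection, in `N` blocks of four slots. In the
first two slots of block `i` the devices having the task `2 * i`, respectively `2 * i + 1`,
transmit. In the third slot the former speak and the latter listen. In the fourth slot the latter
speak if they received a message in the third slot, and the former listen; those of the former that
then receive a message take the ID `i`. (A device having both tasks speaks in the third slot and is
idle in the fourth one.) -/
noncomputable def assignPaired (M : Type) (N β : ℕ) :
    Protocol (Fin (2 * N) → Bool) (Option M) (Finset (Fin N)) where
  State := AssignState N
  init coins := ⟨tasks β coins, 0, False, ∅⟩
  next s :=
    let A : Prop := 2 * (s.slot / 4) ∈ s.tasks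
    let B : Prop := 2 * (s.slot / 4) + 1 ∈ s.tasks
    if s.slot < 4 * N then .inl <|
      match s.slot % 4 with
      | 0 => if A then .transmit none else .idle
      | 1 => if B then .transmit none else .idle
      | 2 => if A then .transmit none else if B then .listen else .idle
      | _ => if B ∧ s.heard then .transmit none else if A ∧ ¬ B then .listen else .idle
    else .inr s.ids
  update s sig :=
    let A : Prop := 2 * (s.slot / 4) ∈ s.tasks
    let B : Prop := 2 * (s.slot / 4) + 1 ∈ s.tasks
    { s with
      slot := s.slot + 1
      heard := s.slot % 4 = 2 ∧ B ∧ ¬ A ∧ sig.IsMessage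
      ids := if h : s.slot / 4 < N then
          (if s.slot % 4 = 3 ∧ A ∧ ¬ B ∧ sig.IsMessage then insert ⟨s.slot / 4, h⟩ s.ids
            else s.ids)
        else s.ids }

/-- The number of coins that each device tosses. -/
def CDModel.coinCount : CDModel → ℕ → ℕ
  | .strongCD, N => N
  | .senderCD, N => N
  | .receiverCD, N => 2 * N
  | .noCD, N => 2 * N

/-- The ID assignment used in each model. -/
noncomputable def assignIDs (M : Type) (N β : ℕ) : (c : CDModel) →
    Protocol (Fin (c.coinCount N) → Bool) (Option M) (Finset (Fin N))
  | .strongCD => assignDirect M N β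
  | .senderCD => assignDirect M N β
  | .receiverCD => assignPaired M N β
  | .noCD => assignPaired M N β

/-- The density parameter of the dense Census used in each model. -/
noncomputable def CDModel.density : CDModel → ℝ
  | .strongCD => 0.325
  | .senderCD => 0.325
  | .receiverCD => 0.325 ^ 2
  | .noCD => 0.325 ^ 2

/-! ### Running the dense Census on the assigned IDs -/

inductive Role where
  | leader
  | follower

/-- What a device does when the devices that it simulates together produce the channel state `ch`
and some of them listen iff `l`: it sends the message if there is one, it sends the contentless
message `none` if they already collide, and otherwise it listens if one of them does. -/
noncomputable def outerAction {M : Type} (ch : Signal M) (l : Prop) [Decidable l] :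
    Action (Option M) :=
  match ch with
  | .message m => .transmit (some m)
  | .noise => .transmit none
  | _ => if l then .listen else .idle

/-- What a simulated device that listens hears when the devices simulated by the same device
together produce the channel state `ch` and their common device receives the signal `sig`. -/
def innerSignal {M : Type} (ch : Signal M) (sig : Signal (Option M)) : Signal M :=
  match ch, sig with
  | .message m, _ => .message m
  | .noise, _ => .silence
  | _, .message (some m) => .message m
  | _, _ => .silence

open Classical in
/-- A device that holds the set `ids` of IDs simulates one device of the `No-CD` algorithm `D` for
each of these IDs. The device ends as the leader iff a device that it simulates ends as the leader
with a list of at least `c * N` IDs. -/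
noncomputable def simulate {M : Type} {N : ℕ} (c : ℝ)
    (D : Protocol (Fin N) M (Option (Finset (Fin N)))) :
    Protocol (Finset (Fin N)) (Option M) Role where
  State := Σ ids : Finset (Fin N), (ids → D.State)
  init ids := ⟨ids, fun k => D.init k⟩
  next := fun ⟨ids, v⟩ =>
    if ∀ k : ids, ∃ o, D.next (v k) = .inr o then
      .inr (if ∃ (k : ids) (I : Finset (Fin N)), D.next (v k) = .inr (some I) ∧ c * N ≤ I.card
        then .leader else .follower)
    else
      .inl (outerAction (channel fun k : ids => D.action (v k))
        (∃ k : ids, D.action (v k) = .listen))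
  update := fun ⟨ids, v⟩ sig =>
    ⟨ids, fun k => D.step (v k)
      (match D.action (v k) with
        | .listen => innerSignal (channel fun j : ids => D.action (v j)) sig
        | _ => .nothing)⟩

/-- The algorithm Test-Network-Size with `N` IDs, task bound `β` and dense Census algorithm `D`. -/
noncomputable def testNetworkSize {M : Type} (c : CDModel) (N β : ℕ) (D : CensusFamily M) :
    Protocol (Fin (c.coinCount N) → Bool) (Option M) Role :=
  (assignIDs M N β c).seq (simulate c.density (D N))

/-- After `T` time slots exactly one device is the leader and all others are followers. -/
def LeaderElected {X M ι : Type} (P : Protocol X M Role) (c : CDModel) (x : ι → X) (T : ℕ) : Prop :=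
  ∃ s, P.OutputAt c x T s .leader ∧ ∀ i, i ≠ s → P.OutputAt c x T i .follower

/-- After `T` time slots all devices are followers. -/
def NoLeaderElected {X M ι : Type} (P : Protocol X M Role) (c : CDModel) (x : ι → X) (T : ℕ) :
    Prop :=
  ∀ i, P.OutputAt c x T i .follower

open MeasureTheory in
/-- The joint law of the coins of `n` devices, each tossing `L` coins, all independent and
`true` with probability `p` (for `0 ≤ p ≤ 1`). -/
noncomputable def coinLaw (n L : ℕ) (p : ℝ) : Measure (Fin n → Fin L → Bool) :=
  Measure.pi fun _ => Measure.pi fun _ =>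
    ProbabilityTheory.bernoulliMeasure true false (Set.projIcc 0 1 zero_le_one p)

end RadioNetwork

/-! The theorem rests on two facts: the fraction of taken IDs separates good estimates from bad
ones, and a Census on a densely occupied ID space needs only inverse Ackermann energy.

Counting. With x = n / est, a slot has exactly one transmitter with probability about x * exp (-x),
which increases up to x = 1 and decreases afterwards. The true probability is at least 0.329 for
good estimates and at most 0.32 for bad ones (`le_soloProb`, `soloProb_le`). In the paired models
these values are squared, up to a factor 1 - 1 / n. The density lies strictly between, and a
Chernoff bound over the N = Θ(log est) independent blocks of slots makes errors polynomially
unlikely (`coinLaw_card_blocks`). The cap β on the tasks spoils independence, so two ranges of n are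
treated apart. If n ≤ est ^ h, then very likely no device reaches the cap
(`coinLaw_not_allParticipate`). If n is larger, then in each slot so many devices have that slot as
their only task that very likely nobody transmits alone (`coinLaw_exists_soleTask`); then no ID is
taken, as it should be. `exists_takenIDs_whp` combines the two.

Census. At stage i the ID space is cut into blocks of length 2 ^ i. An awake device of each block
announces the members of the block, and the devices awake at stage i + 1 listen to the two halves of
their new block. To save energy the stages form a forest: the devices of a block awake at stage p
are distributed by rank over the children of p, so a device wakes up at no more than one child of
each stage. Its energy is thus governed by the depth of the forest. A stage p may have 2 ^ (p / 4)
children, and iterating this growth lets depth m reach `ack m a` stages (`exists_wakeSegment`),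
whence the inverse Ackermann function.

A block with too few awake devices to serve all children gives up. An awake device at stage i stands
for a small block of length 2 ^ par i, and par i ≤ i / 2 whenever i has children, so stage i loses
at most a fraction 1 / (i * (i + 1)) of the ID space. These losses telescope to 1 / 64 in total
(`card_survivors_ge`). A positive fraction of a dense set therefore survives and learns the
surviving set. Each survivor then takes reports from dropped devices in its own window of 40 IDs,
the reports are passed along a chain of survivors, and the last survivor announces the union
(`denseCensus_spec`).

Combination. The Census has at most one sender per slot for every set of IDs, so all four models
give its listeners the same information, and a device can simulate its fewer than β IDs at a
constant factor in energy. The outcome for fixed coins is thus determined by the number of taken IDs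
(`testNetworkSize_spec`). -/

namespace RadioNetwork

/-! ### Wake-up forests -/

/-- A scheme of wake-up stages on the open interval `(a, b)`: stage `i` has the parent stage
`par i`, is its child number `idx i`, and lies `dep i ≤ m` levels below `a`. A stage `p` has at most
`2 ^ (p / 4)` children, and the parent of `p` is at most `p / 2` if `p` has children. -/
structure WakeSegment (m a b : ℕ) (par idx dep : ℕ → ℕ) : Prop where
  le_par : ∀ i, a < i → i < b → a ≤ par i
  par_lt : ∀ i, a < i → i < b → par i < i
  idx_lt : ∀ i, a < i → i < b → idx i < 2 ^ (par i / 4)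
  dep_le : ∀ i, a < i → i < b → dep i ≤ m
  dep_base : ∀ i, a < i → i < b → par i = a → dep i = 1
  dep_succ : ∀ i, a < i → i < b → par i ≠ a → dep i = dep (par i) + 1
  two_mul_par : ∀ i, a < i → i < b → par i ≠ a → 2 * par (par i) ≤ par i
  inj : ∀ i i', a < i → i < b → a < i' → i' < b → par i = par i' → idx i = idx i' → i = i'

/-- This fixes 64 as the first root with children. It provides room for 2 * a + 1 children of a
stage a, and it bounds the loss at stage i by a telescoping fraction. -/
lemma mul_succ_le_two_pow_div_four {i : ℕ} (hi : 64 ≤ i) : i * (i + 1) ≤ 2 ^ (i / 4) := by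
  have key : ∀ m : ℕ, 16 ≤ m → (4 * m + 3) * (4 * m + 4) ≤ 2 ^ m := by
    intro m hm
    induction m, hm using Nat.le_induction with
    | base => norm_num
    | succ m hm ih => rw [pow_succ]; nlinarith
  have h := key (i / 4) (by omega)
  have h1 : i ≤ 4 * (i / 4) + 3 := by omega
  calc i * (i + 1) ≤ (4 * (i / 4) + 3) * (4 * (i / 4) + 4) := Nat.mul_le_mul h1 (by omega)
    _ ≤ _ := h

/-- The recursion of the Ackermann function is the recursion of the tree: a tree of depth m + 1
below a is a sequence of children of a, each followed by the tree of depth m below it, so every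
child applies `ack m` once more to the position reached. -/
lemma exists_wakeSegment (m : ℕ) : ∀ a, 64 ≤ a →
    ∃ b par idx dep, ack m a ≤ b ∧ WakeSegment m a b par idx dep := by
  induction m with
  | zero =>
    intro a _
    refine ⟨a + 1, id, id, id, by simp, ?_⟩
    constructor <;> intros <;> omega
  | succ m ih =>
    intro a ha
    -- The induction is on the number n of children of a. The first a of them only push the position
    -- up to 2 * a; from then on each child may carry a subtree.
    have key : ∀ n, n ≤ 2 ^ (a / 4) → ∃ b par idx dep, a + 1 + n ≤ b ∧
        (∀ k, n = a + k + 1 → ack (m + 1) k ≤ b) ∧ WakeSegment (m + 1) a b par idx dep ∧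
        ∀ i, a < i → i < b → par i = a → idx i < n := by
      intro n
      induction n with
      | zero =>
        intro _
        refine ⟨a + 1, id, id, id, by omega, by intros; omega, ?_, by intros; omega⟩
        constructor <;> intros <;> omega
      | succ n ihn =>
        intro hn
        obtain ⟨b, par, idx, dep, hb, hack, hseg, hidx⟩ := ihn (by omega)
        obtain ⟨b', par', idx', dep', hbb', hack', hseg'⟩ : ∃ b' par' idx' dep', b < b' ∧
            (2 * a ≤ b → ack m b ≤ b') ∧ (WakeSegment m b b' par' idx' dep' ∧
              (2 * a ≤ b ∨ b' = b + 1)) := by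
          by_cases h2 : 2 * a ≤ b
          · obtain ⟨b', par', idx', dep', h1, h3⟩ := ih b (by omega)
            exact ⟨b', par', idx', dep', (lt_ack_right m b).trans_le h1, fun _ => h1, h3, .inl h2⟩
          -- A child b < 2 * a would violate `two_mul_par` if it had children, so it stays a leaf
          -- and occupies one stage.
          · refine ⟨b + 1, id, id, id, by omega, fun h => absurd h h2, ?_, .inr rfl⟩
            constructor <;> intros <;> omega
        obtain ⟨hseg', hor⟩ := hseg'
        refine ⟨b', fun i => if i < b then par i else if i = b then a else par' i,
          fun i => if i < b then idx i else if i = b then n else idx' i,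
          fun i => if i < b then dep i else if i = b then 1 else dep' i + 1,
          by omega, ?_, ?_, ?_⟩
        · intro k hk
          have h2 : ack m b ≤ b' := hack' (by omega)
          refine le_trans ?_ h2
          cases k with
          | zero => rw [ack_succ_zero]; exact ack_mono_right m (by omega)
          | succ k => rw [ack_succ_succ]; exact ack_mono_right m (hack k (by omega))
        · have cases3 : ∀ i, i < b' → i < b ∨ i = b ∨ (b < i ∧ i < b' ∧ 2 * a ≤ b) := by
            intro i hi; omega
          constructor
          · intro i h1 h2
            rcases cases3 i h2 with h | rfl | ⟨h, h', h2a⟩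
            · simpa [h] using hseg.le_par i h1 h
            · simp
            · have := hseg'.le_par i h h'
              simp [not_lt_of_gt h, h.ne']; omega
          · intro i h1 h2
            rcases cases3 i h2 with h | rfl | ⟨h, h', h2a⟩
            · simpa [h] using hseg.par_lt i h1 h
            · simpa using h1
            · have := hseg'.par_lt i h h'
              simp [not_lt_of_gt h, h.ne']; omega
          · intro i h1 h2
            rcases cases3 i h2 with h | rfl | ⟨h, h', h2a⟩
            · simpa [h] using hseg.idx_lt i h1 h
            · simpa using hn
            · simpa [not_lt_of_gt h, h.ne'] using hseg'.idx_lt i h h'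
          · intro i h1 h2
            rcases cases3 i h2 with h | rfl | ⟨h, h', h2a⟩
            · simpa [h] using hseg.dep_le i h1 h
            · simp
            · simpa [not_lt_of_gt h, h.ne'] using hseg'.dep_le i h h'
          · intro i h1 h2
            rcases cases3 i h2 with h | rfl | ⟨h, h', h2a⟩
            · simpa [h] using hseg.dep_base i h1 h
            · simp
            · have := hseg'.le_par i h h'
              simp [not_lt_of_gt h, h.ne']; omega
          · intro i h1 h2
            rcases cases3 i h2 with h | rfl | ⟨h, h', h2a⟩
            · have := hseg.par_lt i h1 h
              have h5 : par i < b := by omega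
              simpa [h, h5] using hseg.dep_succ i h1 h
            · simp
            · have h5 := hseg'.le_par i h h'
              by_cases h6 : par' i = b
              · simp [not_lt_of_gt h, h.ne', h6, hseg'.dep_base i h h' h6]
              · have h7 : ¬ par' i < b := by omega
                simp [not_lt_of_gt h, h.ne', h6, h7, hseg'.dep_succ i h h' h6]
          · intro i h1 h2
            rcases cases3 i h2 with h | rfl | ⟨h, h', h2a⟩
            · have := hseg.par_lt i h1 h
              have h5 : par i < b := by omega
              simpa [h, h5] using hseg.two_mul_par i h1 h
            · simp
            · have h5 := hseg'.le_par i h h'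
              by_cases h6 : par' i = b
              · simp [not_lt_of_gt h, h.ne', h6, h2a]
              · have h7 : ¬ par' i < b := by omega
                simpa [not_lt_of_gt h, h.ne', h6, h7] using fun _ => hseg'.two_mul_par i h h' h6
          · intro i i' h1 h2 h1' h2'
            rcases cases3 i h2 with h | rfl | ⟨h, h', h2a⟩
            · have hp := hseg.par_lt i h1 h
              rcases cases3 i' h2' with g | rfl | ⟨g, g', g2a⟩
              · simpa [h, g] using hseg.inj i i' h1 h h1' g
              · simp only [h, if_true, lt_irrefl, if_false]
                intro e1 e2; have := hidx i h1 h e1; omega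
              · have := hseg'.le_par i' g g'
                simp only [h, if_true, not_lt_of_gt g, g.ne', if_false]; omega
            · rcases cases3 i' h2' with g | rfl | ⟨g, g', g2a⟩
              · simp only [g, if_true, lt_irrefl, if_false]
                intro e1 e2; have := hidx i' h1' g e1.symm; omega
              · simp
              · have := hseg'.le_par i' g g'
                simp only [lt_irrefl, if_true, not_lt_of_gt g, g.ne', if_false]; omega
            · have hp := hseg'.le_par i h h'
              rcases cases3 i' h2' with g | rfl | ⟨g, g', g2a⟩
              · have := hseg.par_lt i' h1' g
                simp only [g, if_true, not_lt_of_gt h, h.ne', if_false]; omega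
              · simp only [lt_irrefl, if_true, not_lt_of_gt h, h.ne', if_false]; omega
              · simpa [not_lt_of_gt h, h.ne', not_lt_of_gt g, g.ne']
                  using hseg'.inj i i' h h' g g'
        · intro i h1 h2
          have hi : i < b ∨ i = b ∨ (b < i ∧ i < b' ∧ 2 * a ≤ b) := by omega
          rcases hi with h | rfl | ⟨h, h', h2a⟩
          · simp only [h, if_true]; intro e; have := hidx i h1 h e; omega
          · simp
          · have := hseg'.le_par i h h'
            simp only [not_lt_of_gt h, h.ne', if_false]; omega
    -- Take a children to reach 2 * a, then a + 1 applications of `ack m`, which make up `ack (m +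
    -- 1) a`.
    obtain ⟨b, par, idx, dep, _, hack, hseg, _⟩ := key (a + a + 1)
      (le_trans (by nlinarith) (mul_succ_le_two_pow_div_four ha))
    exact ⟨b, par, idx, dep, hack a rfl, hseg⟩

/-- The wake-up scheme for `L` stages: the stages up to `64` and from `L` on are roots, and the
stages between are at most `k + 1` levels below the root `64`. -/
structure WakeForest (L k : ℕ) where
  par : ℕ → ℕ
  idx : ℕ → ℕ
  dep : ℕ → ℕ
  seg : WakeSegment (k + 1) 64 L par idx dep

/-- One tree of depth k + 1 below the root 64 suffices, since `ack (k + 1) 64` equals `ack k (ack (k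
+ 1) 63)` and the inner value exceeds k. Truncating a segment at L keeps all its properties because
parents are smaller. -/
lemma nonempty_wakeForest {L k : ℕ} (h : L ≤ ack k k) : Nonempty (WakeForest L k) := by
  obtain ⟨b, par, idx, dep, hb, hs⟩ := exists_wakeSegment (k + 1) 64 le_rfl
  have h1 : ack k k ≤ ack (k + 1) 64 := by
    rw [ack_succ_succ]
    exact ack_mono_right k (by have := add_lt_ack (k + 1) 63; omega)
  have hL : L ≤ b := by omega
  exact ⟨⟨par, idx, dep,
    fun i h1 h2 => hs.le_par i h1 (by omega), fun i h1 h2 => hs.par_lt i h1 (by omega),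
    fun i h1 h2 => hs.idx_lt i h1 (by omega), fun i h1 h2 => hs.dep_le i h1 (by omega),
    fun i h1 h2 => hs.dep_base i h1 (by omega), fun i h1 h2 => hs.dep_succ i h1 (by omega),
    fun i h1 h2 => hs.two_mul_par i h1 (by omega),
    fun i i' h1 h2 h3 h4 => hs.inj i i' h1 (by omega) h3 (by omega)⟩⟩

end RadioNetwork

/-! ### Ranks in dyadic blocks, wake-up sets and surviving blocks -/

namespace RadioNetwork

/-- The number of elements of `U` below `x` that lie in the same block of length `2 ^ p`. -/
def blockRank (U : Finset ℕ) (p x : ℕ) : ℕ :=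
  (U.filter fun y => y / 2 ^ p = x / 2 ^ p ∧ y < x).card

lemma blockRank_congr {U U' : Finset ℕ} {p x : ℕ}
    (h : ∀ y, y / 2 ^ p = x / 2 ^ p → (y ∈ U ↔ y ∈ U')) : blockRank U p x = blockRank U' p x := by
  unfold blockRank
  congr 1
  ext y
  simp only [Finset.mem_filter]
  constructor
  · rintro ⟨h1, h2, h3⟩; exact ⟨(h y h2).1 h1, h2, h3⟩
  · rintro ⟨h1, h2, h3⟩; exact ⟨(h y h2).2 h1, h2, h3⟩

lemma blockRank_lt_blockRank {U : Finset ℕ} {p x y : ℕ} (hx : x ∈ U)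
    (hb : x / 2 ^ p = y / 2 ^ p) (h : x < y) : blockRank U p x < blockRank U p y := by
  unfold blockRank
  refine Finset.card_lt_card (Finset.ssubset_iff_of_subset ?_ |>.2 ⟨x, ?_, ?_⟩)
  · intro z
    simp only [Finset.mem_filter]
    rintro ⟨h1, h2, h3⟩; exact ⟨h1, h2.trans hb, h3.trans h⟩
  · simp [hx, hb, h]
  · simp

lemma blockRank_inj {U : Finset ℕ} {p x y : ℕ} (hx : x ∈ U) (hy : y ∈ U)
    (hb : x / 2 ^ p = y / 2 ^ p) (h : blockRank U p x = blockRank U p y) : x = y := by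
  rcases lt_trichotomy x y with h1 | h1 | h1
  · exact absurd h (blockRank_lt_blockRank hx hb h1).ne
  · exact h1
  · exact absurd h (blockRank_lt_blockRank hy hb.symm h1).ne'

lemma exists_blockRank_eq {U : Finset ℕ} {p c j : ℕ}
    (h : j < (U.filter fun y => y / 2 ^ p = c).card) :
    ∃ y ∈ U, y / 2 ^ p = c ∧ blockRank U p y = j := by
  set V := U.filter fun y => y / 2 ^ p = c with hV
  have hf : (Set.ofPred (· ∈ V)).Finite := V.finite_toSet
  have hj : j < hf.toFinset.card := by
    have : hf.toFinset = V := by ext y; rw [Set.Finite.mem_toFinset]; rfl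
    rwa [this]
  have hy : Nat.nth (· ∈ V) j ∈ V := Nat.nth_mem_of_lt_card hf hj
  have hc := Nat.count_nth_of_lt_card_finite hf hj
  set y := Nat.nth (· ∈ V) j with hydef
  have hy' := hy
  simp only [hV, Finset.mem_filter] at hy'
  refine ⟨y, hy'.1, hy'.2, ?_⟩
  rw [← hc, Nat.count_eq_card_filter_range]
  unfold blockRank
  congr 1
  ext z
  simp only [hV, Finset.mem_filter, Finset.mem_range, hy'.2]
  tauto

lemma div_two_pow_eq_of_le {p s x y : ℕ} (h : p ≤ s) (hxy : y / 2 ^ p = x / 2 ^ p) :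
    y / 2 ^ s = x / 2 ^ s := by
  obtain ⟨d, rfl⟩ := Nat.exists_eq_add_of_le h
  rw [pow_add, ← Nat.div_div_eq_div_mul, ← Nat.div_div_eq_div_mul, hxy]

lemma card_filter_div_le (D : Finset ℕ) (u b : ℕ) :
    (D.filter fun y => y / 2 ^ u = b).card ≤ 2 ^ u := by
  have : (D.filter fun y => y / 2 ^ u = b) ⊆ Finset.Ico (b * 2 ^ u) ((b + 1) * 2 ^ u) := by
    intro y
    simp only [Finset.mem_filter, Finset.mem_Ico]
    rintro ⟨_, rfl⟩
    exact ⟨Nat.div_mul_le_self _ _, by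
      have := Nat.lt_div_mul_add (a := y) (b := 2 ^ u) (by positivity)
      nlinarith⟩
  calc _ ≤ _ := Finset.card_le_card this
    _ = 2 ^ u := by rw [Nat.card_Ico, ← Nat.sub_mul]; simp

namespace WakeForest

variable {L k : ℕ} (F : WakeForest L k)

/-- The devices that wake up at stage `i` when `A` is the set of surviving devices: all at a root,
and otherwise those whose rank among the devices of their block that were awake at the parent
stage is the index of `i`. -/
def awake (A : Finset ℕ) (i : ℕ) : Finset ℕ :=
  if _h : 64 < i ∧ i < L then
    (awake A (F.par i)).filter fun x => blockRank (awake A (F.par i)) (F.par i) x = F.idx i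
  else A
termination_by i
decreasing_by all_goals exact F.seg.par_lt i _h.1 _h.2

lemma awake_root {A : Finset ℕ} {i : ℕ} (h : ¬(64 < i ∧ i < L)) : F.awake A i = A := by
  rw [awake, dif_neg h]

lemma mem_awake {A : Finset ℕ} {i x : ℕ} (h : 64 < i) (h' : i < L) :
    x ∈ F.awake A i ↔
      x ∈ F.awake A (F.par i) ∧ blockRank (F.awake A (F.par i)) (F.par i) x = F.idx i := by
  rw [awake, dif_pos ⟨h, h'⟩, Finset.mem_filter]

lemma awake_subset (A : Finset ℕ) (i : ℕ) : F.awake A i ⊆ A := by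
  induction i using Nat.strong_induction_on with
  | _ i ih =>
    by_cases h : 64 < i ∧ i < L
    · intro x hx
      exact ih _ (F.seg.par_lt i h.1 h.2) ((F.mem_awake h.1 h.2).1 hx).1
    · rw [F.awake_root h]

/-- Locality of waking up: only ranks in blocks of length 2 ^ p for proper ancestors p of i enter
the rule. A device that knows its block at stage `par i` can therefore decide whether it wakes up at
i. -/
lemma mem_awake_congr {A A' : Finset ℕ} (s : ℕ) {i : ℕ} (hi : 64 < i → i < L → F.par i ≤ s) {x : ℕ}
    (h : ∀ y, y / 2 ^ s = x / 2 ^ s → (y ∈ A ↔ y ∈ A')) :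
    x ∈ F.awake A i ↔ x ∈ F.awake A' i := by
  induction i using Nat.strong_induction_on generalizing x with
  | _ i ih =>
    by_cases hr : 64 < i ∧ i < L
    · obtain ⟨h1, h2⟩ := hr
      have hlt := F.seg.par_lt i h1 h2
      have hps := hi h1 h2
      have key : ∀ y, y / 2 ^ F.par i = x / 2 ^ F.par i →
          (y ∈ F.awake A (F.par i) ↔ y ∈ F.awake A' (F.par i)) := by
        intro y hy
        have hys := div_two_pow_eq_of_le hps hy
        refine ih _ hlt (fun g1 g2 => ?_) (fun z hz => h z (hz.trans hys))
        exact (F.seg.par_lt _ g1 g2).le.trans hps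
      rw [F.mem_awake h1 h2, F.mem_awake h1 h2, key x rfl, blockRank_congr key]
    · rw [F.awake_root hr, F.awake_root hr]
      exact h x rfl

/-- A device awake at i is awake at all ancestors of i, so one climbs from i to the last stage above
a before the parent drops to a or below. That stage is decided by knowledge from stage a. -/
lemma exists_mem_awake_of_lt {A : Finset ℕ} {a i x : ℕ} (hx : x ∈ F.awake A i) (ha : a < i) :
    ∃ b, a < b ∧ b ≤ i ∧ (64 < b → b < L → F.par b ≤ a) ∧ x ∈ F.awake A b := by
  induction i using Nat.strong_induction_on with
  | _ i ih =>
    by_cases h : 64 < i ∧ i < L ∧ a < F.par i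
    · obtain ⟨h1, h2, h3⟩ := h
      have hlt := F.seg.par_lt i h1 h2
      obtain ⟨b, hb, hb', hb2, hb3⟩ := ih _ hlt ((F.mem_awake h1 h2).1 hx).1 h3
      exact ⟨b, hb, by omega, hb2, hb3⟩
    · exact ⟨i, ha, le_rfl, fun h1 h2 => by by_contra h3; exact h ⟨h1, h2, by omega⟩, hx⟩

/-- The logarithm of the block length for which the devices awake at stage `i` stand. -/
def unit (i : ℕ) : ℕ := if 64 < i ∧ i < L then F.par i else 0

/-- A block in which fewer devices are awake at stage `i` gives up. -/
def threshold (i : ℕ) : ℕ := if 64 ≤ i ∧ 2 * F.unit i ≤ i then 2 ^ (i / 4) else 1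

lemma one_le_threshold (i : ℕ) : 1 ≤ F.threshold i := by
  unfold threshold; split_ifs
  · exact Nat.one_le_two_pow
  · rfl

/-- The devices whose blocks have not given up before stage `i`. -/
def survivors (S : Finset ℕ) : ℕ → Finset ℕ
  | 0 => S
  | i + 1 => (survivors S i).filter fun x =>
      F.threshold i ≤ ((F.awake (survivors S i) i).filter fun y => y / 2 ^ i = x / 2 ^ i).card

lemma mem_survivors_succ {S : Finset ℕ} {i x : ℕ} : x ∈ F.survivors S (i + 1) ↔
    x ∈ F.survivors S i ∧ F.threshold i ≤
      ((F.awake (F.survivors S i) i).filter fun y => y / 2 ^ i = x / 2 ^ i).card := by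
  rw [survivors, Finset.mem_filter]

lemma survivors_anti (S : Finset ℕ) {i j : ℕ} (h : i ≤ j) : F.survivors S j ⊆ F.survivors S i := by
  induction j, h using Nat.le_induction with
  | base => rfl
  | succ j _ ih => exact fun x hx => ih (F.mem_survivors_succ.1 hx).1

lemma survivors_subset (S : Finset ℕ) (i : ℕ) : F.survivors S i ⊆ S :=
  F.survivors_anti S (Nat.zero_le i)

/-- Blocks give up as a whole and are nested, so devices sharing a block at stage a share their fate
from then on. Old knowledge of a surviving block is thus never outdated. -/
lemma mem_survivors_of_block {S : Finset ℕ} {a i x y : ℕ} (h : a ≤ i) (hx : x ∈ F.survivors S i)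
    (hxy : y / 2 ^ a = x / 2 ^ a) (hy : y ∈ F.survivors S a) : y ∈ F.survivors S i := by
  induction i, h using Nat.le_induction with
  | base => exact hy
  | succ i hi ih =>
    obtain ⟨h1, h2⟩ := F.mem_survivors_succ.1 hx
    refine F.mem_survivors_succ.2 ⟨ih h1, ?_⟩
    rwa [div_two_pow_eq_of_le hi hxy]

lemma mem_survivors_iff_of_block {S : Finset ℕ} {a i x y : ℕ} (h : a ≤ i)
    (hx : x ∈ F.survivors S i) (hxy : y / 2 ^ a = x / 2 ^ a) :
    y ∈ F.survivors S i ↔ y ∈ F.survivors S a :=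
  ⟨fun hy => F.survivors_anti S h hy, F.mem_survivors_of_block h hx hxy⟩

/-- What device `x` may know before stage `i`: the surviving devices of its block at the last stage
`a` at which it was awake. -/
def Knows (S : Finset ℕ) (i x : ℕ) (K : Finset ℕ) : Prop :=
  ∃ a ≤ i, K = (F.survivors S a).filter (fun y => y / 2 ^ a = x / 2 ^ a) ∧
    ∀ b, a < b → b ≤ i → x ∉ F.awake K b

lemma knows_zero {S : Finset ℕ} {x : ℕ} (hx : x ∈ S) : F.Knows S 0 x {x} := by
  refine ⟨0, le_rfl, ?_, fun b h1 h2 => by omega⟩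
  ext y
  simp only [Finset.mem_singleton, survivors, Finset.mem_filter, pow_zero, Nat.div_one]
  constructor
  · rintro rfl; exact ⟨hx, rfl⟩
  · exact fun h => h.2

lemma Knows.eq_of_mem {S K : Finset ℕ} {i x : ℕ} (h : F.Knows S i x K) (hx : x ∈ F.awake K i) :
    K = (F.survivors S i).filter fun y => y / 2 ^ i = x / 2 ^ i := by
  obtain ⟨a, ha, hK, hb⟩ := h
  rcases ha.lt_or_eq with h1 | rfl
  · exact absurd hx (hb i h1 le_rfl)
  · exact hK

lemma mem_awake_survivors_block {S : Finset ℕ} {i x y : ℕ} (hxy : y / 2 ^ i = x / 2 ^ i) :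
    y ∈ F.awake ((F.survivors S i).filter fun y => y / 2 ^ i = x / 2 ^ i) i ↔
      y ∈ F.awake (F.survivors S i) i := by
  refine F.mem_awake_congr i (fun h1 h2 => (F.seg.par_lt i h1 h2).le) fun z hz => ?_
  simp [Finset.mem_filter, hz.trans hxy]

/-- Local knowledge decides true wakefulness. A surviving device that should be awake at i but was
last awake at a < i would, by its own knowledge, have been awake at some ancestor stage in between.
-/
lemma Knows.mem_awake_iff {S K : Finset ℕ} {i x : ℕ} (h : F.Knows S i x K) :
    x ∈ F.awake K i ↔ x ∈ F.awake (F.survivors S i) i := by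
  constructor
  · intro hx
    have hK := h.eq_of_mem F hx
    rw [hK] at hx
    exact (F.mem_awake_survivors_block rfl).1 hx
  · intro hx
    obtain ⟨a, ha, hK, hb⟩ := h
    rcases ha.lt_or_eq with h1 | rfl
    · obtain ⟨b, hab, hbi, hpar, hxb⟩ := F.exists_mem_awake_of_lt hx h1
      refine absurd ?_ (hb b hab hbi)
      refine (F.mem_awake_congr a hpar fun y hy => ?_).1 hxb
      rw [hK, Finset.mem_filter,
        F.mem_survivors_iff_of_block ha (F.awake_subset _ _ hx) hy]
      simp [hy]
    · rw [hK]; exact (F.mem_awake_survivors_block rfl).2 hx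

lemma Knows.succ_of_notMem {S K : Finset ℕ} {i x : ℕ} (h : F.Knows S i x K)
    (hx : x ∉ F.awake K (i + 1)) : F.Knows S (i + 1) x K := by
  obtain ⟨a, ha, hK, hb⟩ := h
  refine ⟨a, by omega, hK, fun b h1 h2 => ?_⟩
  rcases Nat.lt_or_eq_of_le h2 with h3 | rfl
  · exact hb b h1 (by omega)
  · exact hx

lemma knows_survivors (S : Finset ℕ) (i x : ℕ) :
    F.Knows S i x ((F.survivors S i).filter fun y => y / 2 ^ i = x / 2 ^ i) :=
  ⟨i, le_rfl, rfl, fun b h1 h2 => by omega⟩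

/-- Device `x` wakes up at the non-root stage `i`, unless its block has given up meanwhile. -/
def Candidate (S : Finset ℕ) (x i : ℕ) : Prop :=
  64 < i ∧ i < L ∧ x ∈ F.awake (F.survivors S (F.par i)) i

/-- Listening is charged to candidates rather than to awake survivors: a device whose block has
given up without its noticing still wakes up and listens in vain. -/
lemma Knows.candidate {S K : Finset ℕ} {i x : ℕ} (h : F.Knows S i x K)
    (hx : x ∈ F.awake K (i + 1)) (h1 : 64 < i + 1) (h2 : i + 1 < L) :
    F.Candidate S x (i + 1) := by
  refine ⟨h1, h2, ?_⟩
  obtain ⟨a, ha, hK, hb⟩ := h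
  have hlt := F.seg.par_lt _ h1 h2
  have hxp := ((F.mem_awake h1 h2).1 hx).1
  have hpa : F.par (i + 1) ≤ a := by
    by_contra hcon
    exact hb _ (by omega) (by omega) hxp
  have hxK : x ∈ K := F.awake_subset _ _ hx
  rw [hK, Finset.mem_filter] at hxK
  refine (F.mem_awake_congr (F.par (i + 1)) (fun _ _ => le_rfl) fun y hy => ?_).1 hx
  rw [hK, Finset.mem_filter, F.mem_survivors_iff_of_block hpa hxK.1 hy]
  simp [div_two_pow_eq_of_le hpa hy]

lemma candidate_of_mem_awake {S : Finset ℕ} {i x : ℕ} (h1 : 64 < i) (h2 : i < L)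
    (hx : x ∈ F.awake (F.survivors S i) i) : F.Candidate S x i := by
  refine ⟨h1, h2, ?_⟩
  refine (F.mem_awake_congr (F.par i) (fun _ _ => le_rfl) fun y hy => ?_).1 hx
  exact F.mem_survivors_iff_of_block (F.seg.par_lt i h1 h2).le (F.awake_subset _ _ hx) hy

lemma Candidate.mem_par {S : Finset ℕ} {i x : ℕ} (h : F.Candidate S x i) :
    x ∈ F.awake (F.survivors S (F.par i)) (F.par i) ∧
      blockRank (F.awake (F.survivors S (F.par i)) (F.par i)) (F.par i) x = F.idx i :=
  (F.mem_awake h.1 h.2.1).1 h.2.2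

lemma Candidate.par {S : Finset ℕ} {i x : ℕ} (h : F.Candidate S x i) (hp : F.par i ≠ 64) :
    F.Candidate S x (F.par i) := by
  have h1 := F.seg.par_lt i h.1 h.2.1
  have h2 := F.seg.le_par i h.1 h.2.1
  have h3 := h.2.1
  exact F.candidate_of_mem_awake (by omega) (by omega) h.mem_par.1

lemma one_le_dep {i : ℕ} (h1 : 64 < i) (h2 : i < L) : 1 ≤ F.dep i := by
  by_cases h : F.par i = 64
  · rw [F.seg.dep_base i h1 h2 h]
  · rw [F.seg.dep_succ i h1 h2 h]; omega

/-- The stages of a device form a single downward path in the forest, because its rank at a stage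
picks out one child at most. Hence there is at most one of them per depth. -/
lemma Candidate.eq_of_dep_eq {S : Finset ℕ} {i i' x : ℕ} (h : F.Candidate S x i)
    (h' : F.Candidate S x i') (hd : F.dep i = F.dep i') : i = i' := by
  induction i using Nat.strong_induction_on generalizing i' with
  | _ i ih =>
    have hlt := F.seg.par_lt i h.1 h.2.1
    have hpar : F.par i = F.par i' := by
      by_cases hp : F.par i = 64
      · by_cases hp' : F.par i' = 64
        · rw [hp, hp']
        · have hc := Candidate.par F h' hp'
          have := F.one_le_dep hc.1 hc.2.1
          rw [F.seg.dep_base i h.1 h.2.1 hp, F.seg.dep_succ i' h'.1 h'.2.1 hp'] at hd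
          omega
      · have hc := Candidate.par F h hp
        have := F.one_le_dep hc.1 hc.2.1
        by_cases hp' : F.par i' = 64
        · rw [F.seg.dep_base i' h'.1 h'.2.1 hp', F.seg.dep_succ i h.1 h.2.1 hp] at hd
          omega
        · have hc' := Candidate.par F h' hp'
          rw [F.seg.dep_succ i' h'.1 h'.2.1 hp', F.seg.dep_succ i h.1 h.2.1 hp] at hd
          exact ih _ hlt hc hc' (by omega)
    refine F.seg.inj i i' h.1 h.2.1 h'.1 h'.2.1 hpar ?_
    rw [← (h.mem_par).2, ← (h'.mem_par).2, hpar]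

-- This is the energy bound in combinatorial form: 65 roots from 0 to 64, at most k + 1 stages on
-- the path below 64, and the roots from L on.
open Classical in
lemma card_candidate_le (S : Finset ℕ) (x n : ℕ) :
    ((Finset.range n).filter fun i => i ≤ 64 ∨ L ≤ i ∨ F.Candidate S x i).card ≤
      k + 66 + (n - L) := by
  have h1 : ((Finset.range n).filter fun i => i ≤ 64 ∨ L ≤ i ∨ F.Candidate S x i) ⊆
      (Finset.range 65 ∪ Finset.Ico L n) ∪ (Finset.range n).filter fun i => F.Candidate S x i := by
    intro i
    simp only [Finset.mem_filter, Finset.mem_union, Finset.mem_range, Finset.mem_Ico]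
    rintro ⟨h, h1 | h1 | h1⟩
    · exact .inl (.inl (by omega))
    · exact .inl (.inr ⟨h1, h⟩)
    · exact .inr ⟨h, h1⟩
  have h2 : ((Finset.range n).filter fun i => F.Candidate S x i).card ≤
      (Finset.Icc 1 (k + 1)).card := by
    refine Finset.card_le_card_of_injOn F.dep (fun i hi => ?_) (fun i hi i' hi' hd => ?_)
    · have hc := (Finset.mem_filter.1 hi).2
      exact Finset.mem_coe.2 (Finset.mem_Icc.2
        ⟨F.one_le_dep hc.1 hc.2.1, F.seg.dep_le i hc.1 hc.2.1⟩)
    · exact Candidate.eq_of_dep_eq F (Finset.mem_filter.1 hi).2 (Finset.mem_filter.1 hi').2 hd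
  have h3 := Finset.card_le_card h1
  have h4 := Finset.card_union_le (Finset.range 65 ∪ Finset.Ico L n)
    ((Finset.range n).filter fun i => F.Candidate S x i)
  have h5 := Finset.card_union_le (Finset.range 65) (Finset.Ico L n)
  simp only [Finset.card_range, Nat.card_Ico, Nat.card_Icc] at h2 h5
  omega

/-- In each small block that survives up to stage `i` some device is awake. -/
lemma exists_mem_awake_unit {S : Finset ℕ} {i x : ℕ} (hx : x ∈ F.survivors S i) :
    ∃ y ∈ F.awake (F.survivors S i) i, y / 2 ^ F.unit i = x / 2 ^ F.unit i := by
  unfold unit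
  by_cases h : 64 < i ∧ i < L
  · rw [if_pos h]
    have hlt := F.seg.par_lt i h.1 h.2
    have hge := F.seg.le_par i h.1 h.2
    set p := F.par i with hp
    have hxp : x ∈ F.survivors S (p + 1) := F.survivors_anti S hlt hx
    obtain ⟨_, hcard⟩ := F.mem_survivors_succ.1 hxp
    -- Since p has a child, either p is the root 64 or `two_mul_par` applies, so the large threshold
    -- is in force at p.
    have hthr : F.threshold p = 2 ^ (p / 4) := by
      unfold threshold
      refine if_pos ⟨hge, ?_⟩
      unfold unit
      split_ifs with hr
      · exact F.seg.two_mul_par i h.1 h.2 (by omega)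
      · omega
    have hidx := F.seg.idx_lt i h.1 h.2
    -- Having passed the threshold at p, the block holds a device of every rank that a child of p
    -- may ask for.
    rw [← hp, ← hthr] at hidx
    obtain ⟨y, hy, hyx, hrank⟩ := exists_blockRank_eq (hidx.trans_le hcard)
    refine ⟨y, ?_, hyx⟩
    have hagree : ∀ z, z / 2 ^ p = y / 2 ^ p →
        (z ∈ F.survivors S p ↔ z ∈ F.survivors S i) := fun z hz =>
      (F.mem_survivors_iff_of_block hlt.le hx (hz.trans hyx)).symm
    rw [F.mem_awake h.1 h.2, ← hp, ← hrank]
    have hpp : 64 < p → p < L → F.par p ≤ p := fun g1 g2 => (F.seg.par_lt p g1 g2).le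
    refine ⟨(F.mem_awake_congr p hpp hagree).1 hy, blockRank_congr fun z hz => ?_⟩
    exact (F.mem_awake_congr p hpp fun w hw => (hagree w (hw.trans hz)).symm)
  · rw [if_neg h, F.awake_root h]
    exact ⟨x, hx, rfl⟩

/-- There are 2 ^ (L - i) blocks. One that gives up has fewer awake devices than the threshold, and
every small block of length 2 ^ `unit i` that meets the survivors contains an awake device. -/
lemma mul_card_sdiff_survivors_le {S : Finset ℕ} (hS : ∀ x ∈ S, x < 2 ^ L) {i : ℕ} (hi : i < L) :
    (F.survivors S i \ F.survivors S (i + 1)).card ≤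
      2 ^ F.unit i * (F.threshold i - 1) * 2 ^ (L - i) := by
  have hmaps : ∀ x ∈ F.survivors S i \ F.survivors S (i + 1),
      x / 2 ^ i ∈ Finset.range (2 ^ (L - i)) := by
    intro x hx
    rw [Finset.mem_range, Nat.div_lt_iff_lt_mul (by positivity), ← pow_add,
      Nat.sub_add_cancel hi.le]
    exact hS x (F.survivors_subset S i (Finset.mem_sdiff.1 hx).1)
  refine (Finset.card_le_mul_card_image_of_maps_to hmaps
    (2 ^ F.unit i * (F.threshold i - 1)) fun b _ => ?_).trans (by rw [Finset.card_range])
  rcases Finset.eq_empty_or_nonempty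
    ((F.survivors S i \ F.survivors S (i + 1)).filter fun x => x / 2 ^ i = b) with he | ⟨x0, hx0⟩
  · rw [he]; simp
  · simp only [Finset.mem_filter, Finset.mem_sdiff, F.mem_survivors_succ] at hx0
    obtain ⟨⟨hx1, hx2⟩, rfl⟩ := hx0
    have hcount : ((F.awake (F.survivors S i) i).filter
        fun y => y / 2 ^ i = x0 / 2 ^ i).card ≤ F.threshold i - 1 := by
      by_contra hcon
      exact hx2 ⟨hx1, by omega⟩
    have hunit : F.unit i ≤ i := by
      unfold unit; split_ifs with h
      · exact (F.seg.par_lt i h.1 h.2).le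
      · omega
    have hm : ∀ x ∈ (F.survivors S i \ F.survivors S (i + 1)).filter
        (fun x => x / 2 ^ i = x0 / 2 ^ i), x / 2 ^ F.unit i ∈
        ((F.awake (F.survivors S i) i).filter
          fun y => y / 2 ^ i = x0 / 2 ^ i).image fun y => y / 2 ^ F.unit i := by
      intro x hx
      simp only [Finset.mem_filter, Finset.mem_sdiff] at hx
      obtain ⟨y, hy, hyx⟩ := F.exists_mem_awake_unit hx.1.1
      exact Finset.mem_image.2 ⟨y, Finset.mem_filter.2
        ⟨hy, (div_two_pow_eq_of_le hunit hyx).trans hx.2⟩, hyx⟩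
    refine (Finset.card_le_mul_card_image_of_maps_to hm (2 ^ F.unit i)
      fun c _ => card_filter_div_le _ _ _).trans ?_
    exact Nat.mul_le_mul_left _ (Finset.card_image_le.trans hcount)

/-- With threshold 1 nothing is lost, because a block with a survivor has an awake device. With the
large threshold the loss is at most 2 ^ (i / 2 + i / 4 + L - i), and the remaining factor 2 ^ (i /
4) pays for i * (i + 1). -/
lemma card_survivors_le_add {S : Finset ℕ} (hS : ∀ x ∈ S, x < 2 ^ L) {i : ℕ} (hi : i < L) :
    (i < 64 → (F.survivors S i).card ≤ (F.survivors S (i + 1)).card) ∧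
    (i * (i + 1) * (F.survivors S i).card ≤
      i * (i + 1) * (F.survivors S (i + 1)).card + 2 ^ L) := by
  have h1 := F.mul_card_sdiff_survivors_le hS hi
  have h2 := Finset.card_sdiff_add_card_eq_card (F.survivors_anti S (Nat.le_succ i))
  simp only [Nat.succ_eq_add_one] at h2
  by_cases ht : 64 ≤ i ∧ 2 * F.unit i ≤ i
  · refine ⟨fun h => by omega, ?_⟩
    have hthr : F.threshold i - 1 ≤ 2 ^ (i / 4) := by
      unfold threshold; rw [if_pos ht]; exact Nat.sub_le _ _
    have h3 : i * (i + 1) * (F.survivors S i \ F.survivors S (i + 1)).card ≤ 2 ^ L := by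
      calc i * (i + 1) * (F.survivors S i \ F.survivors S (i + 1)).card
          ≤ 2 ^ (i / 4) * (2 ^ F.unit i * 2 ^ (i / 4) * 2 ^ (L - i)) := by
            refine Nat.mul_le_mul (mul_succ_le_two_pow_div_four ht.1) (h1.trans ?_)
            gcongr
        _ = 2 ^ (i / 4 + (F.unit i + i / 4 + (L - i))) := by simp only [pow_add]
        _ ≤ 2 ^ L := Nat.pow_le_pow_right (by norm_num) (by omega)
    rw [← h2, mul_add]; omega
  · have hthr : F.threshold i = 1 := by unfold threshold; rw [if_neg ht]
    rw [hthr] at h1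
    simp only [Nat.sub_self, mul_zero, zero_mul, Nat.le_zero] at h1
    rw [← h2, h1]
    simp

lemma card_survivors_ge {S : Finset ℕ} (hS : ∀ x ∈ S, x < 2 ^ L) :
    (S.card : ℝ) - 2 ^ L / 64 ≤ (F.survivors S L).card := by
  have h1 : ∀ i, i ≤ L → i ≤ 64 → S.card ≤ (F.survivors S i).card := by
    intro i
    induction i with
    | zero => intro _ _; rfl
    | succ i ih =>
      intro h h'
      exact (ih (by omega) (by omega)).trans ((F.card_survivors_le_add hS (by omega)).1 (by omega))
  by_cases hL : L ≤ 64
  · have := h1 L le_rfl hL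
    have h' : (S.card : ℝ) ≤ (F.survivors S L).card := by exact_mod_cast this
    have : (0 : ℝ) < 2 ^ L / 64 := by positivity
    linarith
  -- The loss 1 / (i * (i + 1)) equals 1 / i - 1 / (i + 1), so the total telescopes.
  · have h2 : ∀ i, 64 ≤ i → i ≤ L →
        (S.card : ℝ) - 2 ^ L * (1 / 64 - 1 / i) ≤ (F.survivors S i).card := by
      intro i hi
      induction i, hi using Nat.le_induction with
      | base =>
        intro h
        have : (S.card : ℝ) ≤ (F.survivors S 64).card := by exact_mod_cast h1 64 h le_rfl
        norm_num; exact_mod_cast this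
      | succ i hi ih =>
        intro h
        have h3 := ih (by omega)
        have h4 := (F.card_survivors_le_add hS (i := i) (by omega)).2
        have h5 : (i * (i + 1) * (F.survivors S i).card : ℝ) ≤
          i * (i + 1) * (F.survivors S (i + 1)).card + 2 ^ L := by exact_mod_cast h4
        have hi0 : (0 : ℝ) < i := by positivity
        have h6 : ((F.survivors S i).card : ℝ) ≤
            (F.survivors S (i + 1)).card + 2 ^ L * (1 / i - 1 / (i + 1)) := by
          have h7 : (1 : ℝ) / i - 1 / (i + 1) = 1 / (i * (i + 1)) := by field_simp; ring
          rw [h7, ← sub_le_iff_le_add', mul_one_div, le_div_iff₀ (by positivity)]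
          linarith
        push_cast
        linarith
    have h3 := h2 L (by omega) le_rfl
    have : (0 : ℝ) ≤ 2 ^ L * (1 / L) := by positivity
    have h4 : (2 : ℝ) ^ L / 64 = 2 ^ L * (1 / 64) := by ring
    rw [h4]
    linarith

/-- Stage L is a root with a single block, so all survivors are awake there and know each other,
while every dropped device can tell that it was dropped: it is missing from its own list. -/
lemma Knows.final {S K : Finset ℕ} (hS : ∀ x ∈ S, x < 2 ^ L) {x : ℕ} (hx : x ∈ S)
    (h : F.Knows S L x K) :
    (x ∈ K ↔ x ∈ F.survivors S L) ∧ (x ∈ K → K = F.survivors S L) := by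
  have h1 := h.mem_awake_iff F
  have h2 := h.eq_of_mem F
  rw [F.awake_root (by omega)] at h1 h2
  rw [F.awake_root (by omega)] at h1
  refine ⟨h1, fun hxK => (h2 hxK).trans ?_⟩
  rw [Finset.filter_true_of_mem]
  intro y hy
  rw [Nat.div_eq_of_lt (hS x hx), Nat.div_eq_of_lt (hS y (F.survivors_subset S L hy))]

end WakeForest

end RadioNetwork

/-! ### Protocols with a fixed slot schedule and at most one sender per slot -/

namespace RadioNetwork

lemma channel_eq_message {ι M : Type} {a : ι → Action M} {i : ι} {m : M}
    (h : IsSoleTransmitter a i m) : channel a = .message m := by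
  have hex : ∃ m i, IsSoleTransmitter a i m := ⟨m, i, h⟩
  have h2 : channel a = .message hex.choose := by unfold channel; rw [dif_pos hex]
  rw [h2]
  obtain ⟨j, hj⟩ := hex.choose_spec
  by_cases hji : j = i
  · subst hji
    have := hj.1.symm.trans h.1
    injection this with h3
    rw [h3]
  · exact absurd h.1 (hj.2 i (fun h' => hji h'.symm) m)

lemma exists_isSoleTransmitter_of_channel {ι M : Type} {a : ι → Action M} {m : M}
    (h : channel a = .message m) : ∃ i, IsSoleTransmitter a i m := by
  unfold channel at h
  split_ifs at h with h1 h2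
  injection h with h3
  rw [← h3]
  exact h1.choose_spec

lemma channel_eq_silence {ι M : Type} {a : ι → Action M} (h : ∀ i m, a i ≠ .transmit m) :
    channel a = .silence := by
  unfold channel
  rw [dif_neg, if_neg]
  · rintro ⟨i, m, h'⟩; exact h i m h'
  · rintro ⟨m, i, h', _⟩; exact h i m h'

/-- The message of a signal, if it is one. -/
def Signal.toOption {M : Type} : Signal M → Option M
  | .message m => some m
  | _ => none

/-- A protocol that runs through a fixed list of slots. In slot `σ` a device in state `s` sends
`send σ s` if this is a message, and otherwise listens iff it is interested in the slot. -/
structure SlotMachine (X M O Slot St : Type) where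
  schedule : List Slot
  start : X → St
  send : Slot → St → Option M
  interested : Slot → St → Prop
  recv : Slot → St → Option M → St
  out : St → O

namespace SlotMachine

variable {X M O Slot St ι : Type} (Q : SlotMachine X M O Slot St)

open Classical in
/-- The action of a device in a slot. -/
noncomputable def act (σ : Slot) (s : St) : Action M :=
  match Q.send σ s with
  | some m => .transmit m
  | none => if Q.interested σ s then .listen else .idle

open Classical in
/-- The state of a device after a slot whose message is `o`. -/
noncomputable def advance (σ : Slot) (s : St) (o : Option M) : St :=
  -- An interested sender feeds its own message to itself. It hears nothing in No-CD, but in this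
  -- way all interested devices are updated uniformly.
  Q.recv σ s (if Q.interested σ s then (Q.send σ s <|> o) else none)

/-- The slot machine as a protocol. -/
noncomputable def toProtocol : Protocol X M O where
  State := List Slot × St
  init x := (Q.schedule, Q.start x)
  next
    | ([], s) => .inr (Q.out s)
    | (σ :: _, s) => .inl (Q.act σ s)
  update
    | ([], s), _ => ([], s)
    | (σ :: l, s), sig => (l, Q.advance σ s sig.toOption)

open Classical in
/-- The message that the listeners hear in slot `σ`. -/
noncomputable def content (σ : Slot) (st : ι → St) : Option M :=
  (channel fun i => Q.act σ (st i)).toOption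

/-- One slot of the execution. -/
noncomputable def gstep (st : ι → St) (σ : Slot) : ι → St :=
  fun i => Q.advance σ (st i) (Q.content σ st)

/-- The states after a list of slots. -/
noncomputable def exec (l : List Slot) (st : ι → St) : ι → St := l.foldl Q.gstep st

/-- At most one device sends in slot `σ`. -/
def UniqueSender (σ : Slot) (st : ι → St) : Prop :=
  ∀ i j m m', Q.send σ (st i) = some m → Q.send σ (st j) = some m' → i = j

/-- At most one device sends in each of a list of slots. -/
def CollisionFree : List Slot → (ι → St) → Prop
  | [], _ => True
  | σ :: l, st => Q.UniqueSender σ st ∧ CollisionFree l (Q.gstep st σ)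

/-- The energy that device `i` spends in a list of slots. -/
noncomputable def cost : List Slot → (ι → St) → ι → ℕ
  | [], _, _ => 0
  | σ :: l, st, i => (Q.act σ (st i)).cost + cost l (Q.gstep st σ) i

variable {Q}

@[simp] lemma exec_nil (st : ι → St) : Q.exec [] st = st := rfl

@[simp] lemma exec_cons (σ : Slot) (l : List Slot) (st : ι → St) :
    Q.exec (σ :: l) st = Q.exec l (Q.gstep st σ) := rfl

lemma exec_append (l l' : List Slot) (st : ι → St) :
    Q.exec (l ++ l') st = Q.exec l' (Q.exec l st) := List.foldl_append

lemma collisionFree_append {l l' : List Slot} {st : ι → St} :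
    Q.CollisionFree (l ++ l') st ↔ Q.CollisionFree l st ∧ Q.CollisionFree l' (Q.exec l st) := by
  induction l generalizing st with
  | nil => simp [CollisionFree]
  | cons σ l ih => simp [CollisionFree, ih, and_assoc]

lemma cost_append (l l' : List Slot) (st : ι → St) (i : ι) :
    Q.cost (l ++ l') st i = Q.cost l st i + Q.cost l' (Q.exec l st) i := by
  induction l generalizing st with
  | nil => simp [cost]
  | cons σ l ih => simp [cost, ih, add_assoc]

lemma act_eq_transmit {σ : Slot} {s : St} {m : M} :
    Q.act σ s = .transmit m ↔ Q.send σ s = some m := by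
  unfold act
  cases h : Q.send σ s with
  | some m' => simp
  | none => simp only [reduceCtorEq, iff_false]; split_ifs <;> simp

lemma act_of_send_eq_none {σ : Slot} {s : St} (h : Q.send σ s = none)
    (h' : Q.interested σ s) : Q.act σ s = .listen := by
  unfold act; rw [h]; exact if_pos h'

lemma cost_act_le {σ : Slot} {s : St} {p q : Prop} [Decidable p] [Decidable q]
    (hp : Q.send σ s ≠ none → p) (hq : Q.interested σ s → q) :
    (Q.act σ s).cost ≤ (if p then 1 else 0) + if q then 1 else 0 := by
  unfold act
  cases h : Q.send σ s with
  | some m' => simp [Action.cost, hp (by simp [h])]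
  | none =>
    by_cases hi : Q.interested σ s
    · simp [Action.cost, hi, hq hi]
    · simp [Action.cost, hi]

lemma UniqueSender.content_eq {σ : Slot} {st : ι → St} (h : Q.UniqueSender σ st) {i : ι} {m : M}
    (hi : Q.send σ (st i) = some m) : Q.content σ st = some m := by
  unfold content
  have : IsSoleTransmitter (fun i => Q.act σ (st i)) i m := by
    refine ⟨act_eq_transmit.2 hi, fun j hj m' hm => hj ?_⟩
    exact h j i m' m (act_eq_transmit.1 hm) hi
  rw [channel_eq_message this]; rfl

lemma content_eq_none {σ : Slot} {st : ι → St} (h : ∀ i, Q.send σ (st i) = none) :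
    Q.content σ st = none := by
  unfold content
  rw [channel_eq_silence]
  · rfl
  · intro i m hm
    have := act_eq_transmit.1 hm
    rw [h i] at this
    cases this

open Classical in
/-- If at most one device sends, then its message arrives at all interested devices, itself
included. -/
lemma UniqueSender.gstep_apply {σ : Slot} {st : ι → St} (h : Q.UniqueSender σ st) (i : ι) :
    Q.gstep st σ i =
      Q.recv σ (st i) (if Q.interested σ (st i) then Q.content σ st else none) := by
  unfold gstep advance
  cases hs : Q.send σ (st i) with
  | none => rfl
  | some m => rw [h.content_eq hs]; rfl

lemma hear_toOption (ch : Signal M) : (CDModel.noCD.hear ch .listen).toOption = ch.toOption := by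
  cases ch <;> rfl

/-- This replaces the channel semantics by a fold over the schedule, on which the Census is analysed
list by list. -/
lemma run_toProtocol (x : ι → X) (t : ℕ) (i : ι) : Q.toProtocol.run .noCD x t i =
    (Q.schedule.drop t, Q.exec (Q.schedule.take t) (fun i => Q.start (x i)) i) := by
  induction t generalizing i with
  | zero => rfl
  | succ t ih =>
    have hact : ∀ j, Q.toProtocol.action (Q.toProtocol.run .noCD x t j) =
        Q.toProtocol.action (Q.schedule.drop t,
          Q.exec (Q.schedule.take t) (fun i => Q.start (x i)) j) := fun j => by rw [ih j]
    change Q.toProtocol.step (Q.toProtocol.run .noCD x t i) _ = _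
    simp only [hact]
    rw [ih i]
    by_cases ht : t < Q.schedule.length
    · rw [List.drop_eq_getElem_cons ht, ← List.take_concat_get' _ _ ht, exec_append]
      change (_, Q.advance _ _ _) = (_, Q.advance _ _ _)
      congr 1
      set σ := Q.schedule[t]
      set st := Q.exec (Q.schedule.take t) fun i => Q.start (x i)
      change Q.advance σ (st i)
        (CDModel.noCD.hear (channel fun j => Q.act σ (st j)) (Q.act σ (st i))).toOption = _
      unfold advance content
      congr 1
      by_cases hi : Q.interested σ (st i)
      · simp only [hi, if_true]
        cases hs : Q.send σ (st i) with
        | some m => rfl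
        | none => rw [act_of_send_eq_none hs hi, hear_toOption]
      · simp only [hi, if_false]
    · have h1 : Q.schedule.drop t = [] := List.drop_eq_nil_of_le (by omega)
      have h2 : Q.schedule.drop (t + 1) = [] := List.drop_eq_nil_of_le (by omega)
      have h3 : Q.schedule.take t = Q.schedule := List.take_of_length_le (by omega)
      have h4 : Q.schedule.take (t + 1) = Q.schedule := List.take_of_length_le (by omega)
      rw [h1, h2, h3, h4]
      rfl

lemma actionAt_toProtocol (x : ι → X) {t : ℕ} (ht : t < Q.schedule.length) (i : ι) :
    Q.toProtocol.actionAt .noCD x t i =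
      Q.act Q.schedule[t] (Q.exec (Q.schedule.take t) (fun i => Q.start (x i)) i) := by
  unfold Protocol.actionAt
  rw [run_toProtocol, List.drop_eq_getElem_cons ht]
  rfl

lemma actionAt_toProtocol_of_le (x : ι → X) {t : ℕ} (ht : Q.schedule.length ≤ t) (i : ι) :
    Q.toProtocol.actionAt .noCD x t i = .idle := by
  unfold Protocol.actionAt
  rw [run_toProtocol, List.drop_eq_nil_of_le ht]
  rfl

lemma outputAt_toProtocol (x : ι → X) (i : ι) :
    Q.toProtocol.OutputAt .noCD x Q.schedule.length i
      (Q.out (Q.exec Q.schedule (fun i => Q.start (x i)) i)) := by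
  unfold Protocol.OutputAt
  rw [run_toProtocol, List.drop_length, List.take_length]
  rfl

lemma CollisionFree.uniqueSender {l : List Slot} {st : ι → St} (h : Q.CollisionFree l st)
    {t : ℕ} (ht : t < l.length) : Q.UniqueSender l[t] (Q.exec (l.take t) st) := by
  induction l generalizing st t with
  | nil => simp at ht
  | cons σ l ih =>
    cases t with
    | zero => exact h.1
    | succ t => exact ih h.2 (by simpa using ht)

lemma cost_eq_sum (l : List Slot) (st : ι → St) (i : ι) :
    Q.cost l st i = ∑ t : Fin l.length, (Q.act l[t] (Q.exec (l.take t) st i)).cost := by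
  induction l generalizing st with
  | nil => rfl
  | cons σ l ih =>
    rw [cost, ih]
    exact (Fin.sum_univ_succ (n := l.length) fun t =>
      (Q.act (σ :: l)[t] (Q.exec ((σ :: l).take t) st i)).cost).symm

lemma energy_toProtocol (x : ι → X) (i : ι) :
    Q.toProtocol.energy .noCD x Q.schedule.length i =
      Q.cost Q.schedule (fun i => Q.start (x i)) i := by
  rw [cost_eq_sum, Protocol.energy, Finset.sum_range]
  refine Finset.sum_congr rfl fun t _ => ?_
  rw [actionAt_toProtocol x t.2]
  rfl

lemma eq_of_actionAt_transmit (x : ι → X)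
    (h : Q.CollisionFree Q.schedule fun i => Q.start (x i)) {t : ℕ} {i j : ι} {m m' : M}
    (hi : Q.toProtocol.actionAt .noCD x t i = .transmit m)
    (hj : Q.toProtocol.actionAt .noCD x t j = .transmit m') : i = j := by
  by_cases ht : t < Q.schedule.length
  · rw [actionAt_toProtocol x ht] at hi hj
    exact h.uniqueSender ht i j m m' (act_eq_transmit.1 hi) (act_eq_transmit.1 hj)
  · rw [actionAt_toProtocol_of_le x (by omega)] at hi
    cases hi

end SlotMachine

end RadioNetwork

namespace RadioNetwork

/-! ### The dense Census algorithm -/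

/-- The slots of the Census algorithm: in `merge i b` block `b` of length `2 ^ i` announces its
members, after `commit i` the devices awake at stage `i + 1` adopt what they heard, in `report y` a
device `y` that was dropped introduces itself, in `chain j` the survivor of rank `j` hands over what
it collected, and in `announce` the leader announces the list. -/
inductive CensusSlot where
  | merge (i b : ℕ)
  | commit (i : ℕ)
  | report (y : ℕ)
  | chain (j : ℕ)
  | announce

/-- The state of a device in the Census algorithm. -/
structure CensusState where
  id : ℕ
  know : Finset ℕ
  buf : Finset ℕ

/-- The device is the last one in the list that it knows. -/
def CensusState.IsLast (L : ℕ) (s : CensusState) : Prop :=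
  s.id ∈ s.know ∧ blockRank s.know L s.id + 1 = s.know.card

instance (L : ℕ) (s : CensusState) : Decidable (s.IsLast L) := by
  unfold CensusState.IsLast; infer_instance

namespace WakeForest

variable {L k : ℕ} (F : WakeForest L k)

/-- Device `x` announces block `b` at stage `i` when `A` are the members that it knows. -/
def IsSpeaker (A : Finset ℕ) (i b x : ℕ) : Prop :=
  x / 2 ^ i = b ∧ x ∈ F.awake A i ∧ (∀ y ∈ F.awake A i, y / 2 ^ i = b → x ≤ y) ∧
    F.threshold i ≤ ((F.awake A i).filter fun y => y / 2 ^ i = b).card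

instance (A : Finset ℕ) (i b x : ℕ) : Decidable (F.IsSpeaker A i b x) := by
  unfold IsSpeaker; infer_instance

/-- What a device sends in the Census algorithm. -/
def censusSend : CensusSlot → CensusState → Option (Finset ℕ)
  | .merge i b, s => if F.IsSpeaker s.know i b s.id then some s.know else none
  | .commit _, _ => none
  | .report y, s => if s.id = y ∧ s.id ∉ s.know then some {y} else none
  | .chain j, s => if s.id ∈ s.know ∧ blockRank s.know L s.id = j then some s.buf else none
  | .announce, s => if s.IsLast L then some (s.know ∪ s.buf) else none

/-- When a device wants to receive in the Census algorithm. -/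
def censusInterested : CensusSlot → CensusState → Prop
  | .merge i b, s => b / 2 = s.id / 2 ^ (i + 1) ∧ s.id ∈ F.awake s.know (i + 1)
  | .commit _, _ => False
  | .report y, s => s.id ∈ s.know ∧ 40 * blockRank s.know L s.id ≤ y ∧
      y < 40 * (blockRank s.know L s.id + 1)
  | .chain j, s => s.id ∈ s.know ∧ blockRank s.know L s.id = j + 1
  | .announce, _ => True

/-- How a device updates its state in the Census algorithm. -/
def censusRecv : CensusSlot → CensusState → Option (Finset ℕ) → CensusState
  | .commit i, s, _ =>
      ⟨s.id, if s.id ∈ F.awake s.know (i + 1) then s.buf else s.know, ∅⟩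
  | .announce, s, _ => s
  | _, s, o => ⟨s.id, s.know, s.buf ∪ o.getD ∅⟩

/-- The slots of stage `i`. -/
def stageSlots (L i : ℕ) : List CensusSlot :=
  (List.range (2 ^ (L - i))).map (.merge i) ++ [.commit i]

/-- The slots before the announcement. -/
def mainSlots (L : ℕ) : List CensusSlot :=
  (List.range L).flatMap (stageSlots L) ++ (List.range (2 ^ L)).map .report ++
    (List.range (2 ^ L)).map .chain

/-- The Census algorithm on the ID space `{0, …, N - 1}`. -/
abbrev census (N : ℕ) : 
    SlotMachine (Fin N) (Finset ℕ) (Option (Finset (Fin N))) CensusSlot CensusState where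
  schedule := mainSlots L ++ [.announce]
  start x := ⟨x, {(x : ℕ)}, ∅⟩
  send := F.censusSend
  interested := F.censusInterested
  recv := F.censusRecv
  out s := if s.IsLast L then
    some (Finset.univ.filter fun j : Fin N => (j : ℕ) ∈ s.know ∪ s.buf) else none

variable {F} {N : ℕ} {ι : Type} {id : ι → ℕ} {S : Finset ℕ} {K B : ι → Finset ℕ}

lemma census_recv_buf {σ : CensusSlot} (h : ∀ i, σ ≠ .commit i) (h' : σ ≠ .announce)
    (s : CensusState) (o : Option (Finset ℕ)) :
    (F.census N).recv σ s o = ⟨s.id, s.know, s.buf ∪ o.getD ∅⟩ := by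
  cases σ <;> first | rfl | exact absurd rfl h' | exact absurd rfl (h _)

lemma census_gstep_commit (i : ℕ) (st : ι → CensusState) (j : ι) :
    (F.census N).gstep st (.commit i) j = ⟨(st j).id,
      if (st j).id ∈ F.awake (st j).know (i + 1) then (st j).buf else (st j).know, ∅⟩ := rfl

/-- The joint state of all devices. -/
abbrev joint (id : ι → ℕ) (K B : ι → Finset ℕ) : ι → CensusState := fun i => ⟨id i, K i, B i⟩

/-- An awake device knows exactly the survivors of its block, and the wake-up rule is local. It
therefore sees the same awake set as an omniscient observer, including the minimum and the threshold
test. -/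
lemma isSpeaker_knows {i b x : ℕ} {A : Finset ℕ} (h : F.Knows S i x A) :
    F.IsSpeaker A i b x ↔ F.IsSpeaker (F.survivors S i) i b x := by
  have key : x / 2 ^ i = b → x ∈ F.awake A i →
      ∀ y, y / 2 ^ i = b → (y ∈ F.awake A i ↔ y ∈ F.awake (F.survivors S i) i) := by
    rintro rfl hx y hy
    rw [h.eq_of_mem F hx]
    exact F.mem_awake_survivors_block hy
  unfold IsSpeaker
  constructor
  · rintro ⟨h1, h2, h3, h4⟩
    have k1 := key h1 h2
    refine ⟨h1, (k1 x h1).1 h2, fun y hy hyb => h3 y ((k1 y hyb).2 hy) hyb, h4.trans_eq ?_⟩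
    congr 1
    ext y
    simp only [Finset.mem_filter]
    exact ⟨fun ⟨g1, g2⟩ => ⟨(k1 y g2).1 g1, g2⟩, fun ⟨g1, g2⟩ => ⟨(k1 y g2).2 g1, g2⟩⟩
  · rintro ⟨h1, h2, h3, h4⟩
    have h2' := (h.mem_awake_iff F).2 h2
    have k1 := key h1 h2'
    refine ⟨h1, h2', fun y hy hyb => h3 y ((k1 y hyb).1 hy) hyb, h4.trans_eq ?_⟩
    congr 1
    ext y
    simp only [Finset.mem_filter]
    exact ⟨fun ⟨g1, g2⟩ => ⟨(k1 y g2).2 g1, g2⟩, fun ⟨g1, g2⟩ => ⟨(k1 y g2).1 g1, g2⟩⟩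

lemma merge_send {i b : ℕ} {j : ι} (hK : ∀ j, F.Knows S i (id j) (K j)) {m : Finset ℕ}
    (h : (F.census N).send (.merge i b) (joint id K B j) = some m) :
    F.IsSpeaker (F.survivors S i) i b (id j) ∧
      m = (F.survivors S (i + 1)).filter fun y => y / 2 ^ i = b := by
  simp only [censusSend, Option.ite_none_right_eq_some, Option.some.injEq] at h
  obtain ⟨h1, rfl⟩ := h
  have h2 := (isSpeaker_knows (hK j)).1 h1
  refine ⟨h2, ?_⟩
  rw [(hK j).eq_of_mem F h1.2.1]
  obtain ⟨rfl, _, _, h4⟩ := h2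
  ext y
  simp only [Finset.mem_filter, F.mem_survivors_succ]
  constructor
  · rintro ⟨g1, g2⟩; exact ⟨⟨g1, by rwa [g2]⟩, g2⟩
  · rintro ⟨⟨g1, _⟩, g2⟩; exact ⟨g1, g2⟩

lemma merge_uniqueSender (hinj : Function.Injective id) {i b : ℕ}
    (hK : ∀ j, F.Knows S i (id j) (K j)) :
    (F.census N).UniqueSender (.merge i b) (joint id K B) := by
  intro j j' m m' h h'
  obtain ⟨⟨h1, h2, h3, _⟩, _⟩ := merge_send hK h
  obtain ⟨⟨g1, g2, g3, _⟩, _⟩ := merge_send hK h'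
  exact hinj (le_antisymm (h3 _ g2 g1) (g3 _ h2 h1))

/-- Silence is informative: it means that block b is empty or has given up, and then the block
contains no survivor of the next stage. Reading silence as the empty set is hence correct. -/
lemma merge_content (hS : ∀ n, n ∈ S ↔ ∃ j, id j = n) (hinj : Function.Injective id) {i b : ℕ}
    (hK : ∀ j, F.Knows S i (id j) (K j)) :
    ((F.census N).content (.merge i b) (joint id K B)).getD ∅ =
      (F.survivors S (i + 1)).filter fun y => y / 2 ^ i = b := by
  by_cases h : ∃ j, (F.census N).send (.merge i b) (joint id K B j) ≠ none
  · obtain ⟨j, hj⟩ := h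
    obtain ⟨m, hm⟩ := Option.ne_none_iff_exists'.1 hj
    rw [(merge_uniqueSender hinj hK).content_eq hm, (merge_send hK hm).2]
    rfl
  · push Not at h
    rw [SlotMachine.content_eq_none h]
    symm
    simp only [Option.getD_none]
    rw [Finset.filter_eq_empty_iff]
    intro y hy hyb
    obtain ⟨_, hthr⟩ := F.mem_survivors_succ.1 hy
    rw [hyb] at hthr
    set V := (F.awake (F.survivors S i) i).filter fun y => y / 2 ^ i = b with hV
    -- A surviving block has an awake device because thresholds are at least 1; the least such
    -- device would have spoken.
    have hne : V.Nonempty := Finset.card_pos.1 (lt_of_lt_of_le (F.one_le_threshold i) hthr)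
    have hmin := Finset.mem_filter.1 (V.min'_mem hne)
    obtain ⟨j, hj⟩ := (hS _).1 (F.survivors_subset S i (F.awake_subset _ _ hmin.1))
    have hsp : F.IsSpeaker (F.survivors S i) i b (id j) := by
      rw [hj]
      exact ⟨hmin.2, hmin.1, fun z hz hzb => V.min'_le z (Finset.mem_filter.2 ⟨hz, hzb⟩), hthr⟩
    have := h j
    simp only [censusSend, (isSpeaker_knows (hK j)).2 hsp, if_true, reduceCtorEq] at this

lemma gstep_merge (hS : ∀ n, n ∈ S ↔ ∃ j, id j = n) (hinj : Function.Injective id) {i b : ℕ}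
    (hK : ∀ j, F.Knows S i (id j) (K j)) :
    (F.census N).gstep (joint id K B) (.merge i b) = joint id K fun j =>
      B j ∪ if id j ∈ F.awake (K j) (i + 1) then (F.survivors S (i + 1)).filter
        (fun y => y / 2 ^ i = b ∧ y / 2 ^ (i + 1) = id j / 2 ^ (i + 1)) else ∅ := by
  funext j
  rw [(merge_uniqueSender hinj hK).gstep_apply, census_recv_buf (by simp) (by simp)]
  simp only [CensusState.mk.injEq, true_and]
  congr 1
  by_cases h : id j ∈ F.awake (K j) (i + 1)
  · rw [if_pos h]
    by_cases h2 : b / 2 = id j / 2 ^ (i + 1)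
    · rw [if_pos (show (F.census N).interested (.merge i b) (joint id K B j) from ⟨h2, h⟩),
        merge_content hS hinj hK]
      ext y
      simp only [Finset.mem_filter, and_congr_right_iff]
      rintro _
      constructor
      · rintro rfl
        exact ⟨rfl, by rw [← h2, Nat.div_div_eq_div_mul, pow_succ]⟩
      · exact fun h => h.1
    · rw [if_neg (show ¬ (F.census N).interested (.merge i b) (joint id K B j)
        from fun h' => h2 h'.1)]
      symm
      simp only [Option.getD_none, Finset.filter_eq_empty_iff]
      rintro y _ ⟨rfl, h3⟩
      exact h2 (by rw [← h3, Nat.div_div_eq_div_mul, pow_succ])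
  · rw [if_neg h,
      if_neg (show ¬ (F.census N).interested (.merge i b) (joint id K B j) from fun h' => h h'.2)]
    rfl

lemma exec_merge (hS : ∀ n, n ∈ S ↔ ∃ j, id j = n) (hinj : Function.Injective id) {i : ℕ}
    (hK : ∀ j, F.Knows S i (id j) (K j)) (l : List ℕ) :
    (F.census N).CollisionFree (l.map (.merge i)) (joint id K B) ∧
    (F.census N).exec (l.map (.merge i)) (joint id K B) = (joint id K fun j =>
      B j ∪ if id j ∈ F.awake (K j) (i + 1) then (F.survivors S (i + 1)).filter
        (fun y => y / 2 ^ i ∈ l ∧ y / 2 ^ (i + 1) = id j / 2 ^ (i + 1)) else ∅) ∧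
    ∀ j, (F.census N).cost (l.map (.merge i)) (joint id K B) j ≤
      (if id j ∈ F.awake (K j) i then l.count (id j / 2 ^ i) else 0) +
      if id j ∈ F.awake (K j) (i + 1) then l.countP (fun b => b / 2 = id j / 2 ^ (i + 1))
        else 0 := by
  induction l generalizing B with
  | nil => simp [SlotMachine.CollisionFree, SlotMachine.cost, SlotMachine.exec_nil]
  | cons b l ih =>
    simp only [List.map_cons, SlotMachine.CollisionFree, SlotMachine.exec_cons, SlotMachine.cost]
    rw [gstep_merge hS hinj hK]
    obtain ⟨h1, h2, h3⟩ := ih (B := fun j =>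
      B j ∪ if id j ∈ F.awake (K j) (i + 1) then (F.survivors S (i + 1)).filter
        (fun y => y / 2 ^ i = b ∧ y / 2 ^ (i + 1) = id j / 2 ^ (i + 1)) else ∅)
    refine ⟨⟨merge_uniqueSender hinj hK, h1⟩, ?_, fun j => ?_⟩
    · rw [h2]
      funext j
      simp only [CensusState.mk.injEq, true_and]
      by_cases h : id j ∈ F.awake (K j) (i + 1)
      · simp only [h, if_true, List.mem_cons]
        ext y
        simp only [Finset.mem_union, Finset.mem_filter]
        tauto
      · simp only [h, if_false, Finset.union_empty]
    · have hc : ((F.census N).act (.merge i b) (joint id K B j)).cost ≤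
          (if id j / 2 ^ i = b ∧ id j ∈ F.awake (K j) i then 1 else 0) +
          if b / 2 = id j / 2 ^ (i + 1) ∧ id j ∈ F.awake (K j) (i + 1) then 1 else 0 := by
        refine SlotMachine.cost_act_le (fun h => ?_) fun h => h
        simp only [censusSend, ne_eq, ite_eq_right_iff, reduceCtorEq, imp_false, not_not] at h
        exact ⟨h.1, h.2.1⟩
      have h4 := h3 j
      refine (Nat.add_le_add hc h4).trans ?_
      rw [List.count_cons, List.countP_cons]
      by_cases g1 : id j ∈ F.awake (K j) i <;> by_cases g2 : id j ∈ F.awake (K j) (i + 1) <;>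
        by_cases g3 : id j / 2 ^ i = b <;> by_cases g4 : b / 2 = id j / 2 ^ (i + 1) <;>
        simp [g1, g2, g3, g4, eq_comm (a := b)] <;> omega

lemma countP_range_le (n c : ℕ) (p : ℕ → Bool) (d : ℕ)
    (h : ∀ b, p b = true → d ≤ b ∧ b < d + c) : (List.range n).countP p ≤ c := by
  have h1 : (List.range n).countP p = ((Finset.range n).filter fun b => p b = true).card := by
    rw [List.countP_eq_length_filter, Finset.card_def, Finset.filter_val, Finset.range_val]
    simp [Multiset.range]
  rw [h1]
  calc _ ≤ (Finset.Ico d (d + c)).card := by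
        refine Finset.card_le_card fun b hb => ?_
        have := h b (Finset.mem_filter.1 hb).2
        exact Finset.mem_Ico.2 this
    _ = c := by simp

lemma count_range_le (n c : ℕ) : (List.range n).count c ≤ 1 :=
  List.nodup_iff_count_le_one.1 List.nodup_range c

/-- In one stage a device speaks at most once, for its own block, and listens at most twice, to the
two halves of its next block. The separate commit slot keeps the knowledge of stage i intact while
the announcements of that stage are still in progress. -/
lemma exec_stage (hS : ∀ n, n ∈ S ↔ ∃ j, id j = n) (hinj : Function.Injective id)
    (hL : ∀ n ∈ S, n < 2 ^ L) {i : ℕ} (hi : i < L) (hK : ∀ j, F.Knows S i (id j) (K j)) :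
    ∃ K' : ι → Finset ℕ, (∀ j, F.Knows S (i + 1) (id j) (K' j)) ∧
    (F.census N).CollisionFree (stageSlots L i) (joint id K fun _ => ∅) ∧
    (F.census N).exec (stageSlots L i) (joint id K fun _ => ∅) = (joint id K' fun _ => ∅) ∧
    ∀ j, (F.census N).cost (stageSlots L i) (joint id K fun _ => ∅) j ≤
      (if id j ∈ F.awake (K j) i then 1 else 0) +
        2 * if id j ∈ F.awake (K j) (i + 1) then 1 else 0 := by
  obtain ⟨h1, h2, h3⟩ := exec_merge (N := N) (B := fun _ => ∅) hS hinj hK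
    (List.range (2 ^ (L - i)))
  refine ⟨fun j => if id j ∈ F.awake (K j) (i + 1) then (F.survivors S (i + 1)).filter
    (fun y => y / 2 ^ (i + 1) = id j / 2 ^ (i + 1)) else K j, fun j => ?_, ?_, ?_, fun j => ?_⟩
  · by_cases h : id j ∈ F.awake (K j) (i + 1)
    · simp only [h, if_true]; exact F.knows_survivors S _ _
    · simp only [h, if_false]; exact (hK j).succ_of_notMem F h
  · rw [stageSlots, SlotMachine.collisionFree_append]
    refine ⟨h1, fun j j' m m' h => ?_, trivial⟩
    cases h
  · rw [stageSlots, SlotMachine.exec_append, h2]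
    funext j
    rw [SlotMachine.exec_cons, SlotMachine.exec_nil, census_gstep_commit]
    simp only [Finset.empty_union, CensusState.mk.injEq, and_true, true_and]
    by_cases h : id j ∈ F.awake (K j) (i + 1)
    · simp only [h, if_true]
      ext y
      simp only [Finset.mem_filter, List.mem_range, and_congr_right_iff, and_iff_right_iff_imp]
      intro hy _
      rw [Nat.div_lt_iff_lt_mul (by positivity), ← pow_add, Nat.sub_add_cancel hi.le]
      exact hL y (F.survivors_subset S _ hy)
    · simp only [h, if_false]
  · rw [stageSlots, SlotMachine.cost_append]
    have h4 : (F.census N).cost [.commit i] ((F.census N).exec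
        ((List.range (2 ^ (L - i))).map (.merge i)) (joint id K fun _ => ∅)) j = 0 := by
      simp [SlotMachine.cost, SlotMachine.act, censusSend, censusInterested, Action.cost]
    rw [h4, add_zero]
    refine (h3 j).trans (Nat.add_le_add ?_ ?_)
    · split_ifs
      · exact count_range_le _ _
      · rfl
    · split_ifs
      · refine countP_range_le _ 2 _ (2 * (id j / 2 ^ (i + 1))) fun b hb => ?_
        have := of_decide_eq_true hb
        omega
      · omega

open Classical in
lemma exec_stages (hS : ∀ n, n ∈ S ↔ ∃ j, id j = n) (hinj : Function.Injective id)
    (hL : ∀ n ∈ S, n < 2 ^ L) (n : ℕ) (hn : n ≤ L) :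
    ∃ K : ι → Finset ℕ, (∀ j, F.Knows S n (id j) (K j)) ∧
    (F.census N).CollisionFree ((List.range n).flatMap (stageSlots L))
      (joint id (fun j => {id j}) fun _ => ∅) ∧
    (F.census N).exec ((List.range n).flatMap (stageSlots L))
      (joint id (fun j => {id j}) fun _ => ∅) = (joint id K fun _ => ∅) ∧
    ∀ j, (F.census N).cost ((List.range n).flatMap (stageSlots L))
      (joint id (fun j => {id j}) fun _ => ∅) j ≤
      ((Finset.range n).filter fun i => i ≤ 64 ∨ L ≤ i ∨ F.Candidate S (id j) i).card +
      2 * ((Finset.range (n + 1)).filter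
        fun i => i ≤ 64 ∨ L ≤ i ∨ F.Candidate S (id j) i).card := by
  induction n with
  | zero =>
    exact ⟨fun j => {id j}, fun j => F.knows_zero ((hS _).2 ⟨j, rfl⟩), trivial, rfl,
      fun j => by simp [SlotMachine.cost]⟩
  | succ n ih =>
    obtain ⟨K, hK, h1, h2, h3⟩ := ih (by omega)
    obtain ⟨K', hK', g1, g2, g3⟩ := exec_stage (N := N) hS hinj hL (i := n) (by omega) hK
    rw [List.range_succ, List.flatMap_append, List.flatMap_singleton]
    refine ⟨K', hK', ?_, ?_, fun j => ?_⟩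
    · rw [SlotMachine.collisionFree_append, h2]; exact ⟨h1, g1⟩
    · rw [SlotMachine.exec_append, h2, g2]
    · rw [SlotMachine.cost_append, h2]
      refine (Nat.add_le_add (h3 j) (g3 j)).trans ?_
      have e1 : (if id j ∈ F.awake (K j) n then 1 else 0) ≤
          if n ≤ 64 ∨ L ≤ n ∨ F.Candidate S (id j) n then 1 else 0 := by
        split_ifs with a1 a2 <;> try omega
        exfalso
        -- Speakers at stage n are truly awake survivors, hence candidates.
        refine a2 (or_iff_not_imp_left.2 fun b1 => or_iff_not_imp_left.2 fun b2 => ?_)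
        exact F.candidate_of_mem_awake (by omega) (by omega) (((hK j).mem_awake_iff F).1 a1)
      have e2 : (if id j ∈ F.awake (K j) (n + 1) then 1 else 0) ≤
          if n + 1 ≤ 64 ∨ L ≤ n + 1 ∨ F.Candidate S (id j) (n + 1) then 1 else 0 := by
        split_ifs with a1 a2 <;> try omega
        exfalso
        refine a2 (or_iff_not_imp_left.2 fun b1 => or_iff_not_imp_left.2 fun b2 => ?_)
        exact (hK j).candidate F a1 (by omega) (by omega)
      have e3 : ∀ m, ((Finset.range (m + 1)).filter
          fun i => i ≤ 64 ∨ L ≤ i ∨ F.Candidate S (id j) i).card =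
          ((Finset.range m).filter
            fun i => i ≤ 64 ∨ L ≤ i ∨ F.Candidate S (id j) i).card +
          if m ≤ 64 ∨ L ≤ m ∨ F.Candidate S (id j) m then 1 else 0 := by
        intro m
        rw [Finset.range_add_one, Finset.filter_insert]
        split_ifs with h
        · rw [Finset.card_insert_of_notMem (by simp)]
        · rfl
      rw [e3 (n + 1), e3 n]
      omega

end WakeForest

end RadioNetwork

/-! ### Collecting the dropped devices: reports and the chain -/

namespace RadioNetwork

lemma blockRank_lt_card {U : Finset ℕ} {p x : ℕ} (hx : x ∈ U) :
    blockRank U p x < (U.filter fun y => y / 2 ^ p = x / 2 ^ p).card := by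
  unfold blockRank
  refine Finset.card_lt_card (Finset.ssubset_iff_of_subset ?_ |>.2 ⟨x, ?_, ?_⟩)
  · intro z
    simp only [Finset.mem_filter]
    exact fun h => ⟨h.1, h.2.1⟩
  · simp [hx]
  · simp

namespace WakeForest

variable {L k : ℕ} {F : WakeForest L k}
variable {N : ℕ} {ι : Type} {id : ι → ℕ} {S A : Finset ℕ} {K B : ι → Finset ℕ}

/-- Report y is heard by the survivor of rank y / 40 alone, if there is one. Every survivor knows
its own window because all of them hold the same list A. -/
lemma gstep_report (hS : ∀ n, n ∈ S ↔ ∃ j, id j = n) (hinj : Function.Injective id)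
    (hK : ∀ j, (id j ∈ K j ↔ id j ∈ A) ∧ (id j ∈ K j → K j = A)) (y : ℕ) :
    (F.census N).UniqueSender (.report y) (joint id K B) ∧
    (F.census N).gstep (joint id K B) (.report y) = joint id K fun j =>
      B j ∪ if id j ∈ A then (S \ A).filter (fun z => z = y ∧ 40 * blockRank A L (id j) ≤ z ∧
        z < 40 * (blockRank A L (id j) + 1)) else ∅ := by
  have hsend : ∀ j m, (F.census N).send (.report y) (joint id K B j) = some m ↔
      (id j = y ∧ id j ∉ A) ∧ {y} = m := by
    intro j m
    simp only [censusSend, Option.ite_none_right_eq_some, Option.some.injEq, (hK j).1]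
  have hu : (F.census N).UniqueSender (.report y) (joint id K B) := by
    intro j j' m m' h h'
    exact hinj (((hsend _ _).1 h).1.1.trans ((hsend _ _).1 h').1.1.symm)
  have hc : ((F.census N).content (.report y) (joint id K B)).getD ∅ =
      (S \ A).filter (fun z => z = y) := by
    by_cases h : y ∈ S \ A
    · rw [Finset.mem_sdiff] at h
      obtain ⟨j, hj⟩ := (hS y).1 h.1
      rw [hu.content_eq ((hsend j {y}).2 ⟨⟨hj, by rw [hj]; exact h.2⟩, rfl⟩)]
      ext z
      simp only [Option.getD_some, Finset.mem_singleton, Finset.mem_filter, Finset.mem_sdiff]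
      constructor
      · rintro rfl; exact ⟨h, rfl⟩
      · exact fun h => h.2
    · rw [SlotMachine.content_eq_none, Option.getD_none, eq_comm, Finset.filter_eq_empty_iff]
      · rintro z hz rfl; exact h hz
      · intro j
        rw [Option.eq_none_iff_forall_ne_some]
        rintro m hm
        obtain ⟨⟨rfl, h2⟩, _⟩ := (hsend j m).1 hm
        exact h (Finset.mem_sdiff.2 ⟨(hS _).2 ⟨j, rfl⟩, h2⟩)
  refine ⟨hu, ?_⟩
  funext j
  rw [hu.gstep_apply, census_recv_buf (by simp) (by simp)]
  simp only [CensusState.mk.injEq, true_and]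
  congr 1
  by_cases h : id j ∈ A
  · have hKA := (hK j).2 ((hK j).1.2 h)
    rw [if_pos h]
    by_cases h2 : 40 * blockRank A L (id j) ≤ y ∧ y < 40 * (blockRank A L (id j) + 1)
    · rw [if_pos (show (F.census N).interested (.report y) (joint id K B j) from
        ⟨(hK j).1.2 h, by simp only [hKA]; exact h2⟩), hc]
      ext z
      simp only [Finset.mem_filter, and_congr_right_iff]
      rintro _
      constructor
      · rintro rfl; exact ⟨rfl, h2⟩
      · exact fun h => h.1
    · rw [if_neg (fun h' : (F.census N).interested (.report y) (joint id K B j) =>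
        h2 (by have := h'.2; simp only [hKA] at this; exact this)), Option.getD_none, eq_comm,
        Finset.filter_eq_empty_iff]
      rintro z _ ⟨rfl, h3⟩
      exact h2 h3
  · rw [if_neg h, if_neg (fun h' : (F.census N).interested (.report y) (joint id K B j) =>
      h ((hK j).1.1 h'.1))]
    rfl

lemma exec_report (hS : ∀ n, n ∈ S ↔ ∃ j, id j = n) (hinj : Function.Injective id)
    (hK : ∀ j, (id j ∈ K j ↔ id j ∈ A) ∧ (id j ∈ K j → K j = A)) (l : List ℕ) :
    (F.census N).CollisionFree (l.map .report) (joint id K B) ∧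
    (F.census N).exec (l.map .report) (joint id K B) = (joint id K fun j =>
      B j ∪ if id j ∈ A then (S \ A).filter (fun z => z ∈ l ∧ 40 * blockRank A L (id j) ≤ z ∧
        z < 40 * (blockRank A L (id j) + 1)) else ∅) ∧
    ∀ j, (F.census N).cost (l.map .report) (joint id K B) j ≤ l.count (id j) +
      l.countP fun b => 40 * blockRank (K j) L (id j) ≤ b ∧
        b < 40 * (blockRank (K j) L (id j) + 1) := by
  induction l generalizing B with
  | nil => simp [SlotMachine.CollisionFree, SlotMachine.cost]
  | cons b l ih =>
    simp only [List.map_cons, SlotMachine.CollisionFree, SlotMachine.exec_cons, SlotMachine.cost]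
    obtain ⟨hu, hg⟩ := gstep_report (F := F) (N := N) (B := B) hS hinj hK b
    rw [hg]
    obtain ⟨h1, h2, h3⟩ := ih (B := fun j =>
      B j ∪ if id j ∈ A then (S \ A).filter (fun z => z = b ∧ 40 * blockRank A L (id j) ≤ z ∧
        z < 40 * (blockRank A L (id j) + 1)) else ∅)
    refine ⟨⟨hu, h1⟩, ?_, fun j => ?_⟩
    · rw [h2]
      funext j
      simp only [CensusState.mk.injEq, true_and]
      by_cases h : id j ∈ A
      · simp only [h, if_true, List.mem_cons]
        ext y
        simp only [Finset.mem_union, Finset.mem_filter]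
        tauto
      · simp only [h, if_false, Finset.union_empty]
    · have hc : ((F.census N).act (.report b) (joint id K B j)).cost ≤
          (if b = id j then 1 else 0) + if 40 * blockRank (K j) L (id j) ≤ b ∧
            b < 40 * (blockRank (K j) L (id j) + 1) then 1 else 0 := by
        refine SlotMachine.cost_act_le (fun h => ?_) fun h => h.2
        simp only [censusSend, ne_eq, ite_eq_right_iff, reduceCtorEq, imp_false, not_not] at h
        exact h.1.symm
      refine (Nat.add_le_add hc (h3 j)).trans ?_
      rw [List.count_cons, List.countP_cons]
      simp only [beq_iff_eq, decide_eq_true_eq]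
      omega

/-- What the survivor `x` has collected after `n` slots of the chain. -/
def collected (L : ℕ) (S A : Finset ℕ) (n x : ℕ) : Finset ℕ :=
  if x ∈ A then (S \ A).filter fun z => (n < blockRank A L x → 40 * blockRank A L x ≤ z) ∧
    z < 40 * (blockRank A L x + 1) else ∅

/-- When the survivor of rank n speaks it already holds all dropped IDs below 40 * (n + 1). Joined
with the window of rank n + 1, they give all dropped IDs below the end of that window. -/
lemma gstep_chain (hS : ∀ n, n ∈ S ↔ ∃ j, id j = n) (hinj : Function.Injective id)
    (hL : ∀ n ∈ S, n < 2 ^ L) (hAS : A ⊆ S)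
    (hK : ∀ j, (id j ∈ K j ↔ id j ∈ A) ∧ (id j ∈ K j → K j = A)) (n : ℕ) :
    (F.census N).UniqueSender (.chain n) (joint id K fun j => collected L S A n (id j)) ∧
    (F.census N).gstep (joint id K fun j => collected L S A n (id j)) (.chain n) =
      joint id K fun j => collected L S A (n + 1) (id j) := by
  set st : ι → CensusState := joint id K fun j => collected L S A n (id j) with hst
  have hsend : ∀ j m, (F.census N).send (.chain n) (st j) = some m ↔
      (id j ∈ A ∧ blockRank A L (id j) = n) ∧ collected L S A n (id j) = m := by
    intro j m
    simp only [hst, censusSend, Option.ite_none_right_eq_some, Option.some.injEq]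
    refine and_congr_left fun _ => ?_
    constructor
    · rintro ⟨h1, h2⟩; exact ⟨(hK j).1.1 h1, by rwa [(hK j).2 h1] at h2⟩
    · rintro ⟨h1, h2⟩
      have h3 := (hK j).1.2 h1
      exact ⟨h3, by rwa [(hK j).2 h3]⟩
  have hdiv : ∀ x ∈ A, x / 2 ^ L = 0 := fun x hx => Nat.div_eq_of_lt (hL x (hAS hx))
  have hu : (F.census N).UniqueSender (.chain n) st := by
    intro j j' m m' h h'
    obtain ⟨⟨h1, h2⟩, _⟩ := (hsend _ _).1 h
    obtain ⟨⟨h3, h4⟩, _⟩ := (hsend _ _).1 h'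
    exact hinj (blockRank_inj h1 h3 (by rw [hdiv _ h1, hdiv _ h3]) (h2.trans h4.symm))
  refine ⟨hu, ?_⟩
  funext j
  rw [hu.gstep_apply, census_recv_buf (by simp) (by simp)]
  simp only [hst, CensusState.mk.injEq, true_and]
  by_cases h : id j ∈ A ∧ blockRank A L (id j) = n + 1
  · obtain ⟨h1, h2⟩ := h
    have hKA := (hK j).1.2 h1
    obtain ⟨y, hyA, _, hyn⟩ := exists_blockRank_eq (U := A) (p := L) (c := id j / 2 ^ L) (j := n)
      (by have := blockRank_lt_card (p := L) h1; omega)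
    obtain ⟨i, rfl⟩ := (hS y).1 (hAS hyA)
    have hc := hu.content_eq ((hsend i _).2 ⟨⟨hyA, hyn⟩, rfl⟩)
    rw [if_pos (show (F.census N).interested (.chain n) (st j) from
      ⟨hKA, by simp only [hst]; rw [(hK j).2 hKA]; exact h2⟩), hc]
    simp only [Option.getD_some, collected, h1, if_true, hyA, h2, hyn]
    ext z
    simp only [Finset.mem_union, Finset.mem_filter]
    by_cases hz : z ∈ S \ A
    · simp only [hz, true_and]; omega
    · simp [hz]
  · rw [if_neg (fun h' : (F.census N).interested (.chain n) (st j) =>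
      h ⟨(hK j).1.1 h'.1, by have := h'.2; simp only [hst] at this; rwa [(hK j).2 h'.1] at this⟩)]
    simp only [Option.getD_none, Finset.union_empty, collected]
    by_cases h1 : id j ∈ A
    · simp only [h1, if_true]
      have h2 : blockRank A L (id j) ≠ n + 1 := fun h2 => h ⟨h1, h2⟩
      ext z
      simp only [Finset.mem_filter, and_congr_right_iff]
      intro _
      omega
    · simp only [h1, if_false]

lemma exec_chain (hS : ∀ n, n ∈ S ↔ ∃ j, id j = n) (hinj : Function.Injective id)
    (hL : ∀ n ∈ S, n < 2 ^ L) (hAS : A ⊆ S)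
    (hK : ∀ j, (id j ∈ K j ↔ id j ∈ A) ∧ (id j ∈ K j → K j = A)) (n : ℕ) :
    (F.census N).CollisionFree ((List.range n).map .chain)
      (joint id K fun j => collected L S A 0 (id j)) ∧
    (F.census N).exec ((List.range n).map .chain)
      (joint id K fun j => collected L S A 0 (id j)) =
      (joint id K fun j => collected L S A n (id j)) ∧
    ∀ j, (F.census N).cost ((List.range n).map .chain)
      (joint id K fun j => collected L S A 0 (id j)) j ≤
      (List.range n).count (blockRank (K j) L (id j)) +
      (List.range (n + 1)).count (blockRank (K j) L (id j)) := by
  induction n with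
  | zero => simp [SlotMachine.CollisionFree, SlotMachine.cost]
  | succ n ih =>
    obtain ⟨h1, h2, h3⟩ := ih
    obtain ⟨g1, g2⟩ := gstep_chain (F := F) (N := N) hS hinj hL hAS hK n
    rw [List.range_succ, List.map_append, List.map_singleton]
    refine ⟨?_, ?_, fun j => ?_⟩
    · rw [SlotMachine.collisionFree_append, h2]; exact ⟨h1, g1, trivial⟩
    · rw [SlotMachine.exec_append, h2, SlotMachine.exec_cons, g2, SlotMachine.exec_nil]
    · rw [SlotMachine.cost_append, h2]
      have hc :
          ((F.census N).act (.chain n) (joint id K (fun j => collected L S A n (id j)) j)).cost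
          ≤ (if n = blockRank (K j) L (id j) then 1 else 0) +
            if n + 1 = blockRank (K j) L (id j) then 1 else 0 := by
        refine SlotMachine.cost_act_le (fun h => ?_) fun h => h.2.symm
        simp only [censusSend, ne_eq, ite_eq_right_iff, reduceCtorEq, imp_false, not_not] at h
        exact h.2.symm
      simp only [SlotMachine.cost, add_zero]
      refine (Nat.add_le_add (h3 j) hc).trans ?_
      rw [List.range_succ (n := n + 1), List.range_succ (n := n)]
      simp only [List.count_append, List.count_singleton, beq_iff_eq]
      omega

/-- The effect of all slots before the announcement. -/
lemma exec_mainSlots (hS : ∀ n, n ∈ S ↔ ∃ j, id j = n) (hinj : Function.Injective id)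
    (hL : ∀ n ∈ S, n < 2 ^ L) :
    ∃ K : ι → Finset ℕ, (∀ j, (id j ∈ K j ↔ id j ∈ F.survivors S L) ∧
      (id j ∈ K j → K j = F.survivors S L)) ∧
    (F.census N).CollisionFree (mainSlots L) (joint id (fun j => {id j}) fun _ => ∅) ∧
    (F.census N).exec (mainSlots L) (joint id (fun j => {id j}) fun _ => ∅) =
      (joint id K fun j => collected L S (F.survivors S L) (2 ^ L) (id j)) ∧
    ∀ j, (F.census N).cost (mainSlots L) (joint id (fun j => {id j}) fun _ => ∅) j ≤
      3 * k + 250 := by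
  classical
  obtain ⟨K, hK, h1, h2, h3⟩ := exec_stages (F := F) (N := N) hS hinj hL L le_rfl
  have hKA : ∀ j, (id j ∈ K j ↔ id j ∈ F.survivors S L) ∧
      (id j ∈ K j → K j = F.survivors S L) :=
    fun j => WakeForest.Knows.final F hL ((hS _).2 ⟨j, rfl⟩) (hK j)
  obtain ⟨g1, g2, g3⟩ := exec_report (F := F) (N := N) (B := fun _ => ∅) hS hinj hKA
    (List.range (2 ^ L))
  obtain ⟨e1, e2, e3⟩ := exec_chain (F := F) (N := N) hS hinj hL (F.survivors_subset S L) hKA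
    (2 ^ L)
  have hst : (fun j => (∅ : Finset ℕ) ∪ if id j ∈ F.survivors S L then
      (S \ F.survivors S L).filter (fun z => z ∈ List.range (2 ^ L) ∧
        40 * blockRank (F.survivors S L) L (id j) ≤ z ∧
        z < 40 * (blockRank (F.survivors S L) L (id j) + 1)) else ∅) =
      fun j => collected L S (F.survivors S L) 0 (id j) := by
    funext j
    rw [Finset.empty_union, collected]
    split_ifs with h
    · ext z
      simp only [Finset.mem_filter, Finset.mem_sdiff, List.mem_range]
      constructor
      · rintro ⟨a1, a2, a3, a4⟩; exact ⟨a1, fun _ => a3, a4⟩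
      · rintro ⟨a1, a2, a4⟩; exact ⟨a1, hL z a1.1, by omega, a4⟩
    · rfl
  rw [hst] at g2
  refine ⟨K, hKA, ?_, ?_, fun j => ?_⟩
  · rw [mainSlots, SlotMachine.collisionFree_append, SlotMachine.collisionFree_append,
      SlotMachine.exec_append, h2, g2]
    exact ⟨⟨h1, g1⟩, e1⟩
  · rw [mainSlots, SlotMachine.exec_append, SlotMachine.exec_append, h2, g2, e2]
  · rw [mainSlots, SlotMachine.cost_append, SlotMachine.cost_append, SlotMachine.exec_append,
      h2, g2]
    have a1 := h3 j
    have a2 := g3 j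
    have a3 := e3 j
    -- The budget is k + 66 for speaking and 2 * (k + 67) for listening in the stages, 1 + 40 in the
    -- reports and 1 + 1 in the chain, which is within 3 * k + 250.
    have b1 := F.card_candidate_le S (id j) L
    have b2 := F.card_candidate_le S (id j) (L + 1)
    have b3 := count_range_le (2 ^ L) (id j)
    have b4 := countP_range_le (2 ^ L) 40 (fun b => 40 * blockRank (K j) L (id j) ≤ b ∧
        b < 40 * (blockRank (K j) L (id j) + 1)) (40 * blockRank (K j) L (id j)) fun b hb => by
      have := of_decide_eq_true hb
      omega
    have b5 := count_range_le (2 ^ L) (blockRank (K j) L (id j))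
    have b6 := count_range_le (2 ^ L + 1) (blockRank (K j) L (id j))
    omega

lemma length_mainSlots (L : ℕ) : (mainSlots L).length + 2 ≤ 6 * 2 ^ L := by
  -- The merge slots form a geometric series; the extra summand n counts the commit slots.
  have h : ∀ n, n ≤ L →
      ((List.range n).flatMap (stageSlots L)).length + 2 * 2 ^ (L - n) ≤ 2 * 2 ^ L + n := by
    intro n
    induction n with
    | zero => simp
    | succ n ih =>
      intro hn
      have := ih (by omega)
      rw [List.range_succ, List.flatMap_append, List.flatMap_singleton, List.length_append]
      simp only [stageSlots, List.length_append, List.length_map, List.length_range,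
        List.length_singleton]
      have h2 : 2 ^ (L - n) = 2 * 2 ^ (L - (n + 1)) := by
        rw [← pow_succ']; congr 1; omega
      omega
  have h1 := h L le_rfl
  have h2 : L < 2 ^ L := Nat.lt_two_pow_self
  simp only [mainSlots, List.length_append, List.length_map, List.length_range]
  rw [Nat.sub_self, pow_zero] at h1
  omega

end WakeForest

end RadioNetwork

/-! ### The dense Census: announcement, constants and correctness -/

namespace RadioNetwork

lemma invAck_spec (x : ℝ) : 1 ≤ invAck x ∧ x ≤ ack (invAck x) (invAck x) := by
  have hne : {k : ℕ | 1 ≤ k ∧ x ≤ (ack k k : ℝ)}.Nonempty := by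
    refine ⟨⌈x⌉₊ + 1, by omega, ?_⟩
    have h1 : ⌈x⌉₊ + 1 ≤ ack (⌈x⌉₊ + 1) (⌈x⌉₊ + 1) := (lt_ack_left _ _).le
    have h2 : ((⌈x⌉₊ + 1 : ℕ) : ℝ) ≤ ack (⌈x⌉₊ + 1) (⌈x⌉₊ + 1) := by exact_mod_cast h1
    have := Nat.le_ceil x
    push_cast at h2
    linarith
  exact Nat.sInf_mem hne

lemma invAck_mono {x y : ℝ} (h : x ≤ y) : invAck x ≤ invAck y :=
  Nat.sInf_le ⟨(invAck_spec y).1, h.trans (invAck_spec y).2⟩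

/-- Only the logarithm of N many stages are needed, so the forest for parameter `invAck N` is more
than long enough. -/
lemma clog_le_ack_invAck (N : ℕ) : Nat.clog 2 N ≤ ack (invAck N) (invAck N) := by
  have h1 : Nat.clog 2 N ≤ N := Nat.clog_le_of_le_pow Nat.lt_two_pow_self.le
  have h2 : N ≤ ack (invAck N) (invAck N) := by exact_mod_cast (invAck_spec N).2
  omega

/-- The wake-up forest used on the ID space `{0, …, N - 1}`. -/
noncomputable def censusForest (N : ℕ) : WakeForest (Nat.clog 2 N) (invAck N) :=
  Classical.choice (nonempty_wakeForest (clog_le_ack_invAck N))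

/-- The dense Census algorithm. -/
noncomputable def denseCensus : CensusFamily (Finset ℕ) :=
  fun N => ((censusForest N).census N).toProtocol

/-- The running time of the dense Census algorithm. -/
noncomputable def censusTime (N : ℕ) : ℕ := ((censusForest N).census N).schedule.length

lemma two_pow_clog_le {N : ℕ} (hN : 1 ≤ N) : 2 ^ Nat.clog 2 N ≤ 2 * N := by
  rcases hN.lt_or_eq with h | rfl
  · have h1 := Nat.pow_pred_clog_lt_self one_lt_two h
    have h2 := Nat.clog_pos one_lt_two h
    have h3 : 2 ^ Nat.clog 2 N = 2 * 2 ^ (Nat.clog 2 N).pred := by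
      rw [← pow_succ']; congr 1; simp only [Nat.pred_eq_sub_one]; omega
    omega
  · simp

lemma censusTime_le {N : ℕ} (hN : 1 ≤ N) : censusTime N ≤ 12 * N := by
  have h1 := WakeForest.length_mainSlots (Nat.clog 2 N)
  have h2 := two_pow_clog_le hN
  simp only [censusTime, List.length_append, List.length_singleton]
  omega

namespace WakeForest

variable {L k : ℕ} {F : WakeForest L k}
variable {N : ℕ} {ι : Type} {id : ι → ℕ} {S A : Finset ℕ} {K B : ι → Finset ℕ}

lemma isLast_joint (hK : ∀ j, (id j ∈ K j ↔ id j ∈ A) ∧ (id j ∈ K j → K j = A)) (j : ι) :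
    (joint id K B j).IsLast L ↔ id j ∈ A ∧ blockRank A L (id j) + 1 = A.card := by
  unfold CensusState.IsLast
  constructor
  · rintro ⟨h1, h2⟩
    exact ⟨(hK j).1.1 h1, by simp only [(hK j).2 h1] at h2; exact h2⟩
  · rintro ⟨h1, h2⟩
    have h3 := (hK j).1.2 h1
    exact ⟨h3, by simp only [(hK j).2 h3]; exact h2⟩

lemma send_announce (s : CensusState) : (F.census N).send .announce s =
    if s.IsLast L then some (s.know ∪ s.buf) else none := rfl

lemma uniqueSender_announce (hinj : Function.Injective id) (hL : ∀ n ∈ A, n < 2 ^ L)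
    (hK : ∀ j, (id j ∈ K j ↔ id j ∈ A) ∧ (id j ∈ K j → K j = A)) :
    (F.census N).UniqueSender .announce (joint id K B) := by
  intro j j' m m' h h'
  rw [send_announce, Option.ite_none_right_eq_some, isLast_joint hK] at h h'
  obtain ⟨⟨h1, h2⟩, _⟩ := h
  obtain ⟨⟨h3, h4⟩, _⟩ := h'
  refine hinj (blockRank_inj (p := L) h1 h3 ?_ (by omega))
  rw [Nat.div_eq_of_lt (hL _ h1), Nat.div_eq_of_lt (hL _ h3)]

lemma collected_subset {n x : ℕ} : collected L S A n x ⊆ S := by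
  unfold collected
  split_ifs
  · exact (Finset.filter_subset _ _).trans Finset.sdiff_subset
  · simp

/-- The density condition says that the windows of 40 IDs of all survivors together cover the whole
ID space. This is the only place where the reports could otherwise go unheard. -/
lemma union_collected (hL : ∀ n ∈ S, n < 2 ^ L) (hAS : A ⊆ S) (hA : 2 ^ L ≤ 40 * A.card) {x : ℕ}
    (hx : x ∈ A) (hlast : blockRank A L x + 1 = A.card) :
    A ∪ collected L S A (2 ^ L) x = S := by
  refine subset_antisymm (Finset.union_subset hAS collected_subset) fun y hy => ?_
  by_cases hyA : y ∈ A
  · exact Finset.mem_union_left _ hyA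
  · refine Finset.mem_union_right _ ?_
    have hcard : A.card ≤ 2 ^ L := by
      calc A.card ≤ (Finset.range (2 ^ L)).card :=
            Finset.card_le_card fun z hz => Finset.mem_range.2 (hL z (hAS hz))
        _ = 2 ^ L := Finset.card_range _
    have := hL y hy
    simp only [collected, hx, if_true, Finset.mem_filter, Finset.mem_sdiff]
    exact ⟨⟨hy, hyA⟩, by omega, by omega⟩

end WakeForest

open WakeForest

/-- The execution of the dense Census algorithm on an arbitrary set of devices. -/
lemma denseCensus_spec {N : ℕ} (hN : 1 ≤ N) (S : Finset (Fin N)) :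
    (∀ (t : ℕ) (i j : S) (m m' : Finset ℕ),
      (denseCensus N).actionAt .noCD (Subtype.val : S → Fin N) t i = .transmit m →
      (denseCensus N).actionAt .noCD (Subtype.val : S → Fin N) t j = .transmit m' → i = j) ∧
    (∀ i : S, ∃ o, (denseCensus N).OutputAt .noCD (Subtype.val : S → Fin N) (censusTime N) i o ∧
      ∀ I, o = some I → I.card ≤ S.card) ∧
    (∀ i : S, (denseCensus N).energy .noCD (Subtype.val : S → Fin N) (censusTime N) i ≤
      3 * invAck N + 251) ∧
    ((N : ℝ) ≤ 10 * S.card → SolvesCensus (denseCensus N)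
      (fun m : Finset ℕ => Finset.univ.filter fun j : Fin N => (j : ℕ) ∈ m) S (censusTime N)) := by
  set F := censusForest N with hF
  set id : S → ℕ := fun i => ((i : Fin N) : ℕ) with hid
  set S' : Finset ℕ := S.map Fin.valEmbedding with hS'
  have hS : ∀ n, n ∈ S' ↔ ∃ j, id j = n := by
    intro n
    simp [hS', hid]
  have hinj : Function.Injective id := fun i j h => Subtype.ext (Fin.ext h)
  have hL : ∀ n ∈ S', n < 2 ^ Nat.clog 2 N := by
    intro n hn
    obtain ⟨j, rfl⟩ := (hS n).1 hn
    exact (j : Fin N).2.trans_le (Nat.le_pow_clog one_lt_two N)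
  obtain ⟨K, hK, h1, h2, h3⟩ := exec_mainSlots (F := F) (N := N) hS hinj hL
  set A := F.survivors S' (Nat.clog 2 N) with hA
  have hAS : A ⊆ S' := F.survivors_subset S' (Nat.clog 2 N)
  set st : S → CensusState :=
      joint id K fun j => collected (Nat.clog 2 N) S' A (2 ^ Nat.clog 2 N) (id j) with hst
  have hu : (F.census N).UniqueSender .announce st :=
    uniqueSender_announce hinj (fun n hn => hL n (hAS hn)) hK
  have hfree : (F.census N).CollisionFree (F.census N).schedule
      fun i : S => (F.census N).start i.val := by
    rw [SlotMachine.collisionFree_append]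
    exact ⟨h1, by rw [h2]; exact hu, trivial⟩
  have hexec : (F.census N).exec (F.census N).schedule
      (fun i : S => (F.census N).start i.val) = st := by
    change (F.census N).exec (mainSlots (Nat.clog 2 N) ++ [.announce])
        (joint id (fun j => {id j}) fun _ => ∅) = _
    rw [SlotMachine.exec_append, h2]
    rfl
  have hout : ∀ i : S, (denseCensus N).OutputAt .noCD (Subtype.val : S → Fin N) (censusTime N) i
      ((F.census N).out (st i)) := by
    intro i
    have := SlotMachine.outputAt_toProtocol (Q := F.census N) (Subtype.val : S → Fin N) i
    rwa [hexec] at this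
  have hval : ∀ U : Finset ℕ, U ⊆ S' →
      (Finset.univ.filter fun j : Fin N => (j : ℕ) ∈ U) ⊆ S := by
    intro U hU j hj
    have := hU (Finset.mem_filter.1 hj).2
    simpa [hS', Fin.val_inj] using this
  refine ⟨fun t i j m m' hi hj => SlotMachine.eq_of_actionAt_transmit _ hfree hi hj,
    fun i => ⟨_, hout i, fun I hI => ?_⟩, fun i => ?_, fun hdense => ?_⟩
  · simp only [Option.ite_none_right_eq_some, Option.some.injEq] at hI
    obtain ⟨hl, rfl⟩ := hI
    refine Finset.card_le_card (hval _ (Finset.union_subset ?_ collected_subset))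
    have hl' := (isLast_joint hK i).1 hl
    simp only [hst]
    rw [(hK i).2 ((hK i).1.2 hl'.1)]
    exact hAS
  · have := SlotMachine.energy_toProtocol (Q := F.census N) (Subtype.val : S → Fin N) i
    refine this.trans_le ?_
    change (F.census N).cost (mainSlots (Nat.clog 2 N) ++ [.announce])
      (joint id (fun j => {id j}) fun _ => ∅) i ≤ _
    rw [SlotMachine.cost_append, h2]
    have e1 := h3 i
    have e2 : (F.census N).cost [.announce] st i ≤ 1 := by
      simp only [SlotMachine.cost, add_zero]
      cases (F.census N).act .announce (st i) <;> simp [Action.cost]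
    omega
  · have hcard : S'.card = S.card := Finset.card_map _
    have h4 := F.card_survivors_ge hL
    have h5 : ((2 ^ Nat.clog 2 N : ℕ) : ℝ) ≤ ((2 * N : ℕ) : ℝ) := by
        exact_mod_cast two_pow_clog_le hN
    push_cast at h5
    rw [hcard] at h4
    -- The power of two is at most 2 * N ≤ 20 * |S|, so |A| is at least its 1 / 20 - 1 / 64, which
    -- exceeds 1 / 40.
    have hA40 : 2 ^ Nat.clog 2 N ≤ 40 * A.card := by
      have : (2 : ℝ) ^ Nat.clog 2 N ≤ 40 * A.card := by linarith
      exact_mod_cast this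
    have hApos : 0 < A.card := by
      have : 0 < 2 ^ Nat.clog 2 N := by positivity
      omega
    have hf : (A.filter fun y => y / 2 ^ Nat.clog 2 N = 0) = A :=
      Finset.filter_true_of_mem fun y hy => Nat.div_eq_of_lt (hL y (hAS hy))
    obtain ⟨y, hyA, _, hy⟩ := exists_blockRank_eq (U := A)
        (p := (Nat.clog 2 N)) (c := 0) (j := A.card - 1)
      (by rw [hf]; omega)
    obtain ⟨s, rfl⟩ := (hS y).1 (hAS hyA)
    have hKs : K s = A := (hK s).2 ((hK s).1.2 hyA)
    have hlast : (st s).IsLast (Nat.clog 2 N) := (isLast_joint hK s).2 ⟨hyA, by omega⟩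
    have hunion : (st s).know ∪ (st s).buf = S' := by
      simp only [hst, hKs]
      exact union_collected hL hAS hA40 hyA (by omega)
    have hread : (Finset.univ.filter fun j : Fin N => (j : ℕ) ∈ S') = S := by
      ext j
      simp [hS', Fin.val_inj]
    have hnot : ∀ i, i ≠ s → ¬ (st i).IsLast (Nat.clog 2 N) := by
      intro i hi hl
      exact hi (hu i s _ _ (by rw [send_announce, if_pos hl])
        (by rw [send_announce, if_pos hlast]))
    have hact : ∀ i : S, (denseCensus N).actionAt .noCD (Subtype.val : S → Fin N)
        (mainSlots (Nat.clog 2 N)).length i = (F.census N).act .announce (st i) := by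
      intro i
      have hlt : (mainSlots (Nat.clog 2 N)).length < (F.census N).schedule.length := by simp
      have := SlotMachine.actionAt_toProtocol (Q := F.census N) (Subtype.val : S → Fin N) hlt i
      refine this.trans ?_
      have e1 : (F.census N).schedule[(mainSlots (Nat.clog 2 N)).length] = .announce := by simp
      have e2 : (F.census N).schedule.take (mainSlots (Nat.clog 2 N)).length =
            mainSlots (Nat.clog 2 N) := by simp
      rw [e1, e2]
      exact congrArg (fun f : S → CensusState => (F.census N).act .announce (f i)) h2
    refine ⟨s, ?_, fun i hi => ?_,
        (mainSlots (Nat.clog 2 N)).length, S', ?_, ?_, hread, fun i hi => ?_⟩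
    · have := hout s
      rw [show (F.census N).out (st s) = some S by
        change (if (st s).IsLast (Nat.clog 2 N) then _ else _) = _
        rw [if_pos hlast, hunion, hread]] at this
      exact this
    · have := hout i
      rwa [show (F.census N).out (st i) = none from if_neg (hnot i hi)] at this
    · simp [censusTime]
    · rw [hact, SlotMachine.act_eq_transmit, send_announce, if_pos hlast, hunion]
    · rw [hact]
      exact SlotMachine.act_of_send_eq_none (by rw [send_announce, if_neg (hnot i hi)]) trivial

lemma isDenseCensus_denseCensus {c : ℝ} (hc : 0.1 ≤ c) : IsDenseCensus c denseCensus := by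
  -- 254 = 3 + 251 absorbs the additive energy, as `invAck N` is at least 1; it also exceeds the
  -- time factor 12.
  refine ⟨254, fun N m => Finset.univ.filter fun j : Fin N => (j : ℕ) ∈ m, fun N hN S => ?_⟩
  obtain ⟨h1, _, h3, h4⟩ := denseCensus_spec hN S
  refine ⟨h1, fun hS => ⟨censusTime N, ?_, h4 ?_, fun i => ?_⟩⟩
  · have h : ((censusTime N : ℕ) : ℝ) ≤ ((12 * N : ℕ) : ℝ) := by exact_mod_cast censusTime_le hN
    push_cast at h
    have : (0 : ℝ) ≤ N := by positivity
    linarith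
  · have : (0 : ℝ) ≤ N := by positivity
    nlinarith
  · have h : (((denseCensus N).energy .noCD (Subtype.val : S → Fin N) (censusTime N) i : ℕ) : ℝ) ≤
        ((3 * invAck N + 251 : ℕ) : ℝ) := by exact_mod_cast h3 i
    have h5 : (1 : ℝ) ≤ (invAck N : ℝ) := by exact_mod_cast (invAck_spec N).1
    push_cast at h
    linarith

end RadioNetwork

namespace RadioNetwork

/-! ### Sequential composition -/

namespace Protocol

variable {X M O Y ι : Type} {P : Protocol X M Y} {Q : Protocol Y M O} {c : CDModel} {x : ι → X}
  {y : ι → Y} {T : ℕ}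

lemma handOver_of_inl {s : P.State} {a : Action M} (h : P.next s = .inl a) :
    handOver P Q s = .inl s := by
  unfold handOver; rw [h]

lemma handOver_of_inr {s : P.State} {o : Y} (h : P.next s = .inr o) :
    handOver P Q s = .inr (Q.init o) := by
  unfold handOver; rw [h]

/-- Since all devices leave the first protocol at the same time T, the two phases never share a slot
and each runs as if it were alone. -/
lemma seq_run_of_le (h : ∀ t < T, ∀ i, ∃ a, P.next (P.run c x t i) = .inl a) {t : ℕ} (ht : t ≤ T)
    (i : ι) : (P.seq Q).run c x t i = handOver P Q (P.run c x t i) := by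
  induction t generalizing i with
  | zero => rfl
  | succ t ih =>
    have hs : ∀ j, (P.seq Q).run c x t j = .inl (P.run c x t j) := fun j => by
      obtain ⟨a, ha⟩ := h t ht j
      rw [ih (by omega), handOver_of_inl ha]
    change (P.seq Q).step ((P.seq Q).run c x t i) (c.hear (channel fun j =>
      (P.seq Q).action ((P.seq Q).run c x t j)) ((P.seq Q).action ((P.seq Q).run c x t i))) =
      handOver P Q (P.step (P.run c x t i) _)
    simp only [hs]
    obtain ⟨a, ha⟩ := h t ht i
    have hstep : ∀ sig, P.step (P.run c x t i) sig = P.update (P.run c x t i) sig := fun sig => by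
      unfold step; rw [ha]
    rw [hstep]
    rfl

lemma seq_actionAt_of_lt (h : ∀ t < T, ∀ i, ∃ a, P.next (P.run c x t i) = .inl a) {t : ℕ}
    (ht : t < T) (i : ι) : (P.seq Q).actionAt c x t i = P.actionAt c x t i := by
  obtain ⟨a, ha⟩ := h t ht i
  unfold actionAt
  rw [seq_run_of_le h ht.le, handOver_of_inl ha]
  rfl

lemma seq_run_add (h : ∀ t < T, ∀ i, ∃ a, P.next (P.run c x t i) = .inl a)
    (h' : ∀ i, P.next (P.run c x T i) = .inr (y i)) (t : ℕ) (i : ι) :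
    (P.seq Q).run c x (T + t) i = .inr (Q.run c y t i) := by
  induction t generalizing i with
  | zero => rw [add_zero, seq_run_of_le h le_rfl, handOver_of_inr (h' i)]; rfl
  | succ t ih =>
    change (P.seq Q).step ((P.seq Q).run c x (T + t) i) (c.hear (channel fun j =>
      (P.seq Q).action ((P.seq Q).run c x (T + t) j))
        ((P.seq Q).action ((P.seq Q).run c x (T + t) i))) =
      .inr (Q.step (Q.run c y t i) (c.hear (channel fun j => Q.action (Q.run c y t j))
        (Q.action (Q.run c y t i))))
    simp only [ih]
    have hact : ∀ s : Q.State, (P.seq Q).action (.inr s) = Q.action s := fun s => rfl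
    simp only [hact]
    unfold step
    cases hq : Q.next (Q.run c y t i) <;> simp [seq, hq]

lemma seq_outputAt (h : ∀ t < T, ∀ i, ∃ a, P.next (P.run c x t i) = .inl a)
    (h' : ∀ i, P.next (P.run c x T i) = .inr (y i)) (t : ℕ) (i : ι) (o : O) :
    (P.seq Q).OutputAt c x (T + t) i o ↔ Q.OutputAt c y t i o := by
  unfold OutputAt
  rw [seq_run_add h h']
  rfl

lemma seq_energy (h : ∀ t < T, ∀ i, ∃ a, P.next (P.run c x t i) = .inl a)
    (h' : ∀ i, P.next (P.run c x T i) = .inr (y i)) (t : ℕ) (i : ι) :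
    (P.seq Q).energy c x (T + t) i = P.energy c x T i + Q.energy c y t i := by
  unfold energy
  rw [Finset.sum_range_add]
  congr 1
  · refine Finset.sum_congr rfl fun s hs => ?_
    rw [seq_actionAt_of_lt h (Finset.mem_range.1 hs)]
  · refine Finset.sum_congr rfl fun s _ => ?_
    unfold actionAt
    rw [seq_run_add h h']
    rfl

end Protocol

/-! ### ID assignment -/

lemma isMessage_channel {ι M : Type} {a : ι → Action M} :
    (channel a).IsMessage ↔ ∃ i m, IsSoleTransmitter a i m := by
  constructor
  · rintro ⟨m, hm⟩
    obtain ⟨i, hi⟩ := exists_isSoleTransmitter_of_channel hm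
    exact ⟨i, m, hi⟩
  · rintro ⟨i, m, h⟩; exact ⟨m, channel_eq_message h⟩

lemma isMessage_perceive {M : Type} (c : CDModel) (s : Signal M) :
    (c.perceive s).IsMessage ↔ s.IsMessage := by
  cases c <;> cases s <;> simp [CDModel.perceive, Signal.IsMessage]

lemma isMessage_hear_transmit {M : Type} {c : CDModel} (hc : c = .strongCD ∨ c = .senderCD)
    (s : Signal M) (m : M) : (c.hear s (.transmit m)).IsMessage ↔ s.IsMessage := by
  rcases hc with rfl | rfl
  · exact isMessage_perceive .strongCD s
  · exact isMessage_perceive .senderCD s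

section Assign

variable {ι M : Type} {N L β : ℕ} {c : CDModel}

/-- Device `i` is the only one with the task `k`. -/
def SoleTask (β : ℕ) (x : ι → Fin L → Bool) (k : ℕ) (i : ι) : Prop :=
  k ∈ tasks β (x i) ∧ ∀ j, j ≠ i → k ∉ tasks β (x j)

lemma SoleTask.eq {x : ι → Fin L → Bool} {k : ℕ} {i j : ι} (h : SoleTask β x k i)
    (h' : SoleTask β x k j) : i = j := by
  by_contra hij
  exact h'.2 i hij h.1

lemma card_tasks_le (coins : Fin L → Bool) : (tasks β coins).card ≤ β := by
  unfold tasks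
  dsimp only
  split_ifs with h
  · exact h.le
  · simp

lemma action_cost_ite_le {A : Action M} {p : Prop} [Decidable p] (h : ¬ p → A = .idle) :
    A.cost ≤ if p then 1 else 0 := by
  split_ifs with hp
  · cases A <;> simp [Action.cost]
  · rw [h hp]; rfl

lemma exists_isSoleTransmitter_ite {A : ι → Action (Option M)} {p : ι → Prop}
    (h : ∀ i m, A i = .transmit m ↔ p i ∧ m = none) :
    (∃ i m, IsSoleTransmitter A i m) ↔ ∃ i, p i ∧ ∀ j, j ≠ i → ¬ p j := by
  constructor
  · rintro ⟨i, m, h1, h2⟩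
    exact ⟨i, ((h i m).1 h1).1, fun j hj hp => h2 j hj none ((h j none).2 ⟨hp, rfl⟩)⟩
  · rintro ⟨i, h1, h2⟩
    exact ⟨i, none, (h i none).2 ⟨h1, rfl⟩, fun j hj m' hm => h2 j hj ((h j m').1 hm).1⟩

open Classical in
lemma assignDirect_run (hc : c = .strongCD ∨ c = .senderCD) (x : ι → Fin N → Bool) {t : ℕ}
    (ht : t ≤ N) (i : ι) : (assignDirect M N β).run c x t i =
      ⟨tasks β (x i), t, False,
        Finset.univ.filter fun k : Fin N => (k : ℕ) < t ∧ SoleTask β x k i⟩ := by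
  induction t generalizing i with
  | zero =>
    change AssignState.mk _ _ _ _ = _
    simp
  | succ t ih =>
    have htN : t < N := ht
    have hrun : ∀ j, (assignDirect M N β).run c x t j = ⟨tasks β (x j), t, False,
        Finset.univ.filter fun k : Fin N => (k : ℕ) < t ∧ SoleTask β x k j⟩ :=
      fun j => ih (by omega) j
    have hact : ∀ j, (assignDirect M N β).action ((assignDirect M N β).run c x t j) =
        if t ∈ tasks β (x j) then .transmit none else .idle := by
      intro j
      rw [hrun]
      simp [Protocol.action, assignDirect, htN]
    change (assignDirect M N β).step ((assignDirect M N β).run c x t i) (c.hear (channel fun j =>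
      (assignDirect M N β).action ((assignDirect M N β).run c x t j)) _) = _
    simp only [hact]
    rw [hrun]
    have hch : (channel fun j => if t ∈ tasks β (x j) then Action.transmit (none : Option M)
        else .idle).IsMessage ↔ ∃ j, SoleTask β x t j := by
      rw [isMessage_channel, exists_isSoleTransmitter_ite (p := fun j => t ∈ tasks β (x j))]
      · rfl
      · intro j m
        split_ifs with h <;> simp [h, eq_comm]
    have hmsg : (t ∈ tasks β (x i) ∧ (c.hear (channel fun j => if t ∈ tasks β (x j) then
        Action.transmit (none : Option M) else .idle) (if t ∈ tasks β (x i) then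
        Action.transmit (none : Option M) else .idle)).IsMessage) ↔ SoleTask β x t i := by
      constructor
      · rintro ⟨h1, h2⟩
        rw [if_pos h1] at h2
        obtain ⟨j, hj⟩ := hch.1 ((isMessage_hear_transmit hc _ _).1 h2)
        by_cases hji : j = i
        · rwa [← hji]
        · exact absurd h1 (hj.2 i (fun h => hji h.symm))
      · intro h
        refine ⟨h.1, ?_⟩
        rw [if_pos h.1]
        exact (isMessage_hear_transmit hc _ _).2 (hch.2 ⟨i, h⟩)
    simp only [Protocol.step, assignDirect, htN, if_true, dif_pos, AssignState.mk.injEq, true_and]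
    simp only [hmsg]
    ext k
    by_cases hs : SoleTask β x t i
    · simp only [hs, if_true, Finset.mem_insert, Finset.mem_filter, Finset.mem_univ, true_and]
      constructor
      · rintro (rfl | ⟨h1, h2⟩)
        · exact ⟨by simp, hs⟩
        · exact ⟨by omega, h2⟩
      · rintro ⟨h1, h2⟩
        rcases Nat.lt_succ_iff_lt_or_eq.1 h1 with h3 | h3
        · exact .inr ⟨h3, h2⟩
        · exact .inl (Fin.ext h3)
    · simp only [hs, if_false, Finset.mem_filter, Finset.mem_univ, true_and]
      constructor
      · rintro ⟨h1, h2⟩; exact ⟨by omega, h2⟩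
      · rintro ⟨h1, h2⟩
        rcases Nat.lt_succ_iff_lt_or_eq.1 h1 with h3 | h3
        · exact ⟨h3, h2⟩
        · rw [h3] at h2; exact absurd h2 hs

/-- Device `i` is the only one with the task `2 * k` and another device is the only one with the
task `2 * k + 1`. -/
def SolePair (β : ℕ) (x : ι → Fin L → Bool) (k : ℕ) (i : ι) : Prop :=
  SoleTask β x (2 * k) i ∧ ∃ j, j ≠ i ∧ SoleTask β x (2 * k + 1) j

/-- What a device does in a slot of the paired ID assignment. -/
lemma assignPaired_action_spec {s : AssignState N} (hs : s.slot < 4 * N) {A B : Prop}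
    (hA : A ↔ 2 * (s.slot / 4) ∈ s.tasks) (hB : B ↔ 2 * (s.slot / 4) + 1 ∈ s.tasks) :
    (s.slot % 4 = 2 → ∀ m, (assignPaired M N β).action s = .transmit m ↔ A ∧ m = none) ∧
    (s.slot % 4 = 2 → B → ¬ A → (assignPaired M N β).action s = .listen) ∧
    (s.slot % 4 = 3 → ∀ m, (assignPaired M N β).action s = .transmit m ↔
      (B ∧ s.heard) ∧ m = none) ∧
    (s.slot % 4 = 3 → A → ¬ B → (assignPaired M N β).action s = .listen) ∧
    (¬ (A ∨ B) → (assignPaired M N β).action s = .idle) := by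
  obtain rfl := propext hA
  obtain rfl := propext hB
  refine ⟨fun h m => ?_, fun h h1 h2 => ?_, fun h m => ?_, fun h h1 h2 => ?_, fun h => ?_⟩
  · simp only [Protocol.action, assignPaired, hs, if_true, h]
    by_cases h1 : 2 * (s.slot / 4) ∈ s.tasks
    · simp [h1, eq_comm]
    · by_cases h2 : 2 * (s.slot / 4) + 1 ∈ s.tasks <;> simp [h1, h2]
  · simp [Protocol.action, assignPaired, hs, h, h1, h2]
  · simp only [Protocol.action, assignPaired, hs, if_true, h]
    by_cases h1 : 2 * (s.slot / 4) + 1 ∈ s.tasks ∧ s.heard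
    · simp [h1, eq_comm]
    · simp only [h1, if_false, false_and]
      split_ifs <;> simp
  · simp [Protocol.action, assignPaired, hs, h, h1, h2]
  · push Not at h
    have h4 : s.slot % 4 = 0 ∨ s.slot % 4 = 1 ∨ s.slot % 4 = 2 ∨ s.slot % 4 = 3 := by omega
    rcases h4 with h4 | h4 | h4 | h4 <;>
      simp [Protocol.action, assignPaired, hs, h4, h.1, h.2]

open Classical in
lemma assignPaired_run (x : ι → Fin (2 * N) → Bool) {t : ℕ} (ht : t ≤ 4 * N) (i : ι) :
    (assignPaired M N β).run c x t i =
      ⟨tasks β (x i), t, t % 4 = 3 ∧ 2 * (t / 4) + 1 ∈ tasks β (x i) ∧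
        2 * (t / 4) ∉ tasks β (x i) ∧ ∃ j, SoleTask β x (2 * (t / 4)) j,
        Finset.univ.filter fun k : Fin N => (k : ℕ) < t / 4 ∧ SolePair β x k i⟩ := by
  induction t generalizing i with
  | zero =>
    change AssignState.mk _ _ _ _ = _
    simp
  | succ t ih =>
    have htN : t < 4 * N := ht
    have hrun := fun j => ih (by omega) j
    have hspec := fun j => assignPaired_action_spec (M := M) (N := N) (β := β)
      (s := (assignPaired M N β).run c x t j) (by rw [hrun]; exact htN)
      (A := 2 * (t / 4) ∈ tasks β (x j)) (B := 2 * (t / 4) + 1 ∈ tasks β (x j))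
      (by rw [hrun]) (by rw [hrun])
    have hslot : ∀ j, ((assignPaired M N β).run c x t j).slot = t := fun j => by rw [hrun]
    have hheard : ∀ j, ((assignPaired M N β).run c x t j).heard ↔
      (t % 4 = 3 ∧ 2 * (t / 4) + 1 ∈ tasks β (x j) ∧
        2 * (t / 4) ∉ tasks β (x j) ∧ ∃ j, SoleTask β x (2 * (t / 4)) j) := fun j => by rw [hrun]
    simp only [hslot, hheard] at hspec
    change (assignPaired M N β).step ((assignPaired M N β).run c x t i) (c.hear (channel fun j =>
      (assignPaired M N β).action ((assignPaired M N β).run c x t j))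
      ((assignPaired M N β).action ((assignPaired M N β).run c x t i))) = _
    set act : ι → Action (Option M) := fun j =>
      (assignPaired M N β).action ((assignPaired M N β).run c x t j) with hactdef
    change (assignPaired M N β).step ((assignPaired M N β).run c x t i)
      (c.hear (channel act) (act i)) = _
    have hlis : act i = .listen → ((c.hear (channel act) (act i)).IsMessage ↔
        ∃ j m, IsSoleTransmitter act j m) := by
      intro h
      rw [h, ← isMessage_channel]
      exact isMessage_perceive _ _
    have h2 : t % 4 = 2 → 2 * (t / 4) + 1 ∈ tasks β (x i) → 2 * (t / 4) ∉ tasks β (x i) →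
        ((c.hear (channel act) (act i)).IsMessage ↔ ∃ j, SoleTask β x (2 * (t / 4)) j) := by
      intro h hB hA
      rw [hlis ((hspec i).2.1 h hB hA),
        exists_isSoleTransmitter_ite (p := fun j => 2 * (t / 4) ∈ tasks β (x j))]
      · rfl
      · exact fun j m => (hspec j).1 h m
    -- If i hears j in the fourth slot, then j has heard a sole first-slot transmitter, which must
    -- be i. Any further second-slot transmitter would have heard i as well and would have collided
    -- with j.
    have h3 : t % 4 = 3 → ((2 * (t / 4) ∈ tasks β (x i) ∧ 2 * (t / 4) + 1 ∉ tasks β (x i) ∧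
        (c.hear (channel act) (act i)).IsMessage) ↔ SolePair β x (t / 4) i) := by
      intro h
      have hex := exists_isSoleTransmitter_ite (A := act) (fun j m => (hspec j).2.2.1 h m)
      constructor
      · rintro ⟨hA, hB, hm⟩
        rw [hlis ((hspec i).2.2.2.1 h hA hB), hex] at hm
        obtain ⟨j, ⟨hj1, _, _, hj2, i', hi'⟩, hj3⟩ := hm
        have hii : i' = i := by
          by_contra hne
          exact hi'.2 i (fun e => hne e.symm) hA
        subst hii
        refine ⟨hi', j, fun e => hj2 (e ▸ hA), hj1, fun j' hj' hB' => ?_⟩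
        refine hj3 j' hj' ⟨hB', h, hB', fun hA' => ?_, i', hi'⟩
        by_cases he : j' = i'
        · exact hB (he ▸ hB')
        · exact hi'.2 j' he hA'
      · rintro ⟨hi, j, hji, hj⟩
        have hB : 2 * (t / 4) + 1 ∉ tasks β (x i) := hj.2 i (fun e => hji e.symm)
        refine ⟨hi.1, hB, ?_⟩
        rw [hlis ((hspec i).2.2.2.1 h hi.1 hB), hex]
        exact ⟨j, ⟨hj.1, h, hj.1, hi.2 j hji, i, hi⟩, fun j' hj' hp => hj.2 j' hj' hp.1⟩
    rw [hrun i]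
    have htN4 : t / 4 < N := by omega
    simp only [Protocol.step, assignPaired, htN, if_true, htN4, dif_pos, AssignState.mk.injEq,
      true_and]
    constructor
    · refine propext ?_
      constructor
      · rintro ⟨h, hB, hA, hm⟩
        have hd : (t + 1) / 4 = t / 4 := by omega
        rw [hd]
        exact ⟨by omega, hB, hA, (h2 h hB hA).1 hm⟩
      · rintro ⟨h, hrest⟩
        have hd : (t + 1) / 4 = t / 4 := by omega
        rw [hd] at hrest
        have h' : t % 4 = 2 := by omega
        exact ⟨h', hrest.1, hrest.2.1, (h2 h' hrest.1 hrest.2.1).2 hrest.2.2⟩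
    · ext k
      by_cases hs : t % 4 = 3
      · have hd : (t + 1) / 4 = t / 4 + 1 := by omega
        simp only [hs, true_and, h3 hs, hd]
        by_cases hp : SolePair β x (t / 4) i
        · simp only [hp, if_true, Finset.mem_insert, Finset.mem_filter, Finset.mem_univ, true_and]
          constructor
          · rintro (rfl | ⟨h1, h2⟩)
            · exact ⟨by simp, hp⟩
            · exact ⟨by omega, h2⟩
          · rintro ⟨h1, h2⟩
            rcases Nat.lt_succ_iff_lt_or_eq.1 h1 with h3 | h3
            · exact .inr ⟨h3, h2⟩
            · exact .inl (Fin.ext h3)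
        · simp only [hp, if_false, Finset.mem_filter, Finset.mem_univ, true_and]
          constructor
          · rintro ⟨h1, h2⟩; exact ⟨by omega, h2⟩
          · rintro ⟨h1, h2⟩
            rcases Nat.lt_succ_iff_lt_or_eq.1 h1 with h3 | h3
            · exact ⟨h3, h2⟩
            · rw [h3] at h2; exact absurd h2 hp
      · have hd : (t + 1) / 4 = t / 4 := by omega
        simp only [hs, false_and, if_false, hd]

end Assign

end RadioNetwork

/-! ### Outcome and energy of the ID assignment -/

namespace RadioNetwork

section Assign

variable {ι M : Type} {N β : ℕ}

/-- The length of the ID assignment. -/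
def CDModel.assignTime : CDModel → ℕ → ℕ
  | .strongCD, N => N
  | .senderCD, N => N
  | .receiverCD, N => 4 * N
  | .noCD, N => 4 * N

/-- Device `i` takes the ID `k`. -/
def Assigned : (c : CDModel) → (β : ℕ) → (x : ι → Fin (c.coinCount N) → Bool) → ℕ → ι → Prop
  | .strongCD, β, x => SoleTask β x
  | .senderCD, β, x => SoleTask β x
  | .receiverCD, β, x => SolePair β x
  | .noCD, β, x => SolePair β x

lemma Assigned.eq {c : CDModel} {x : ι → Fin (c.coinCount N) → Bool} {k : ℕ} {i j : ι}
    (h : Assigned c β x k i) (h' : Assigned c β x k j) : i = j := by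
  cases c
  · exact SoleTask.eq h h'
  · exact SoleTask.eq h h'
  · exact SoleTask.eq h.1 h'.1
  · exact SoleTask.eq h.1 h'.1

-- Distinct IDs come from distinct tasks, so the cap on the tasks also caps the number of devices to
-- be simulated.
open Classical in
lemma card_assigned_le (c : CDModel) (x : ι → Fin (c.coinCount N) → Bool) (i : ι) :
    (Finset.univ.filter fun k : Fin N => Assigned c β x k i).card ≤ β := by
  refine le_trans ?_ (card_tasks_le (β := β) (x i))
  cases c
  · exact Finset.card_le_card_of_injOn (fun k => (k : ℕ))
      (fun k hk => (Finset.mem_filter.1 hk).2.1) fun a _ b _ h => Fin.ext h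
  · exact Finset.card_le_card_of_injOn (fun k => (k : ℕ))
      (fun k hk => (Finset.mem_filter.1 hk).2.1) fun a _ b _ h => Fin.ext h
  · exact Finset.card_le_card_of_injOn (fun k => 2 * (k : ℕ))
      (fun k hk => (Finset.mem_filter.1 hk).2.1.1) fun a _ b _ h => Fin.ext (by simpa using h)
  · exact Finset.card_le_card_of_injOn (fun k => 2 * (k : ℕ))
      (fun k hk => (Finset.mem_filter.1 hk).2.1.1) fun a _ b _ h => Fin.ext (by simpa using h)

open Classical in
lemma assignDirect_spec {c : CDModel} (hc : c = .strongCD ∨ c = .senderCD)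
    (x : ι → Fin N → Bool) :
    (∀ t < N, ∀ i, ∃ a,
      (assignDirect M N β).next ((assignDirect M N β).run c x t i) = .inl a) ∧
    (∀ i, (assignDirect M N β).next ((assignDirect M N β).run c x N i) =
      .inr (Finset.univ.filter fun k : Fin N => SoleTask β x k i)) ∧
    ∀ i, (assignDirect M N β).energy c x N i ≤ 8 * β := by
  refine ⟨fun t ht i => ?_, fun i => ?_, fun i => ?_⟩
  · rw [assignDirect_run hc x ht.le]
    simp [assignDirect, ht]
  · rw [assignDirect_run hc x le_rfl]
    simp [assignDirect]
  · have h : ∀ t ∈ Finset.range N, ((assignDirect M N β).actionAt c x t i).cost ≤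
        if t ∈ tasks β (x i) then 1 else 0 := by
      intro t ht
      refine action_cost_ite_le fun hp => ?_
      rw [Protocol.actionAt, assignDirect_run hc x (Finset.mem_range.1 ht).le]
      simp [Protocol.action, assignDirect, Finset.mem_range.1 ht, hp]
    refine (Finset.sum_le_sum h).trans ?_
    rw [← Finset.card_filter]
    calc _ ≤ (tasks β (x i)).card :=
          Finset.card_le_card fun t ht => (Finset.mem_filter.1 ht).2
      _ ≤ β := card_tasks_le _
      _ ≤ 8 * β := by omega

open Classical in
lemma assignPaired_spec (c : CDModel) (x : ι → Fin (2 * N) → Bool) :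
    (∀ t < 4 * N, ∀ i, ∃ a,
      (assignPaired M N β).next ((assignPaired M N β).run c x t i) = .inl a) ∧
    (∀ i, (assignPaired M N β).next ((assignPaired M N β).run c x (4 * N) i) =
      .inr (Finset.univ.filter fun k : Fin N => SolePair β x k i)) ∧
    ∀ i, (assignPaired M N β).energy c x (4 * N) i ≤ 8 * β := by
  refine ⟨fun t ht i => ?_, fun i => ?_, fun i => ?_⟩
  · rw [assignPaired_run x ht.le]
    simp [assignPaired, ht]
  · rw [assignPaired_run x le_rfl]
    simp [assignPaired]
  · have h : ∀ t ∈ Finset.range (4 * N), ((assignPaired M N β).actionAt c x t i).cost ≤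
        (if 2 * (t / 4) ∈ tasks β (x i) ∨ 2 * (t / 4) + 1 ∈ tasks β (x i) then 1 else 0) := by
      intro t ht
      have ht' := Finset.mem_range.1 ht
      refine action_cost_ite_le fun hp => ?_
      have hspec := (assignPaired_action_spec (M := M) (N := N) (β := β)
        (s := (assignPaired M N β).run c x t i) (by rw [assignPaired_run x ht'.le]; exact ht')
        Iff.rfl Iff.rfl).2.2.2.2
      refine hspec ?_
      rw [assignPaired_run x ht'.le]
      exact hp
    -- A task keeps its device busy only within one block of four slots; d distinguishes the first
    -- (0) from the second (1) slot of a pair.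
    have hcard : ∀ d, ((Finset.range (4 * N)).filter
        fun t => 2 * (t / 4) + d ∈ tasks β (x i)).card ≤ 4 * β := by
      intro d
      refine (Finset.card_le_mul_card_image_of_maps_to (f := fun t => 2 * (t / 4) + d)
        (t := tasks β (x i)) (fun t ht => (Finset.mem_filter.1 ht).2) 4 fun b _ => ?_).trans
        (Nat.mul_le_mul_left _ (card_tasks_le _))
      calc _ ≤ (Finset.Ico (4 * ((b - d) / 2)) (4 * ((b - d) / 2) + 4)).card := by
            refine Finset.card_le_card fun t ht => ?_
            simp only [Finset.mem_filter] at ht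
            rw [Finset.mem_Ico]
            omega
        _ = 4 := by simp
    refine (Finset.sum_le_sum h).trans ?_
    rw [← Finset.card_filter, Finset.filter_or]
    refine (Finset.card_union_le _ _).trans ?_
    have h0 := hcard 0
    have h1 := hcard 1
    simp only [add_zero] at h0
    omega

open Classical in
lemma assignIDs_spec (c : CDModel) (x : ι → Fin (c.coinCount N) → Bool) :
    (∀ t < c.assignTime N, ∀ i, ∃ a,
      (assignIDs M N β c).next ((assignIDs M N β c).run c x t i) = .inl a) ∧
    (∀ i, (assignIDs M N β c).next ((assignIDs M N β c).run c x (c.assignTime N) i) =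
      .inr (Finset.univ.filter fun k : Fin N => Assigned c β x k i)) ∧
    ∀ i, (assignIDs M N β c).energy c x (c.assignTime N) i ≤ 8 * β := by
  cases c
  · exact assignDirect_spec (.inl rfl) x
  · exact assignDirect_spec (.inr rfl) x
  · exact assignPaired_spec _ x
  · exact assignPaired_spec _ x

end Assign

/-! ### Simulation of the Census algorithm -/

lemma Protocol.action_of_inl {X M O : Type} {P : Protocol X M O} {s : P.State} {a : Action M}
    (h : P.next s = .inl a) : P.action s = a := by
  unfold Protocol.action; rw [h]

lemma Protocol.action_of_inr {X M O : Type} {P : Protocol X M O} {s : P.State} {o : O}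
    (h : P.next s = .inr o) : P.action s = .idle := by
  unfold Protocol.action; rw [h]

lemma outerAction_silence {M : Type} (l : Prop) [Decidable l] :
    outerAction (.silence : Signal M) l = if l then .listen else .idle := rfl

section Simulate

variable {ι M : Type} {N : ℕ} {D : Protocol (Fin N) M (Option (Finset (Fin N)))} {θ : ℝ}
  {c : CDModel} {y : ι → Finset (Fin N)} {S : Finset (Fin N)}

open Classical in
lemma simulate_action (v : Σ ids : Finset (Fin N), (ids → D.State)) :
    (simulate θ D).action v = outerAction (channel fun k : v.1 => D.action (v.2 k))
      (∃ k : v.1, D.action (v.2 k) = .listen) := by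
  obtain ⟨ids, v⟩ := v
  by_cases h : ∀ k : ids, ∃ o, D.next (v k) = .inr o
  · have hn : ∃ r, (simulate θ D).next ⟨ids, v⟩ = .inr r := by
      unfold simulate
      dsimp only
      rw [if_pos h]
      exact ⟨_, rfl⟩
    obtain ⟨r, hr⟩ := hn
    have hidle : ∀ k : ids, D.action (v k) = .idle := fun k => by
      obtain ⟨o, ho⟩ := h k
      exact Protocol.action_of_inr ho
    rw [Protocol.action_of_inr hr]
    simp only [hidle]
    rw [channel_eq_silence (by simp), outerAction_silence]
    simp
  · refine Protocol.action_of_inl ?_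
    unfold simulate
    dsimp only
    rw [if_neg h]

open Classical in
lemma simulate_step (v : Σ ids : Finset (Fin N), (ids → D.State)) (sig : Signal (Option M)) :
    (simulate θ D).step v sig = ⟨v.1, fun k => D.step (v.2 k)
      (match D.action (v.2 k) with
        | .listen => innerSignal (channel fun j : v.1 => D.action (v.2 j)) sig
        | _ => .nothing)⟩ := by
  obtain ⟨ids, v⟩ := v
  unfold Protocol.step
  by_cases h : ∀ k : ids, ∃ o, D.next (v k) = .inr o
  · have hn : ∃ r, (simulate θ D).next ⟨ids, v⟩ = .inr r := by
      unfold simulate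
      dsimp only
      rw [if_pos h]
      exact ⟨_, rfl⟩
    obtain ⟨r, hr⟩ := hn
    rw [hr]
    dsimp only
    congr 1
    funext k
    obtain ⟨o, ho⟩ := h k
    rw [ho]
  · have hn : ∃ a, (simulate θ D).next ⟨ids, v⟩ = .inl a := by
      unfold simulate
      dsimp only
      rw [if_neg h]
      exact ⟨_, rfl⟩
    obtain ⟨r, hr⟩ := hn
    rw [hr]
    rfl

open Classical in
lemma simulate_action_of_eq {s : (simulate θ D).State} {ids : Finset (Fin N)} {v : ids → D.State}
    (hs : s = (⟨ids, v⟩ : Σ ids : Finset (Fin N), (ids → D.State))) :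
    (simulate θ D).action s = outerAction (channel fun k : ids => D.action (v k))
      (∃ k : ids, D.action (v k) = .listen) := by
  subst hs
  exact simulate_action _

/-- A device that performs the outer action hears for its simulated devices what they would
hear. -/
lemma innerSignal_hear (a : S → Action M) (hy : ∀ k, k ∈ S ↔ ∃ i, k ∈ y i)
    (hdisj : ∀ i j k, k ∈ y i → k ∈ y j → i = j)
    (hu : ∀ k k' m m', a k = .transmit m → a k' = .transmit m' → k = k')
    (e : (i : ι) → Action (Option M)) (hsub : ∀ i k, k ∈ y i → k ∈ S)
    (he : ∀ i, ∃ _ : Decidable (∃ k : y i, a ⟨k, hsub i k k.2⟩ = .listen),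
      e i = outerAction (channel fun k : y i => a ⟨k, hsub i k k.2⟩)
        (∃ k : y i, a ⟨k, hsub i k k.2⟩ = .listen)) (i : ι) (k : y i) :
    (match a ⟨k, hsub i k k.2⟩ with
      | .listen => innerSignal (channel fun j : y i => a ⟨j, hsub i j j.2⟩)
          (c.hear (channel e) (e i))
      | _ => .nothing) = CDModel.noCD.hear (channel a) (a ⟨k, hsub i k k.2⟩) := by
  cases hk : a ⟨k, hsub i k k.2⟩ with
  | idle => rfl
  | transmit m => rfl
  | listen =>
    change innerSignal _ _ = CDModel.noCD.perceive _
    -- If a simulated device transmits, it is the only one, so exactly one real device transmits.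
    -- The listeners that it simulates itself get the message locally, all others over the channel.
    -- No collision ever occurs, so the model does not matter.
    by_cases ht : ∃ k m, a k = .transmit m
    · obtain ⟨k0, m, hm⟩ := ht
      have hch : channel a = .message m := channel_eq_message ⟨hm, fun j hj m' hm' =>
        hj (hu j k0 m' m hm' hm)⟩
      rw [hch]
      obtain ⟨i0, hi0⟩ := (hy k0).1 k0.2
      have hin : channel (fun j : y i0 => a ⟨j, hsub i0 j j.2⟩) = .message m :=
        channel_eq_message (i := ⟨k0, hi0⟩) ⟨hm, fun j hj m' hm' => hj (by
          have := hu _ k0 m' m hm' hm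
          exact Subtype.ext (congrArg (fun z : S => (z : Fin N)) this))⟩
      by_cases hii : i = i0
      · subst hii
        rw [hin]
        rfl
      · have hsil : ∀ i', i' ≠ i0 →
            channel (fun j : y i' => a ⟨j, hsub i' j j.2⟩) = .silence := by
          intro i' hi'
          refine channel_eq_silence fun j m' hm' => hi' ?_
          have := hu _ k0 m' m hm' hm
          exact hdisj i' i0 k0 (by rw [← this]; exact j.2) hi0
        have he0 : e i0 = .transmit (some m) := by
          obtain ⟨_, h⟩ := he i0
          rw [h, hin]; rfl
        have hother : ∀ i', i' ≠ i0 → ∀ m', e i' ≠ .transmit m' := by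
          intro i' hi' m'
          obtain ⟨_, h⟩ := he i'
          rw [h, hsil i' hi', outerAction_silence]
          split_ifs <;> simp
        have hei : e i = .listen := by
          obtain ⟨_, h⟩ := he i
          rw [h, hsil i hii, outerAction_silence]
          exact if_pos ⟨k, hk⟩
        rw [hsil i hii, hei, channel_eq_message ⟨he0, hother⟩]
        cases c <;> rfl
    · push Not at ht
      have hsil : ∀ i', channel (fun j : y i' => a ⟨j, hsub i' j j.2⟩) = .silence :=
        fun i' => channel_eq_silence fun j m' hm' => ht _ m' hm'
      have hother : ∀ i' m', e i' ≠ .transmit m' := by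
        intro i' m'
        obtain ⟨_, h⟩ := he i'
        rw [h, hsil i', outerAction_silence]
        split_ifs <;> simp
      have hei : e i = .listen := by
        obtain ⟨_, h⟩ := he i
        rw [h, hsil i, outerAction_silence]
        exact if_pos ⟨k, hk⟩
      rw [hsil i, hei, channel_eq_silence hother, channel_eq_silence ht]
      cases c <;> rfl

lemma simulate_run (hy : ∀ k, k ∈ S ↔ ∃ i, k ∈ y i) (hdisj : ∀ i j k, k ∈ y i → k ∈ y j → i = j)
    (hu : ∀ (t : ℕ) (k k' : S) (m m' : M),
      D.actionAt .noCD (Subtype.val : S → Fin N) t k = .transmit m →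
      D.actionAt .noCD (Subtype.val : S → Fin N) t k' = .transmit m' → k = k')
    (hsub : ∀ i k, k ∈ y i → k ∈ S) (t : ℕ) (i : ι) :
    (simulate θ D).run c y t i =
      ⟨y i, fun k => D.run .noCD (Subtype.val : S → Fin N) t ⟨k, hsub i k k.2⟩⟩ := by
  classical
  induction t generalizing i with
  | zero => rfl
  | succ t ih =>
    change (simulate θ D).step ((simulate θ D).run c y t i) (c.hear (channel fun j =>
      (simulate θ D).action ((simulate θ D).run c y t j))
      ((simulate θ D).action ((simulate θ D).run c y t i))) = _
    rw [ih i]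
    refine (simulate_step _ _).trans ?_
    dsimp only
    congr 1
    funext k
    change D.step _ _ = D.step _ _
    congr 1
    have he : ∀ i, (simulate θ D).action ((simulate θ D).run c y t i) = outerAction
        (channel fun k : y i =>
            D.action (D.run .noCD (Subtype.val : S → Fin N) t ⟨k, hsub i k k.2⟩))
        (∃ k : y i, D.action (D.run .noCD (Subtype.val : S → Fin N) t ⟨k, hsub i k k.2⟩) =
          .listen) :=
      fun i => simulate_action_of_eq (ih i)
    have := innerSignal_hear (c := c) (y := y)
      (fun k : S => D.action (D.run .noCD (Subtype.val : S → Fin N) t k)) hy hdisj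
      (hu t) (fun i => (simulate θ D).action ((simulate θ D).run c y t i)) hsub
      (fun i => ⟨_, he i⟩) i k
    refine Eq.trans ?_ this
    congr 3
    rw [ih i]

/-- A real device is active in a slot only if a simulated one is, so its energy is at most the sum
over its IDs. -/
lemma simulate_energy_le (hy : ∀ k, k ∈ S ↔ ∃ i, k ∈ y i)
    (hdisj : ∀ i j k, k ∈ y i → k ∈ y j → i = j)
    (hu : ∀ (t : ℕ) (k k' : S) (m m' : M),
      D.actionAt .noCD (Subtype.val : S → Fin N) t k = .transmit m →
      D.actionAt .noCD (Subtype.val : S → Fin N) t k' = .transmit m' → k = k') {T E : ℕ}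
    (hE : ∀ k : S, D.energy .noCD (Subtype.val : S → Fin N) T k ≤ E) (i : ι) :
    (simulate θ D).energy c y T i ≤ (y i).card * E := by
  classical
  have hsub : ∀ i k, k ∈ y i → k ∈ S := fun i k h => (hy k).2 ⟨i, h⟩
  have hcost : ∀ t ∈ Finset.range T, ((simulate θ D).actionAt c y t i).cost ≤
      ∑ k : y i, (D.actionAt .noCD (Subtype.val : S → Fin N) t ⟨k, hsub i k k.2⟩).cost := by
    intro t _
    by_cases h : ∀ k : y i,
        D.actionAt .noCD (Subtype.val : S → Fin N) t ⟨k, hsub i k k.2⟩ = .idle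
    · have : (simulate θ D).actionAt c y t i = .idle := by
        refine (simulate_action_of_eq (simulate_run hy hdisj hu hsub t i)).trans ?_
        unfold Protocol.actionAt at h
        simp only [h]
        rw [channel_eq_silence (by simp), outerAction_silence]
        simp
      rw [this]
      exact Nat.zero_le _
    · push Not at h
      obtain ⟨k, hk⟩ := h
      have h1 : 1 ≤ (D.actionAt .noCD (Subtype.val : S → Fin N) t ⟨k, hsub i k k.2⟩).cost := by
        revert hk
        cases D.actionAt .noCD (Subtype.val : S → Fin N) t ⟨k, hsub i k k.2⟩ <;>
          simp [Action.cost]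
      have h2 : ((simulate θ D).actionAt c y t i).cost ≤ 1 := by
        cases (simulate θ D).actionAt c y t i <;> simp [Action.cost]
      refine h2.trans (h1.trans ?_)
      exact Finset.single_le_sum (f := fun k : y i =>
        (D.actionAt .noCD (Subtype.val : S → Fin N) t ⟨k, hsub i k k.2⟩).cost)
        (fun _ _ => Nat.zero_le _) (Finset.mem_univ k)
  refine (Finset.sum_le_sum hcost).trans ?_
  rw [Finset.sum_comm]
  calc _ ≤ ∑ _k : y i, E := Finset.sum_le_sum fun k _ => hE _
    _ = (y i).card * E := by simp

open Classical in
lemma simulate_outputAt (hy : ∀ k, k ∈ S ↔ ∃ i, k ∈ y i)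
    (hdisj : ∀ i j k, k ∈ y i → k ∈ y j → i = j)
    (hu : ∀ (t : ℕ) (k k' : S) (m m' : M),
      D.actionAt .noCD (Subtype.val : S → Fin N) t k = .transmit m →
      D.actionAt .noCD (Subtype.val : S → Fin N) t k' = .transmit m' → k = k') {T : ℕ}
    {o : S → Option (Finset (Fin N))}
    (ho : ∀ k : S, D.OutputAt .noCD (Subtype.val : S → Fin N) T k (o k)) (i : ι) :
    (simulate θ D).OutputAt c y T i
      (if ∃ (k : S) (I : Finset (Fin N)), (k : Fin N) ∈ y i ∧ o k = some I ∧ θ * N ≤ I.card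
        then .leader else .follower) := by
  have hsub : ∀ i k, k ∈ y i → k ∈ S := fun i k h => (hy k).2 ⟨i, h⟩
  unfold Protocol.OutputAt at ho ⊢
  rw [simulate_run hy hdisj hu hsub]
  unfold simulate
  dsimp only
  rw [if_pos fun k => ⟨_, ho _⟩]
  congr 2
  apply propext
  constructor
  · rintro ⟨k, I, hI, hc⟩
    rw [ho] at hI
    exact ⟨⟨k, hsub i k k.2⟩, I, k.2, Sum.inr.inj hI, hc⟩
  · rintro ⟨k, I, hk, hI, hc⟩
    exact ⟨⟨k, hk⟩, I, by rw [ho, hI], hc⟩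

end Simulate

end RadioNetwork

/-! ### Test-Network-Size for fixed coins -/

namespace RadioNetwork

lemma CDModel.density_ge (c : CDModel) : (0.1 : ℝ) ≤ c.density := by
  cases c <;> norm_num [CDModel.density]

lemma CDModel.assignTime_le (c : CDModel) (N : ℕ) : c.assignTime N ≤ 4 * N := by
  cases c <;> simp only [CDModel.assignTime] <;> omega

lemma CDModel.coinCount_le (c : CDModel) (N : ℕ) : c.coinCount N ≤ 2 * N := by
  cases c <;> simp only [CDModel.coinCount] <;> omega

open Classical in
/-- The IDs that are taken. -/
noncomputable def takenIDs {ι : Type} (c : CDModel) {N : ℕ} (β : ℕ)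
    (x : ι → Fin (c.coinCount N) → Bool) : Finset (Fin N) :=
  Finset.univ.filter fun k : Fin N => ∃ i, Assigned c β x k i

lemma mem_takenIDs {ι : Type} {c : CDModel} {N β : ℕ} {x : ι → Fin (c.coinCount N) → Bool}
    {k : Fin N} : k ∈ takenIDs c β x ↔ ∃ i, Assigned c β x k i := by
  simp [takenIDs]

open Classical in
/-- Whatever the coins are, Test-Network-Size halts with a leader exactly if enough IDs are
taken. -/
lemma testNetworkSize_spec {ι : Type} (c : CDModel) {N : ℕ} (hN : 1 ≤ N) (β : ℕ)
    (x : ι → Fin (c.coinCount N) → Bool) :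
    ∃ T : ℕ, T ≤ 16 * N ∧
      (∀ i, ∃ r, (testNetworkSize c N β denseCensus).OutputAt c x T i r) ∧
      (∀ i, (testNetworkSize c N β denseCensus).energy c x T i ≤
        8 * β + β * (3 * invAck N + 251)) ∧
      (c.density * N ≤ (takenIDs c β x).card →
        LeaderElected (testNetworkSize c N β denseCensus) c x T) ∧
      ((takenIDs c β x).card < c.density * N →
        NoLeaderElected (testNetworkSize c N β denseCensus) c x T) := by
  set S := takenIDs c β x with hS
  obtain ⟨hu, hout, hE, hsolve⟩ := denseCensus_spec hN S
  obtain ⟨h, h', hE'⟩ := assignIDs_spec (M := Finset ℕ) (β := β) c x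
  set y : ι → Finset (Fin N) :=
    fun i => Finset.univ.filter fun k : Fin N => Assigned c β x k i with hy
  have hSy : ∀ k, k ∈ S ↔ ∃ i, k ∈ y i := fun k => by simp [hS, hy, takenIDs]
  have hdisj : ∀ i j k, k ∈ y i → k ∈ y j → i = j := fun i j k hi hj =>
    Assigned.eq (Finset.mem_filter.1 hi).2 (Finset.mem_filter.1 hj).2
  choose o ho hoc using hout
  have hrole := fun i => (Protocol.seq_outputAt (Q := simulate c.density (denseCensus N)) h h'
    (censusTime N) i _).2 (simulate_outputAt (c := c) (θ := c.density) hSy hdisj hu ho i)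
  refine ⟨c.assignTime N + censusTime N, ?_, fun i => ⟨_, hrole i⟩, fun i => ?_,
    fun hd => ?_, fun hd i => ?_⟩
  · have := censusTime_le hN
    have := c.assignTime_le N
    omega
  · unfold testNetworkSize
    rw [Protocol.seq_energy h h']
    refine Nat.add_le_add (hE' i) ((simulate_energy_le hSy hdisj hu hE i).trans ?_)
    exact Nat.mul_le_mul_right _ (card_assigned_le c x i)
  · have hNR : (1 : ℝ) ≤ N := by exact_mod_cast hN
    -- Every density is at least 0.1, which is what the Census requires.
    obtain ⟨s, hs, hother, _⟩ := hsolve (by nlinarith [c.density_ge])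
    have hos : o s = some S := by
      have := ho s
      unfold Protocol.OutputAt at this hs
      rw [hs] at this
      exact (Sum.inr.inj this).symm
    have hoo : ∀ k, k ≠ s → o k = none := fun k hk => by
      have h1 := ho k
      have h2 := hother k hk
      unfold Protocol.OutputAt at h1 h2
      rw [h2] at h1
      exact (Sum.inr.inj h1).symm
    obtain ⟨i0, hi0⟩ := (hSy s).1 s.2
    refine ⟨i0, ?_, fun i hi => ?_⟩
    · have := hrole i0
      rwa [if_pos ⟨s, S, hi0, hos, hd⟩] at this
    · have := hrole i
      rwa [if_neg] at this
      rintro ⟨k, I, hk, hI, -⟩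
      by_cases hks : k = s
      · exact hi (hdisj i i0 k hk (hks ▸ hi0))
      · rw [hoo k hks] at hI
        exact absurd hI (by simp)
  · have := hrole i
    rwa [if_neg] at this
    rintro ⟨k, I, -, hI, hc⟩
    -- Even when the Census fails, a list never exceeds the set of taken IDs, so any would-be leader
    -- resets itself.
    have h1 : (I.card : ℝ) ≤ S.card := by exact_mod_cast hoc k I hI
    linarith

end RadioNetwork

namespace RadioNetwork

/-! ### The law of the coins as a finite sum -/

open MeasureTheory

/-- The probability that a coin shows `b`. -/
noncomputable def coinProb (p : ℝ) (b : Bool) : ℝ := if b then p else 1 - p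

lemma coinProb_nonneg {p : ℝ} (h0 : 0 ≤ p) (h1 : p ≤ 1) (b : Bool) : 0 ≤ coinProb p b := by
  unfold coinProb
  split_ifs <;> linarith

lemma sum_coinProb (p : ℝ) : ∑ b, coinProb p b = 1 := by
  simp [coinProb]

instance (n L : ℕ) (p : ℝ) : IsProbabilityMeasure (coinLaw n L p) := by
  unfold coinLaw
  infer_instance

lemma coinLaw_real_singleton {n L : ℕ} {p : ℝ} (h0 : 0 ≤ p) (h1 : p ≤ 1)
    (ω : Fin n → Fin L → Bool) :
    (coinLaw n L p).real {ω} = ∏ i, ∏ j, coinProb p (ω i j) := by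
  have hb : ∀ b, (ProbabilityTheory.bernoulliMeasure true false
      (Set.projIcc (0 : ℝ) 1 zero_le_one p)).real {b} = coinProb p b := by
    intro b
    rw [ProbabilityTheory.bernoulliMeasure_real_apply _ (measurableSet_singleton b)]
    cases b <;> simp [coinProb, Set.projIcc_of_mem zero_le_one ⟨h0, h1⟩]
  unfold coinLaw
  rw [measureReal_def, Measure.pi_singleton, ENNReal.toReal_prod]
  refine Finset.prod_congr rfl fun i _ => ?_
  rw [Measure.pi_singleton, ENNReal.toReal_prod]
  exact Finset.prod_congr rfl fun j _ => hb _

/-- Markov's inequality for the coins. -/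
lemma coinLaw_real_le {n L : ℕ} {p : ℝ} (h0 : 0 ≤ p) (h1 : p ≤ 1)
    {A : Set (Fin n → Fin L → Bool)} {f : (Fin n → Fin L → Bool) → ℝ} (hf : ∀ ω, 0 ≤ f ω)
    (hA : ∀ ω ∈ A, 1 ≤ f ω) :
    (coinLaw n L p).real A ≤ ∑ ω, (∏ i, ∏ j, coinProb p (ω i j)) * f ω := by
  classical
  have hw : ∀ ω : Fin n → Fin L → Bool, 0 ≤ ∏ i, ∏ j, coinProb p (ω i j) := fun ω =>
    Finset.prod_nonneg fun i _ => Finset.prod_nonneg fun j _ => coinProb_nonneg h0 h1 _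
  have hset : A = (Finset.univ.filter fun ω => ω ∈ A : Finset (Fin n → Fin L → Bool)) := by
    ext ω; simp
  rw [hset, ← sum_measureReal_singleton, Finset.sum_filter]
  refine Finset.sum_le_sum fun ω _ => ?_
  split_ifs with h
  · rw [coinLaw_real_singleton h0 h1]
    exact le_mul_of_one_le_right (hw ω) (hA ω h)
  · exact mul_nonneg (hw ω) (hf ω)

/-- Independence of the devices. -/
lemma sum_prod_devices {n L : ℕ} (w : Bool → ℝ) (g : Fin n → (Fin L → Bool) → ℝ) :
    ∑ ω : Fin n → Fin L → Bool, (∏ i, ∏ j, w (ω i j)) * ∏ i, g i (ω i) =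
      ∏ i, ∑ u : Fin L → Bool, (∏ j, w (u j)) * g i u := by
  classical
  rw [Finset.prod_univ_sum, Fintype.piFinset_univ]
  exact Finset.sum_congr rfl fun ω _ => Finset.prod_mul_distrib.symm

/-- Independence of the coins of a device. -/
lemma sum_prod_coins {κ : Type} [Fintype κ] [DecidableEq κ] (w : Bool → ℝ)
    (g : κ → Bool → ℝ) :
    ∑ u : κ → Bool, (∏ j, w (u j)) * ∏ j, g j (u j) = ∏ j, ∑ b, w b * g j b := by
  rw [Finset.prod_univ_sum, Fintype.piFinset_univ]
  exact Finset.sum_congr rfl fun ω _ => Finset.prod_mul_distrib.symm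

lemma sum_prod_coinProb {κ : Type} [Fintype κ] [DecidableEq κ] (p : ℝ) :
    ∑ u : κ → Bool, ∏ j, coinProb p (u j) = 1 := by
  have := sum_prod_coins (κ := κ) (coinProb p) fun _ _ => 1
  simpa only [sum_coinProb, mul_one, Finset.prod_const_one] using this

/-- Independence of disjoint blocks of slots. -/
lemma sum_prod_blocks {n L N : ℕ} {ρ : Type} [Fintype ρ] [DecidableEq ρ] (e : Fin N × ρ ≃ Fin L)
    (w : Bool → ℝ) (g : (ρ → Fin n → Bool) → ℝ) :
    ∑ ω : Fin n → Fin L → Bool, (∏ i, ∏ j, w (ω i j)) * ∏ k, g (fun d i => ω i (e (k, d))) =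
      (∑ v : ρ → Fin n → Bool, (∏ d, ∏ i, w (v d i)) * g v) ^ N := by
  classical
  let E : (Fin n → Fin L → Bool) ≃ (Fin N → ρ → Fin n → Bool) :=
    { toFun := fun ω k d i => ω i (e (k, d))
      invFun := fun v i j => v (e.symm j).1 (e.symm j).2 i
      left_inv := fun ω => by
        funext i j
        change ω i (e ((e.symm j).1, (e.symm j).2)) = _
        rw [Prod.mk.eta, e.apply_symm_apply]
      right_inv := fun v => by
        funext k d i
        change v (e.symm (e (k, d))).1 (e.symm (e (k, d))).2 i = _
        rw [e.symm_apply_apply] }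
  have hpow : ∀ X : ℝ, X ^ N = ∏ _k : Fin N, X := fun X => by simp
  rw [hpow, Finset.prod_univ_sum, Fintype.piFinset_univ]
  refine Fintype.sum_equiv E _ _ fun ω => ?_
  rw [Finset.prod_mul_distrib]
  congr 1
  rw [Finset.prod_comm, ← Equiv.prod_comp e, Fintype.prod_prod_type]
  rfl

/-! ### Chernoff bounds -/

/-- This is the contribution of one block to the exponential moment. From exp x ≤ 1 + x + x ^ 2 the
exponent is at most x ^ 2 - δ * |x|, which is minimal at |x| = δ / 2. -/
lemma chernoff_factor {q c δ : ℝ} (hq : q ≤ 1) (hδ0 : 0 < δ) (hδ1 : δ ≤ 1) (hq0 : 0 ≤ q) :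
    (q + δ ≤ c →
      (1 + q * (Real.exp (δ / 2) - 1)) * Real.exp (-(δ / 2) * c) ≤ Real.exp (-(δ ^ 2 / 4))) ∧
    (c + δ ≤ q →
      (1 + q * (Real.exp (-(δ / 2)) - 1)) * Real.exp (δ / 2 * c) ≤ Real.exp (-(δ ^ 2 / 4))) := by
  have key : ∀ x : ℝ, |x| ≤ 1 →
      1 + q * (Real.exp x - 1) ≤ Real.exp (q * x + x ^ 2) := by
    intro x hx
    have h1 := (abs_le.1 (Real.abs_exp_sub_one_sub_id_le hx)).2
    have h2 := Real.add_one_le_exp (q * x + x ^ 2)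
    nlinarith [sq_nonneg x]
  constructor
  · intro h
    refine (mul_le_mul_of_nonneg_right (key (δ / 2) (by rw [abs_of_pos] <;> linarith))
      (Real.exp_pos _).le).trans ?_
    rw [← Real.exp_add, Real.exp_le_exp]
    nlinarith
  · intro h
    refine (mul_le_mul_of_nonneg_right (key (-(δ / 2)) (by rw [abs_neg, abs_of_pos] <;> linarith))
      (Real.exp_pos _).le).trans ?_
    rw [← Real.exp_add, Real.exp_le_exp]
    nlinarith

section Chernoff

variable {n L N : ℕ} {ρ : Type} [Fintype ρ] [DecidableEq ρ]

lemma sum_prod_blockProb (p : ℝ) :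
    ∑ v : ρ → Fin n → Bool, ∏ d, ∏ i, coinProb p (v d i) = 1 := by
  classical
  have := Finset.prod_univ_sum (fun _ : ρ => (Finset.univ : Finset (Fin n → Bool)))
    fun _ u => ∏ i, coinProb p (u i)
  rw [Fintype.piFinset_univ] at this
  rw [← this]
  simp [sum_prod_coinProb]

open Classical in
/-- The moment generating function of the number of successful blocks. -/
lemma sum_exp_card_blocks (e : Fin N × ρ ≃ Fin L) (p x : ℝ) (s : (ρ → Fin n → Bool) → Prop) :
    ∑ ω : Fin n → Fin L → Bool, (∏ i, ∏ j, coinProb p (ω i j)) *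
        Real.exp (x * (Finset.univ.filter fun k => s fun d i => ω i (e (k, d))).card) =
      (1 + (∑ v ∈ Finset.univ.filter s, ∏ d, ∏ i, coinProb p (v d i)) * (Real.exp x - 1)) ^ N := by
  have h := sum_prod_blocks (n := n) e (coinProb p) fun v => if s v then Real.exp x else 1
  have htot := sum_prod_blockProb (n := n) (ρ := ρ) p
  have hone : ∑ v : ρ → Fin n → Bool, (∏ d, ∏ i, coinProb p (v d i)) *
      (if s v then Real.exp x else 1) =
      1 + (∑ v ∈ Finset.univ.filter s, ∏ d, ∏ i, coinProb p (v d i)) * (Real.exp x - 1) := by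
    refine Eq.trans ?_ (congrArg (· + _) htot)
    rw [Finset.sum_mul, Finset.sum_filter, ← Finset.sum_add_distrib]
    refine Finset.sum_congr rfl fun v _ => ?_
    split_ifs <;> ring
  rw [hone] at h
  rw [← h]
  refine Finset.sum_congr rfl fun ω _ => ?_
  congr 1
  rw [Finset.prod_ite, Finset.prod_const_one, mul_one, Finset.prod_const, ← Real.exp_nat_mul,
    mul_comm]

open Classical in
/-- The number of successful blocks is concentrated. -/
lemma coinLaw_card_blocks (e : Fin N × ρ ≃ Fin L) {p : ℝ} (h0 : 0 ≤ p) (h1 : p ≤ 1)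
    (s : (ρ → Fin n → Bool) → Prop) {q c δ : ℝ}
    (hq : ∑ v ∈ Finset.univ.filter s, ∏ d, ∏ i, coinProb p (v d i) = q) (hδ0 : 0 < δ)
    (hδ1 : δ ≤ 1) :
    (q + δ ≤ c → (coinLaw n L p).real {ω | c * N ≤
        (Finset.univ.filter fun k => s fun d i => ω i (e (k, d))).card} ≤
      Real.exp (-(δ ^ 2 / 4) * N)) ∧
    (c + δ ≤ q → (coinLaw n L p).real {ω |
        ((Finset.univ.filter fun k => s fun d i => ω i (e (k, d))).card : ℝ) < c * N} ≤
      Real.exp (-(δ ^ 2 / 4) * N)) := by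
  have hq0 : 0 ≤ q := by
    rw [← hq]
    exact Finset.sum_nonneg fun v _ => Finset.prod_nonneg fun d _ =>
      Finset.prod_nonneg fun i _ => coinProb_nonneg h0 h1 _
  have hq1 : q ≤ 1 := by
    rw [← hq, ← sum_prod_blockProb (n := n) (ρ := ρ) p]
    exact Finset.sum_le_univ_sum_of_nonneg fun v => Finset.prod_nonneg fun d _ =>
      Finset.prod_nonneg fun i _ => coinProb_nonneg h0 h1 _
  -- One Markov estimate serves both tails; the sign of x decides which.
  have hgen : ∀ (x : ℝ) (A : Set (Fin n → Fin L → Bool)),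
      (∀ ω ∈ A, x * c * N ≤
        x * (Finset.univ.filter fun k => s fun d i => ω i (e (k, d))).card) →
      (1 + q * (Real.exp x - 1)) * Real.exp (-x * c) ≤ Real.exp (-(δ ^ 2 / 4)) →
      (coinLaw n L p).real A ≤ Real.exp (-(δ ^ 2 / 4) * N) := by
    intro x A hA hx
    refine (coinLaw_real_le h0 h1 (f := fun ω => Real.exp (x *
      (Finset.univ.filter fun k => s fun d i => ω i (e (k, d))).card) * Real.exp (-x * c) ^ N)
      (fun ω => by positivity) fun ω hω => ?_).trans ?_
    · rw [← Real.exp_nat_mul, ← Real.exp_add]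
      refine Real.one_le_exp ?_
      have := hA ω hω
      linarith
    · simp_rw [← mul_assoc]
      rw [← Finset.sum_mul, sum_exp_card_blocks, hq, ← mul_pow, mul_comm (-(δ ^ 2 / 4)),
        Real.exp_nat_mul]
      refine pow_le_pow_left₀ (mul_nonneg ?_ (Real.exp_pos _).le) hx N
      nlinarith [Real.exp_pos x]
  obtain ⟨ha, hb⟩ := chernoff_factor (c := c) hq1 hδ0 hδ1 hq0
  constructor
  · intro h
    refine hgen (δ / 2) _ (fun ω hω => ?_) (ha h)
    have : c * N ≤ _ := hω
    nlinarith
  · intro h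
    refine hgen (-(δ / 2)) _ (fun ω hω => ?_) (by rw [neg_neg]; exact hb h)
    have : _ < c * N := hω
    nlinarith

end Chernoff

end RadioNetwork

namespace RadioNetwork

open MeasureTheory

/-! ### The number of IDs that are taken -/

open Classical in
/-- The slots selected by the coins. -/
noncomputable def selected {L : ℕ} (u : Fin L → Bool) : Finset (Fin L) :=
  Finset.univ.filter fun j => u j = true

lemma mem_tasks {L β : ℕ} {u : Fin L → Bool} {k : ℕ} :
    k ∈ tasks β u ↔ (selected u).card < β ∧ ∃ h : k < L, u ⟨k, h⟩ = true := by
  classical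
  have hc : ((Finset.univ.filter fun j => u j = true).image Fin.val).card = (selected u).card :=
    Finset.card_image_of_injective _ Fin.val_injective
  unfold tasks
  dsimp only
  rw [hc]
  split_ifs with h
  · simp only [Finset.mem_image, Finset.mem_filter, Finset.mem_univ, true_and, h]
    constructor
    · rintro ⟨j, hj, rfl⟩
      exact ⟨j.2, hj⟩
    · rintro ⟨hk, hj⟩
      exact ⟨_, hj, rfl⟩
  · simp [h]

/-- Exactly device `i` transmits. -/
def soloColumn {n : ℕ} (i : Fin n) : Fin n → Bool := fun j => decide (j = i)

lemma soloColumn_injective {n : ℕ} : Function.Injective (soloColumn (n := n)) := by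
  intro i j h
  have := congrFun h i
  simpa [soloColumn] using this

lemma eq_soloColumn_iff {n : ℕ} {u : Fin n → Bool} {i : Fin n} :
    u = soloColumn i ↔ u i = true ∧ ∀ j, j ≠ i → u j ≠ true := by
  constructor
  · rintro rfl
    simp [soloColumn]
  · rintro ⟨h1, h2⟩
    funext j
    by_cases hj : j = i
    · subst hj; simpa [soloColumn] using h1
    · simpa [soloColumn, hj] using h2 j hj

lemma prod_soloColumn {n : ℕ} (p : ℝ) (i : Fin n) :
    ∏ j, coinProb p (soloColumn i j) = p * (1 - p) ^ (n - 1) := by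
  classical
  rw [← Finset.mul_prod_erase _ _ (Finset.mem_univ i)]
  have h : ∀ j ∈ Finset.univ.erase i, coinProb p (soloColumn i j) = 1 - p := fun j hj => by
    simp [coinProb, soloColumn, Finset.ne_of_mem_erase hj]
  rw [Finset.prod_congr rfl h, Finset.prod_const, Finset.card_erase_of_mem (Finset.mem_univ i)]
  simp [coinProb, soloColumn]

/-- The probability that a given ID is taken if all devices participate. -/
noncomputable def CDModel.successProb : CDModel → ℕ → ℝ → ℝ
  | .strongCD, n, p => n * (p * (1 - p) ^ (n - 1))
  | .senderCD, n, p => n * (p * (1 - p) ^ (n - 1))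
  | .receiverCD, n, p => n * (n - 1) * (p * (1 - p) ^ (n - 1)) ^ 2
  | .noCD, n, p => n * (n - 1) * (p * (1 - p) ^ (n - 1)) ^ 2

/-- A slot in which exactly one device transmits. -/
def DirectSuccess {n : ℕ} (v : Unit → Fin n → Bool) : Prop := ∃ i, v () = soloColumn i

/-- Two slots in each of which exactly one device transmits, not the same in both. -/
def PairedSuccess {n : ℕ} (v : Fin 2 → Fin n → Bool) : Prop :=
  ∃ i j, j ≠ i ∧ v 0 = soloColumn i ∧ v 1 = soloColumn j

open Classical in
lemma sum_directSuccess (n : ℕ) (p : ℝ) :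
    ∑ v ∈ Finset.univ.filter (DirectSuccess (n := n)), ∏ d, ∏ i, coinProb p (v d i) =
      n * (p * (1 - p) ^ (n - 1)) := by
  have h : Finset.univ.filter (DirectSuccess (n := n)) =
      Finset.univ.image fun i _ => soloColumn i := by
    ext v
    simp only [DirectSuccess, Finset.mem_filter, Finset.mem_univ, true_and, Finset.mem_image]
    exact exists_congr fun i => ⟨fun h => funext fun _ => h.symm, fun h => by rw [← h]⟩
  rw [h, Finset.sum_image fun i _ j _ hij => soloColumn_injective (congrFun hij ())]
  simp [prod_soloColumn]

open Classical in
lemma sum_pairedSuccess (n : ℕ) (p : ℝ) :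
    ∑ v ∈ Finset.univ.filter (PairedSuccess (n := n)), ∏ d, ∏ i, coinProb p (v d i) =
      n * (n - 1) * (p * (1 - p) ^ (n - 1)) ^ 2 := by
  have h : Finset.univ.filter (PairedSuccess (n := n)) =
      (Finset.univ : Finset (Fin n)).offDiag.image fun x => ![soloColumn x.1, soloColumn x.2] := by
    ext v
    simp only [PairedSuccess, Finset.mem_filter, Finset.mem_univ, true_and, Finset.mem_image,
      Finset.mem_offDiag, Prod.exists]
    refine exists_congr fun i => exists_congr fun j => ⟨fun ⟨h1, h2, h3⟩ => ⟨h1.symm, ?_⟩,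
      fun ⟨h1, h2⟩ => ⟨Ne.symm h1, ?_⟩⟩
    · funext d
      fin_cases d
      · exact h2.symm
      · exact h3.symm
    · rw [← h2]
      exact ⟨rfl, rfl⟩
  rw [h, Finset.sum_image]
  · simp only [Fin.prod_univ_two, Matrix.cons_val_zero, Matrix.cons_val_one, prod_soloColumn,
      Finset.sum_const, Finset.offDiag_card, Finset.card_univ, Fintype.card_fin, nsmul_eq_mul]
    rw [Nat.cast_sub (Nat.le_mul_self n)]
    push_cast
    ring
  · rintro ⟨i, j⟩ _ ⟨i', j'⟩ _ hij
    have h0 := soloColumn_injective (congrFun hij 0)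
    have h1 := soloColumn_injective (congrFun hij 1)
    exact Prod.ext h0 h1

/-- All devices participate. -/
def AllParticipate {n L : ℕ} (β : ℕ) (x : Fin n → Fin L → Bool) : Prop :=
  ∀ i, (selected (x i)).card < β

lemma soleTask_iff {n L β : ℕ} {x : Fin n → Fin L → Bool} (hx : AllParticipate β x) {k : ℕ}
    (hk : k < L) {i : Fin n} :
    SoleTask β x k i ↔ (fun j => x j ⟨k, hk⟩) = soloColumn i := by
  rw [eq_soloColumn_iff]
  have h : ∀ j, k ∈ tasks β (x j) ↔ x j ⟨k, hk⟩ = true := fun j => by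
    rw [mem_tasks]
    exact ⟨fun h => h.2.2, fun h => ⟨hx j, hk, h⟩⟩
  unfold SoleTask
  simp only [h]

open Classical in
/-- The number of taken IDs is concentrated up to the event that some device does not
participate. -/
lemma coinLaw_takenIDs (c : CDModel) (n N β : ℕ) {p : ℝ} (h0 : 0 ≤ p) (h1 : p ≤ 1) {δ : ℝ}
    (hδ0 : 0 < δ) (hδ1 : δ ≤ 1) :
    (c.successProb n p + δ ≤ c.density →
      (coinLaw n (c.coinCount N) p).real {ω | AllParticipate β ω ∧
        c.density * N ≤ (takenIDs c (N := N) β ω).card} ≤ Real.exp (-(δ ^ 2 / 4) * N)) ∧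
    (c.density + δ ≤ c.successProb n p →
      (coinLaw n (c.coinCount N) p).real {ω | AllParticipate β ω ∧
        ((takenIDs c (N := N) β ω).card : ℝ) < c.density * N} ≤ Real.exp (-(δ ^ 2 / 4) * N)) := by
  have direct : ∀ (θ : ℝ) (q : ℝ) (y : (Fin n → Fin N → Bool) → Finset (Fin N)),
      (∀ ω, y ω = Finset.univ.filter fun k : Fin N => ∃ i, SoleTask β ω k i) →
      q = n * (p * (1 - p) ^ (n - 1)) →
      (q + δ ≤ θ → (coinLaw n N p).real {ω | AllParticipate β ω ∧ θ * N ≤ (y ω).card} ≤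
        Real.exp (-(δ ^ 2 / 4) * N)) ∧
      (θ + δ ≤ q → (coinLaw n N p).real {ω | AllParticipate β ω ∧ ((y ω).card : ℝ) < θ * N} ≤
        Real.exp (-(δ ^ 2 / 4) * N)) := by
    rintro θ q y hy rfl
    obtain ⟨ha, hb⟩ := coinLaw_card_blocks (c := θ) (Equiv.prodUnique (Fin N) Unit) h0 h1 _
      (sum_directSuccess n p) hδ0 hδ1
    have hcard : ∀ ω, AllParticipate β ω → (y ω).card = (Finset.univ.filter fun k =>
        DirectSuccess fun d i => ω i (Equiv.prodUnique (Fin N) Unit (k, d))).card := by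
      intro ω hω
      rw [hy]
      congr 1
      ext k
      simp only [Finset.mem_filter, Finset.mem_univ, true_and]
      exact exists_congr fun i => soleTask_iff hω k.2
    exact ⟨fun h => (measureReal_mono fun ω hω => by
        have := hω.2; rw [hcard ω hω.1] at this; exact this).trans (ha h),
      fun h => (measureReal_mono fun ω hω => by
        have := hω.2; rw [hcard ω hω.1] at this; exact this).trans (hb h)⟩
  have paired : ∀ (θ : ℝ) (q : ℝ) (y : (Fin n → Fin (2 * N) → Bool) → Finset (Fin N)),
      (∀ ω, y ω = Finset.univ.filter fun k : Fin N => ∃ i, SolePair β ω k i) →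
      q = n * (n - 1) * (p * (1 - p) ^ (n - 1)) ^ 2 →
      (q + δ ≤ θ → (coinLaw n (2 * N) p).real {ω | AllParticipate β ω ∧ θ * N ≤ (y ω).card} ≤
        Real.exp (-(δ ^ 2 / 4) * N)) ∧
      (θ + δ ≤ q → (coinLaw n (2 * N) p).real {ω | AllParticipate β ω ∧
        ((y ω).card : ℝ) < θ * N} ≤ Real.exp (-(δ ^ 2 / 4) * N)) := by
    rintro θ q y hy rfl
    let e : Fin N × Fin 2 ≃ Fin (2 * N) := finProdFinEquiv.trans (finCongr (mul_comm N 2))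
    have he : ∀ k d, ((e (k, d) : Fin (2 * N)) : ℕ) = 2 * k + d := fun k d => by
      simp [e, finProdFinEquiv, add_comm]
    obtain ⟨ha, hb⟩ := coinLaw_card_blocks (c := θ) e h0 h1 _
      (sum_pairedSuccess n p) hδ0 hδ1
    have hcard : ∀ ω, AllParticipate β ω → (y ω).card = (Finset.univ.filter fun k =>
        PairedSuccess fun d i => ω i (e (k, d))).card := by
      intro ω hω
      rw [hy]
      congr 1
      ext k
      simp only [Finset.mem_filter, Finset.mem_univ, true_and]
      refine exists_congr fun i => ?_
      have hk0 : 2 * (k : ℕ) < 2 * N := by omega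
      have hk1 : 2 * (k : ℕ) + 1 < 2 * N := by omega
      have e0 : e (k, 0) = ⟨2 * k, hk0⟩ := Fin.ext (he k 0)
      have e1 : e (k, 1) = ⟨2 * k + 1, hk1⟩ := Fin.ext (he k 1)
      unfold SolePair
      rw [soleTask_iff hω hk0, ← e0]
      simp only [soleTask_iff hω hk1, ← e1]
      constructor
      · rintro ⟨h, j, hj, h'⟩
        exact ⟨j, hj, h, h'⟩
      · rintro ⟨j, hj, h, h'⟩
        exact ⟨h, j, hj, h'⟩
    exact ⟨fun h => (measureReal_mono fun ω hω => by
        have := hω.2; rw [hcard ω hω.1] at this; exact this).trans (ha h),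
      fun h => (measureReal_mono fun ω hω => by
        have := hω.2; rw [hcard ω hω.1] at this; exact this).trans (hb h)⟩
  cases c
  · exact direct _ _ _ (fun ω => by unfold takenIDs; ext k; simp only [Finset.mem_filter]; rfl) rfl
  · exact direct _ _ _ (fun ω => by unfold takenIDs; ext k; simp only [Finset.mem_filter]; rfl) rfl
  · exact paired _ _ _ (fun ω => by unfold takenIDs; ext k; simp only [Finset.mem_filter]; rfl) rfl
  · exact paired _ _ _ (fun ω => by unfold takenIDs; ext k; simp only [Finset.mem_filter]; rfl) rfl

/-! ### Devices that do not participate -/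

/-- With high probability all devices participate. -/
lemma coinLaw_not_allParticipate (n L β : ℕ) {p y : ℝ} (h0 : 0 ≤ p) (h1 : p ≤ 1) (hy : 1 ≤ y) :
    (coinLaw n L p).real {ω | ¬ AllParticipate β ω} ≤
      n * (Real.exp (L * (p * y)) / y ^ β) := by
  classical
  have hset : {ω : Fin n → Fin L → Bool | ¬ AllParticipate β ω} =
      ⋃ i, {ω | β ≤ (selected (ω i)).card} := by
    ext ω
    simp [AllParticipate]
  rw [hset]
  refine (measureReal_iUnion_fintype_le _).trans ?_
  have hi : ∀ i ∈ (Finset.univ : Finset (Fin n)), (coinLaw n L p).real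
      {ω | β ≤ (selected (ω i)).card} ≤ Real.exp (L * (p * y)) / y ^ β := by
    intro i _
    have hy0 : 0 < y := by linarith
    -- The test function is y to the number of slots selected by device i, divided by y ^ β. Its
    -- mean is (1 - p + p * y) ^ L / y ^ β.
    refine (coinLaw_real_le h0 h1 (f := fun ω => (∏ i', if i' = i then
      ∏ j, (if ω i' j = true then y else 1) else 1) / y ^ β) (fun ω => by
        refine div_nonneg (Finset.prod_nonneg fun i' _ => ?_) (by positivity)
        split_ifs
        · refine Finset.prod_nonneg fun j _ => ?_
          split_ifs <;> linarith
        · exact zero_le_one) fun ω hω => ?_).trans ?_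
    · rw [one_le_div (by positivity), Finset.prod_ite_eq' Finset.univ i, if_pos (Finset.mem_univ i),
        Finset.prod_ite, Finset.prod_const_one, mul_one, Finset.prod_const]
      exact pow_le_pow_right₀ hy hω
    · simp_rw [← mul_div_assoc]
      rw [← Finset.sum_div, div_le_div_iff_of_pos_right (by positivity),
        sum_prod_devices (coinProb p) fun i' u => if i' = i then
          ∏ j, (if u j = true then y else 1) else 1]
      rw [← Finset.mul_prod_erase _ _ (Finset.mem_univ i)]
      have hrest : ∀ i' ∈ Finset.univ.erase i, ∑ u : Fin L → Bool, (∏ j, coinProb p (u j)) *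
          (if i' = i then ∏ j, (if u j = true then y else 1) else 1) = 1 := by
        intro i' hi'
        simp [Finset.ne_of_mem_erase hi', sum_prod_coinProb]
      rw [Finset.prod_congr rfl hrest, Finset.prod_const_one, mul_one]
      simp only [if_true]
      rw [sum_prod_coins (coinProb p) fun _ b => if b = true then y else 1]
      have hb : ∑ b, coinProb p b * (if b = true then y else 1) = 1 - p + p * y := by
        simp [coinProb]; ring
      rw [Finset.prod_congr rfl fun _ _ => hb, Finset.prod_const, Finset.card_univ,
        Fintype.card_fin, Real.exp_nat_mul]
      refine pow_le_pow_left₀ (by nlinarith) ?_ L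
      have := Real.add_one_le_exp (p * y)
      linarith
  refine (Finset.sum_le_sum hi).trans ?_
  simp

/-! ### Many devices -/

/-- If there are many devices then with high probability no ID is taken. -/
lemma coinLaw_exists_soleTask (n L β : ℕ) {p : ℝ} (h0 : 0 ≤ p) (h1 : p ≤ 1) (hβ : 2 ≤ β) :
    (coinLaw n L p).real {ω | ∃ k < L, ∃ i, SoleTask β ω k i} ≤
      L * n * Real.exp (-(p * (1 - p) ^ (L - 1)) * (n - 1)) := by
  classical
  have hset : {ω : Fin n → Fin L → Bool | ∃ k < L, ∃ i, SoleTask β ω k i} ⊆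
      ⋃ x : Fin L × Fin n, {ω | SoleTask β ω x.1 x.2} := by
    rintro ω ⟨k, hk, i, h⟩
    exact Set.mem_iUnion.2 ⟨(⟨k, hk⟩, i), h⟩
  refine (measureReal_mono hset).trans ((measureReal_iUnion_fintype_le _).trans ?_)
  set r := p * (1 - p) ^ (L - 1) with hr
  have hi : ∀ x ∈ (Finset.univ : Finset (Fin L × Fin n)), (coinLaw n L p).real
      {ω | SoleTask β ω x.1 x.2} ≤ Real.exp (-r * (n - 1)) := by
    rintro ⟨k, i⟩ _
    have hn : 1 ≤ n := Fin.pos i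
    -- The test function is the indicator that no device other than i has task k.
    refine (coinLaw_real_le h0 h1 (f := fun ω => ∏ i', if i' = i then 1 else
      if (k : ℕ) ∈ tasks β (ω i') then 0 else 1) (fun ω => by
        refine Finset.prod_nonneg fun i' _ => ?_
        split_ifs <;> norm_num) fun ω hω => ?_).trans ?_
    · refine (Finset.prod_eq_one fun i' _ => ?_).ge
      split_ifs with h1 h2
      · rfl
      · exact absurd h2 (hω.2 i' h1)
      · rfl
    · rw [sum_prod_devices (coinProb p) fun i' u => if i' = i then 1 else
        if (k : ℕ) ∈ tasks β u then 0 else 1]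
      rw [← Finset.mul_prod_erase _ _ (Finset.mem_univ i)]
      have hrest : ∀ i' ∈ Finset.univ.erase i, ∑ u : Fin L → Bool, (∏ j, coinProb p (u j)) *
          (if i' = i then 1 else if (k : ℕ) ∈ tasks β u then 0 else 1) ≤ Real.exp (-r) := by
        intro i' hi'
        -- A device whose coins select only slot k participates because β ≥ 2. This event has
        -- probability r whatever the cap does to other coin patterns.
        have hsolo : (k : ℕ) ∈ tasks β (soloColumn k) := by
          rw [mem_tasks]
          have : selected (soloColumn k) = {k} := by
            ext j; simp [selected, soloColumn]
          refine ⟨by rw [this, Finset.card_singleton]; omega, k.2, by simp [soloColumn]⟩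
        have hle : ∑ u : Fin L → Bool, (∏ j, coinProb p (u j)) *
            (if i' = i then 1 else if (k : ℕ) ∈ tasks β u then 0 else 1) ≤
            ∑ u : Fin L → Bool, ((∏ j, coinProb p (u j)) -
              if u = soloColumn k then ∏ j, coinProb p (u j) else 0) := by
          refine Finset.sum_le_sum fun u _ => ?_
          have hw : 0 ≤ ∏ j, coinProb p (u j) :=
            Finset.prod_nonneg fun j _ => coinProb_nonneg h0 h1 _
          rw [if_neg (Finset.ne_of_mem_erase hi')]
          by_cases hu : u = soloColumn k
          · subst hu
            simp [hsolo]
          · rw [if_neg hu]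
            split_ifs <;> simp [hw]
        refine hle.trans ?_
        rw [Finset.sum_sub_distrib, sum_prod_coinProb, Finset.sum_ite_eq' Finset.univ,
          if_pos (Finset.mem_univ _), prod_soloColumn]
        have := Real.add_one_le_exp (-r)
        linarith
      rw [show -r * ((n : ℝ) - 1) = ((n - 1 : ℕ) : ℝ) * (-r) by
        rw [Nat.cast_sub hn]; push_cast; ring, Real.exp_nat_mul]
      have hfirst : ∑ u : Fin L → Bool, (∏ j, coinProb p (u j)) *
          (if i = i then (1 : ℝ) else if (k : ℕ) ∈ tasks β u then 0 else 1) = 1 := by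
        simp [sum_prod_coinProb]
      rw [hfirst, one_mul]
      refine (Finset.prod_le_prod (fun i' _ => ?_) hrest).trans ?_
      · refine Finset.sum_nonneg fun u _ => mul_nonneg
          (Finset.prod_nonneg fun j _ => coinProb_nonneg h0 h1 _) ?_
        split_ifs <;> norm_num
      · rw [Finset.prod_const, Finset.card_erase_of_mem (Finset.mem_univ i), Finset.card_univ,
          Fintype.card_fin]
  refine (Finset.sum_le_sum hi).trans ?_
  simp

end RadioNetwork

namespace RadioNetwork

open MeasureTheory

/-! ### The probability that an ID is taken -/

/-- Unimodality of x * exp (-x) without calculus: the value at a dominates that at x if a lies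
between x and the peak 1. -/
lemma mul_exp_neg_le {a x : ℝ} (ha : 0 ≤ a) (h : 0 ≤ (a - x) * (1 - a)) :
    x * Real.exp (-x) ≤ a * Real.exp (-a) := by
  have h1 := Real.add_one_le_exp (x - a)
  have h2 : x ≤ a * Real.exp (x - a) := by nlinarith
  calc x * Real.exp (-x) ≤ a * Real.exp (x - a) * Real.exp (-x) :=
        mul_le_mul_of_nonneg_right h2 (Real.exp_pos _).le
    _ = a * Real.exp (-a) := by rw [mul_assoc, ← Real.exp_add]; ring_nf

/-- The probability that exactly one device transmits, if the estimate is far off. -/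
lemma soloProb_le {n : ℕ} {est : ℝ} (hn : 1 ≤ n) (hest : 100 ≤ est)
    (h : 1.9 * n ≤ est ∨ est ≤ n / 1.9) :
    n * (1 / est * (1 - 1 / est) ^ (n - 1)) ≤ 0.32 := by
  have hest0 : 0 < est := by linarith
  set p := 1 / est with hp
  have hp0 : 0 < p := by positivity
  have hp1 : p ≤ 0.01 := by
    rw [hp, div_le_iff₀ hest0]; linarith
  have hpe : est * p = 1 := by rw [hp]; field_simp
  set x := n * p with hx
  have hx0 : 0 ≤ x := by positivity
  have h1 : (1 - p) ^ (n - 1) ≤ Real.exp (-x) * Real.exp p := by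
    have : 1 - p ≤ Real.exp (-p) := by linarith [Real.add_one_le_exp (-p)]
    refine (pow_le_pow_left₀ (by linarith) this (n - 1)).trans_eq ?_
    rw [← Real.exp_nat_mul, ← Real.exp_add, Nat.cast_sub hn]
    congr 1
    push_cast
    ring
  have h2 : Real.exp p ≤ 1.011 := by
    have := Real.add_one_le_exp (-p)
    have hpos := Real.exp_pos p
    have hm : Real.exp p * Real.exp (-p) = 1 := by rw [← Real.exp_add]; simp
    nlinarith
  have h3 : x * Real.exp (-x) ≤ 0.314 := by
    -- By unimodality only the endpoints x = 10 / 19 and x = 1.9 matter.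
    have hd := Real.exp_one_gt_d9
    rcases h with h | h
    · have hxa : x ≤ 10 / 19 := by nlinarith
      refine (mul_exp_neg_le (a := 10 / 19) (by norm_num) (by nlinarith)).trans ?_
      have e1 : (1.648 : ℝ) ≤ Real.exp (1 / 2) := by
        have : Real.exp (1 / 2) ^ 2 = Real.exp 1 := by
          rw [← Real.exp_nat_mul]; norm_num
        have := Real.exp_pos (1 / 2)
        nlinarith
      have e2 : (1.648 * (1 + 1 / 38) : ℝ) ≤ Real.exp (10 / 19) := by
        rw [show (10 / 19 : ℝ) = 1 / 2 + 1 / 38 by norm_num, Real.exp_add]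
        refine mul_le_mul e1 ?_ (by norm_num) (Real.exp_pos _).le
        linarith [Real.add_one_le_exp (1 / 38 : ℝ)]
      rw [Real.exp_neg, ← div_eq_mul_inv, div_le_iff₀ (Real.exp_pos _)]
      linarith
    · have hxa : 1.9 ≤ x := by
        rw [le_div_iff₀ (by norm_num)] at h
        nlinarith
      refine (mul_exp_neg_le (a := 1.9) (by norm_num) (by nlinarith)).trans ?_
      have e2 : (7.38 * 0.9 : ℝ) ≤ Real.exp 1.9 := by
        rw [show (1.9 : ℝ) = 1 + 1 + -0.1 by norm_num, Real.exp_add, Real.exp_add]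
        refine mul_le_mul (by nlinarith) ?_ (by norm_num) (by positivity)
        linarith [Real.add_one_le_exp (-0.1 : ℝ)]
      rw [Real.exp_neg, ← div_eq_mul_inv, div_le_iff₀ (Real.exp_pos _)]
      linarith
  have hexp : 0 ≤ x * Real.exp (-x) := mul_nonneg hx0 (Real.exp_pos _).le
  calc n * (p * (1 - p) ^ (n - 1)) = x * (1 - p) ^ (n - 1) := by rw [hx]; ring
    _ ≤ x * (Real.exp (-x) * Real.exp p) := mul_le_mul_of_nonneg_left h1 hx0
    _ = x * Real.exp (-x) * Real.exp p := by ring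
    _ ≤ 0.32 := by nlinarith

/-- The probability that exactly one device transmits, if the estimate is good. -/
lemma le_soloProb {n : ℕ} {est : ℝ} (hn : 1 ≤ n) (hest : 100 ≤ est) (h1 : n / 1.5 ≤ est)
    (h2 : est ≤ 1.5 * n) : 0.329 ≤ n * (1 / est * (1 - 1 / est) ^ (n - 1)) := by
  have hest0 : 0 < est := by linarith
  set p := 1 / est with hp
  have hp0 : 0 < p := by positivity
  have hp1 : p ≤ 0.01 := by
    rw [hp, div_le_iff₀ hest0]; linarith
  have hpe : est * p = 1 := by rw [hp]; field_simp
  set x := n * p with hx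
  have hx0 : 0 ≤ x := by positivity
  have hx1 : 2 / 3 ≤ x := by nlinarith
  have hx2 : x ≤ 3 / 2 := by
    rw [div_le_iff₀ (by norm_num)] at h1
    nlinarith
  -- The correction in the exponent is about p * (x - 1), at most 0.01 * 0.5 and a little.
  have h3 : Real.exp (-x) * Real.exp (-0.0051) ≤ (1 - p) ^ (n - 1) := by
    have hq : Real.exp (-(p / (1 - p))) ≤ 1 - p := by
      have := Real.add_one_le_exp (p / (1 - p))
      have h1p : (0 : ℝ) < 1 - p := by linarith
      rw [Real.exp_neg]
      refine inv_le_of_inv_le₀ h1p (le_trans (le_of_eq ?_) this)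
      field_simp
      ring
    refine le_trans ?_ (pow_le_pow_left₀ (Real.exp_pos _).le hq (n - 1))
    rw [← Real.exp_nat_mul, ← Real.exp_add, Real.exp_le_exp, Nat.cast_sub hn]
    have : ((n : ℝ) - (1 : ℕ)) * (p / (1 - p)) ≤ x + 0.0051 := by
      rw [← mul_div_assoc, div_le_iff₀ (by linarith)]
      push_cast
      nlinarith
    linarith
  have h4 : 0.334 ≤ x * Real.exp (-x) := by
    have hd := Real.exp_one_lt_d9
    have hd0 := Real.exp_pos 1
    rcases le_total x 1 with h | h
    · refine le_trans ?_ (mul_exp_neg_le (a := x) (x := 2 / 3) hx0 (by nlinarith))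
      have e1 : Real.exp (2 / 3) ≤ 1.95 := by
        refine le_of_pow_le_pow_left₀ (n := 3) (by norm_num) (by norm_num) ?_
        rw [← Real.exp_nat_mul, show ((3 : ℕ) : ℝ) * (2 / 3) = 1 + 1 by norm_num, Real.exp_add]
        nlinarith
      rw [Real.exp_neg, ← div_eq_mul_inv, le_div_iff₀ (Real.exp_pos _)]
      linarith
    · refine le_trans ?_ (mul_exp_neg_le (a := x) (x := 3 / 2) hx0 (by nlinarith))
      have e1 : Real.exp (3 / 2) ≤ 4.485 := by
        refine le_of_pow_le_pow_left₀ (n := 2) (by norm_num) (by norm_num) ?_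
        rw [← Real.exp_nat_mul, show ((2 : ℕ) : ℝ) * (3 / 2) = 1 + 1 + 1 by norm_num,
          Real.exp_add, Real.exp_add]
        have : Real.exp 1 * Real.exp 1 ≤ 7.3891 := by nlinarith
        nlinarith
      rw [Real.exp_neg, ← div_eq_mul_inv, le_div_iff₀ (Real.exp_pos _)]
      linarith
  have h5 : (0.9949 : ℝ) ≤ Real.exp (-0.0051) := by
    linarith [Real.add_one_le_exp (-0.0051 : ℝ)]
  calc (0.329 : ℝ) ≤ x * Real.exp (-x) * Real.exp (-0.0051) := by nlinarith
    _ = x * (Real.exp (-x) * Real.exp (-0.0051)) := by ring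
    _ ≤ x * (1 - p) ^ (n - 1) := mul_le_mul_of_nonneg_left h3 hx0
    _ = n * (p * (1 - p) ^ (n - 1)) := by rw [hx]; ring

lemma CDModel.successProb_le (c : CDModel) {n : ℕ} {est : ℝ} (hn : 1 ≤ n) (hest : 100 ≤ est)
    (h : 1.9 * n ≤ est ∨ est ≤ n / 1.9) : c.successProb n (1 / est) + 0.0005 ≤ c.density := by
  have hs := soloProb_le hn hest h
  have hnR : (1 : ℝ) ≤ n := by exact_mod_cast hn
  have hw : 0 ≤ 1 / est * (1 - 1 / est) ^ (n - 1) := by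
    have h1 : 1 / est ≤ 1 := by rw [div_le_one] <;> linarith
    have h0 : 0 ≤ 1 / est := by positivity
    exact mul_nonneg h0 (pow_nonneg (by linarith) _)
  set w := 1 / est * (1 - 1 / est) ^ (n - 1)
  have hpair : (n : ℝ) * (n - 1) * w ^ 2 + 0.0005 ≤ 0.325 ^ 2 := by
    have h0 : 0 ≤ n * w := by positivity
    nlinarith [mul_nonneg h0 hw]
  cases c
  · exact le_trans (add_le_add_left hs _) (by norm_num [CDModel.density])
  · exact le_trans (add_le_add_left hs _) (by norm_num [CDModel.density])
  · exact hpair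
  · exact hpair

lemma CDModel.le_successProb (c : CDModel) {n : ℕ} {est : ℝ} (hn : 1 ≤ n) (hest : 100 ≤ est)
    (h1 : n / 1.5 ≤ est) (h2 : est ≤ 1.5 * n) :
    c.density + 0.0005 ≤ c.successProb n (1 / est) := by
  have hs := le_soloProb hn hest h1 h2
  have hn66 : (66 : ℝ) ≤ n := by linarith
  set w := 1 / est * (1 - 1 / est) ^ (n - 1)
  have hpair : 0.325 ^ 2 + 0.0005 ≤ (n : ℝ) * (n - 1) * w ^ 2 := by
    have h3 : (n : ℝ) * (n - 1) * w ^ 2 = (n * w) ^ 2 * (1 - 1 / n) := by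
      field_simp
    have h4 : (1 : ℝ) / n ≤ 1 / 66 := one_div_le_one_div_of_le (by norm_num) hn66
    have h5 : (0.329 : ℝ) ^ 2 ≤ (n * w) ^ 2 := pow_le_pow_left₀ (by norm_num) hs 2
    rw [h3]
    nlinarith
  cases c
  · exact le_trans (by norm_num [CDModel.density]) hs
  · exact le_trans (by norm_num [CDModel.density]) hs
  · exact hpair
  · exact hpair

end RadioNetwork

namespace RadioNetwork

open MeasureTheory

/-! ### The failure probability -/

lemma log_le_two_mul_sqrt {x : ℝ} (hx : 0 < x) : Real.log x ≤ 2 * √x := by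
  have h1 := Real.log_le_sub_one_of_pos (Real.sqrt_pos.2 hx)
  rw [Real.log_sqrt hx.le] at h1
  linarith

/-- If the number of devices is at most polynomial in the estimate then with high probability all
devices participate. -/
lemma not_allParticipate_bound (K : ℝ) (hK : 0 < K) (h : ℕ) :
    ∃ b : ℕ, 1 ≤ b ∧ ∀ (n L : ℕ) (est : ℝ), 100 ≤ est → (n : ℝ) ≤ est ^ h →
      (L : ℝ) ≤ 2 * (K * Real.log est + 1) →
      n * (Real.exp (L * (1 / est * √est)) / √est ^ (2 * b)) ≤ est⁻¹ / 2 := by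
  obtain ⟨m, hm⟩ := pow_unbounded_of_one_lt (2 * Real.exp (4 * K + 2)) (by norm_num : (1 : ℝ) < 100)
  -- With y = √est the exponential moment is bounded by a constant. In the exponent of est, h pays
  -- for the union over devices, 1 for the claimed bound and m for that constant.
  refine ⟨h + 1 + m, by omega, fun n L est hest hn hL => ?_⟩
  have hest0 : 0 < est := by linarith
  have hs1 : 1 ≤ √est := Real.one_le_sqrt.2 (by linarith)
  have hs := Real.sq_sqrt hest0.le
  have hexp : Real.exp (L * (1 / est * √est)) ≤ Real.exp (4 * K + 2) := by
    rw [Real.exp_le_exp]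
    have hlog := log_le_two_mul_sqrt hest0
    have hL' : (L : ℝ) ≤ (4 * K + 2) * √est := by nlinarith
    have : 1 / est * √est = 1 / √est := by
      rw [one_div_mul_eq_div, Real.sqrt_div_self]; simp
    rw [this, mul_one_div, div_le_iff₀ (by linarith)]
    exact hL'
  have hpow : √est ^ (2 * (h + 1 + m)) = est ^ h * est * est ^ m := by
    rw [pow_mul, hs, pow_add, pow_succ]
  have hm' : 2 * Real.exp (4 * K + 2) ≤ est ^ m :=
    hm.le.trans (pow_le_pow_left₀ (by norm_num) hest m)
  have hh : 0 < est ^ h := by positivity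
  have hmm : 0 < est ^ m := by positivity
  rw [hpow, ← mul_div_assoc, div_le_iff₀ (by positivity)]
  calc n * Real.exp (L * (1 / est * √est)) ≤ est ^ h * Real.exp (4 * K + 2) :=
        mul_le_mul hn hexp (Real.exp_pos _).le hh.le
    _ ≤ est ^ h * (est ^ m / 2) := mul_le_mul_of_nonneg_left (by linarith) hh.le
    _ = est⁻¹ / 2 * (est ^ h * est * est ^ m) := by field_simp

/-- If the number of devices is much larger than the estimate then with high probability no device
is the only one that transmits in a slot. -/
lemma exists_soleTask_bound (K : ℝ) (hK : 0 < K) :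
    ∃ h : ℕ, 2 ≤ h ∧ ∀ (n L : ℕ) (est : ℝ), 100 ≤ est → est ^ h < n →
      (L : ℝ) ≤ 2 * (K * Real.log est + 1) →
      L * n * Real.exp (-(1 / est * (1 - 1 / est) ^ (L - 1)) * (n - 1)) ≤ (n : ℝ)⁻¹ := by
  set κ := Real.exp (-(4 * K + 4)) with hκ
  have hκ0 : 0 < κ := Real.exp_pos _
  -- With z = √n the failure bound is of order z ^ 3 * exp (-κ * z / 2), to be compared with 1 / z ^
  -- 2. The sixth Taylor term of the exponential, with 6! = 720, wins once z is this large.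
  obtain ⟨h0, hh0⟩ := pow_unbounded_of_one_lt (720 * (2 * K + 1) / (κ / 2) ^ 6)
    (by norm_num : (1 : ℝ) < 10)
  refine ⟨h0 + 2, by omega, fun n L est hest hn hL => ?_⟩
  have hest0 : 0 < est := by linarith
  set z := √(n : ℝ) with hz
  have hzz : z ^ 2 = n := Real.sq_sqrt (Nat.cast_nonneg n)
  have hz0 : 0 ≤ z := Real.sqrt_nonneg _
  have hezz : est ≤ z := by
    refine Real.le_sqrt_of_sq_le (le_trans ?_ hn.le)
    exact pow_le_pow_right₀ (by linarith) (by omega)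
  have hhz : 10 ^ h0 ≤ z := by
    refine Real.le_sqrt_of_sq_le (le_trans ?_ hn.le)
    calc ((10 : ℝ) ^ h0) ^ 2 = 100 ^ h0 := by rw [← pow_mul, mul_comm, pow_mul]; norm_num
      _ ≤ est ^ h0 := pow_le_pow_left₀ (by norm_num) hest h0
      _ ≤ est ^ (h0 + 2) := pow_le_pow_right₀ (by linarith) (by omega)
  have hzpos : 0 < z := by linarith
  have hn2 : (2 : ℝ) ≤ n := by nlinarith
  have hlog0 : 0 ≤ Real.log est := Real.log_nonneg (by linarith)
  have hlog : Real.log est ≤ est := (Real.log_le_sub_one_of_pos hest0).trans (by linarith)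
  have hL' : (L : ℝ) ≤ (2 * K + 1) * est := by nlinarith
  set p := 1 / est with hp
  have hp0 : 0 < p := by positivity
  have hp1 : p ≤ 0.01 := by
    rw [hp, div_le_iff₀ hest0]; linarith
  have hpe : p * est = 1 := by rw [hp]; field_simp
  have hpow : κ ≤ (1 - p) ^ (L - 1) := by
    have hq : Real.exp (-(2 * p)) ≤ 1 - p := by
      have h1 := Real.add_one_le_exp (2 * p)
      have h2 : Real.exp (2 * p) * Real.exp (-(2 * p)) = 1 := by rw [← Real.exp_add]; simp
      have h3 := Real.exp_pos (-(2 * p))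
      nlinarith
    calc κ ≤ Real.exp (L * -(2 * p)) := by
          rw [hκ, Real.exp_le_exp]
          have : L * p ≤ (2 * K + 1) * est * p := mul_le_mul_of_nonneg_right hL' hp0.le
          nlinarith
      _ = Real.exp (-(2 * p)) ^ L := Real.exp_nat_mul _ _
      _ ≤ (1 - p) ^ L := pow_le_pow_left₀ (Real.exp_pos _).le hq L
      _ ≤ (1 - p) ^ (L - 1) := pow_le_pow_of_le_one (by linarith) (by linarith) (Nat.sub_le _ _)
  have hexp : Real.exp (-(p * (1 - p) ^ (L - 1)) * (n - 1)) ≤ Real.exp (-(κ / 2 * z)) := by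
    rw [Real.exp_le_exp]
    have h1 : p * κ * (n / 2) ≤ p * (1 - p) ^ (L - 1) * (n - 1) :=
      mul_le_mul (mul_le_mul_of_nonneg_left hpow hp0.le) (by linarith) (by linarith)
        (mul_nonneg hp0.le (hκ0.le.trans hpow))
    -- As est ≤ √n, about n / est ≥ √n transmitters are expected per slot.
    have h2 : z ≤ p * n := by
      rw [← hzz]
      nlinarith
    nlinarith
  have hfact := Real.pow_div_factorial_le_exp (κ / 2 * z) (by positivity) 6
  have hmain : (2 * K + 1) * z ^ 5 ≤ Real.exp (κ / 2 * z) := by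
    refine le_trans ?_ hfact
    have h6 : (0 : ℝ) < (κ / 2) ^ 6 := by positivity
    have h7 : 720 * (2 * K + 1) ≤ z * (κ / 2) ^ 6 := by
      rw [← div_le_iff₀ h6]
      linarith
    have h8 : ((Nat.factorial 6 : ℕ) : ℝ) = 720 := by norm_num [Nat.factorial]
    rw [h8, le_div_iff₀ (by norm_num), mul_pow]
    have := mul_le_mul_of_nonneg_right h7 (pow_nonneg hz0 5)
    linarith
  calc L * n * Real.exp (-(p * (1 - p) ^ (L - 1)) * (n - 1))
      ≤ ((2 * K + 1) * z) * z ^ 2 * Real.exp (-(κ / 2 * z)) := by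
        rw [hzz]
        refine mul_le_mul (mul_le_mul_of_nonneg_right (hL'.trans ?_) (Nat.cast_nonneg n)) hexp
          (Real.exp_pos _).le (by positivity)
        exact mul_le_mul_of_nonneg_left hezz (by linarith)
    _ ≤ (n : ℝ)⁻¹ := by
        rw [← hzz, Real.exp_neg, ← div_eq_mul_inv, div_le_iff₀ (Real.exp_pos _), inv_mul_eq_div,
          le_div_iff₀ (by positivity)]
        calc _ = (2 * K + 1) * z ^ 5 := by ring
          _ ≤ _ := hmain

lemma exists_soleTask_of_assigned {ι : Type} {c : CDModel} {N β : ℕ}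
    {x : ι → Fin (c.coinCount N) → Bool} {k : Fin N} {i : ι} (h : Assigned c β x k i) :
    ∃ k < c.coinCount N, ∃ i, SoleTask β x k i := by
  cases c
  · exact ⟨k, k.2, i, h⟩
  · exact ⟨k, k.2, i, h⟩
  · exact ⟨2 * k, Nat.mul_lt_mul_of_pos_left k.2 two_pos, i, h.1⟩
  · exact ⟨2 * k, Nat.mul_lt_mul_of_pos_left k.2 two_pos, i, h.1⟩

/-- With high probability the number of taken IDs shows whether the estimate is good or far off. -/
lemma exists_takenIDs_whp (c : CDModel) :
    ∃ (K : ℝ) (β : ℕ) (ε : ℝ), 0 < K ∧ 0 < ε ∧ ∀ (n : ℕ) (est : ℝ), 1 ≤ n → 100 ≤ est →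
      ∀ N : ℕ, N = ⌈K * Real.log est⌉₊ →
      ∃ B : Set (Fin n → Fin (c.coinCount N) → Bool),
        (coinLaw n (c.coinCount N) (1 / est)).real B ≤ min ((n : ℝ) ^ (-ε)) (est ^ (-ε)) ∧
        ∀ ω ∉ B,
          (n / 1.5 ≤ est ∧ est ≤ 1.5 * n → c.density * N ≤ (takenIDs c β ω).card) ∧
          (1.9 * n ≤ est ∨ est ≤ n / 1.9 → (takenIDs c β ω).card < c.density * N) := by
  set δ : ℝ := 0.0005 with hδ
  have hδ0 : 0 < δ := by norm_num [hδ]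
  have hδ1 : δ ≤ 1 := by norm_num [hδ]
  have hη0 : 0 < δ ^ 2 / 4 := by positivity
  -- With this K the Chernoff bound is est ^ (-2), which is below half of 1 / est.
  set K : ℝ := 2 / (δ ^ 2 / 4) with hK
  have hK0 : 0 < K := by positivity
  obtain ⟨h, hh, hmany⟩ := exists_soleTask_bound K hK0
  obtain ⟨b, hb, hfew⟩ := not_allParticipate_bound K hK0 h
  have hhR : (2 : ℝ) ≤ h := by exact_mod_cast hh
  have hε0 : (0 : ℝ) < 1 / h := by positivity
  refine ⟨K, 2 * b, 1 / h, hK0, hε0, ?_⟩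
  rintro n est hn hest N hN
  have hest0 : 0 < est := by linarith
  have hnR : (1 : ℝ) ≤ n := by exact_mod_cast hn
  have hn0 : (0 : ℝ) < n := by linarith
  have hlog1 : 0 < Real.log est := Real.log_pos (by linarith)
  have hp0 : 0 ≤ 1 / est := by positivity
  have hp1 : 1 / est ≤ 1 := by rw [div_le_one] <;> linarith
  have hNge : K * Real.log est ≤ N := hN ▸ Nat.le_ceil _
  have hNle : (N : ℝ) ≤ K * Real.log est + 1 :=
    hN ▸ (Nat.ceil_lt_add_one (by positivity)).le
  have hN0 : (0 : ℝ) < N := lt_of_lt_of_le (by positivity) hNge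
  have hL : ((c.coinCount N : ℕ) : ℝ) ≤ 2 * (K * Real.log est + 1) := by
    have : ((c.coinCount N : ℕ) : ℝ) ≤ ((2 * N : ℕ) : ℝ) := by exact_mod_cast c.coinCount_le N
    push_cast at this
    linarith
  have hdens := c.density_ge
  by_cases hcase : (n : ℝ) ≤ est ^ h
  · have hchern : Real.exp (-(δ ^ 2 / 4) * N) ≤ est⁻¹ / 2 := by
      have h1 : Real.exp (-(δ ^ 2 / 4) * N) ≤ Real.exp (-(2 * Real.log est)) := by
        rw [Real.exp_le_exp]
        have h2 : δ ^ 2 / 4 * (K * Real.log est) ≤ δ ^ 2 / 4 * N :=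
          mul_le_mul_of_nonneg_left hNge hη0.le
        have h3 : δ ^ 2 / 4 * (K * Real.log est) = 2 * Real.log est := by
          rw [hK]; field_simp
        linarith
      refine h1.trans ?_
      rw [Real.exp_neg, two_mul, Real.exp_add, Real.exp_log hest0, mul_inv]
      have : est⁻¹ ≤ 1 / 2 := by
        rw [inv_le_comm₀ hest0 (by norm_num)]; norm_num; linarith
      have h0 : 0 < est⁻¹ := by positivity
      nlinarith
    -- The exponent 1 / h turns n ≤ est ^ h into the bound 1 / est ≤ n ^ (-1 / h).
    have hmin : est⁻¹ ≤ min ((n : ℝ) ^ (-(1 / (h : ℝ)))) (est ^ (-(1 / (h : ℝ)))) := by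
      rw [← Real.rpow_neg_one]
      refine le_min ?_ ?_
      · calc est ^ (-1 : ℝ) = (est ^ h) ^ (-(1 / (h : ℝ))) := by
              rw [← Real.rpow_natCast, ← Real.rpow_mul hest0.le]
              congr 1
              field_simp
          _ ≤ (n : ℝ) ^ (-(1 / (h : ℝ))) :=
              Real.rpow_le_rpow_of_nonpos hn0 hcase (by linarith)
      · refine Real.rpow_le_rpow_of_exponent_le (by linarith) ?_
        rw [neg_le_neg_iff, div_le_one (by linarith)]
        linarith
    have hpart := (coinLaw_not_allParticipate n (c.coinCount N) (2 * b) hp0 hp1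
      (Real.one_le_sqrt.2 (by linarith : 1 ≤ est))).trans (hfew n _ est hest hcase hL)
    obtain ⟨hup, hlow⟩ := coinLaw_takenIDs c n N (2 * b) hp0 hp1 hδ0 hδ1
    by_cases hnear : n / 1.5 ≤ est ∧ est ≤ 1.5 * n
    · refine ⟨{ω | ¬ AllParticipate (2 * b) ω} ∪ {ω | AllParticipate (2 * b) ω ∧
        ((takenIDs c (N := N) (2 * b) ω).card : ℝ) < c.density * N}, ?_, fun ω hω => ?_⟩
      · have := hlow (c.le_successProb hn hest hnear.1 hnear.2)
        have := measureReal_union_le (μ := coinLaw n (c.coinCount N) (1 / est))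
          {ω | ¬ AllParticipate (2 * b) ω} {ω | AllParticipate (2 * b) ω ∧
            ((takenIDs c (N := N) (2 * b) ω).card : ℝ) < c.density * N}
        linarith
      · simp only [Set.mem_union, Set.mem_ofPred_eq, not_or, not_not, not_and, not_lt] at hω
        refine ⟨fun _ => hω.2 hω.1, fun hfar => ?_⟩
        exfalso
        obtain ⟨h1, h2⟩ := hnear
        rcases hfar with h3 | h3
        · linarith
        · rw [le_div_iff₀ (by norm_num)] at h3
          rw [div_le_iff₀ (by norm_num)] at h1
          linarith
    by_cases hfar : 1.9 * n ≤ est ∨ est ≤ n / 1.9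
    · refine ⟨{ω | ¬ AllParticipate (2 * b) ω} ∪ {ω | AllParticipate (2 * b) ω ∧
        c.density * N ≤ (takenIDs c (N := N) (2 * b) ω).card}, ?_, fun ω hω => ?_⟩
      · have := hup (c.successProb_le hn hest hfar)
        have := measureReal_union_le (μ := coinLaw n (c.coinCount N) (1 / est))
          {ω | ¬ AllParticipate (2 * b) ω} {ω | AllParticipate (2 * b) ω ∧
            c.density * N ≤ (takenIDs c (N := N) (2 * b) ω).card}
        linarith
      · simp only [Set.mem_union, Set.mem_ofPred_eq, not_or, not_not, not_and, not_le] at hω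
        exact ⟨fun h => absurd h hnear, fun _ => hω.2 hω.1⟩
    -- Between the two ranges of estimates nothing is claimed about the leader.
    · refine ⟨∅, ?_, fun ω _ => ⟨fun h => absurd h hnear, fun h => absurd h hfar⟩⟩
      rw [measureReal_empty]
      exact le_trans (by positivity) hmin
  · have hcase' : est ^ h < n := not_le.1 hcase
    have hestn : est ^ 2 < n :=
      (pow_le_pow_right₀ (by linarith) hh).trans_lt hcase'
    have hmin : (n : ℝ)⁻¹ ≤ min ((n : ℝ) ^ (-(1 / (h : ℝ)))) (est ^ (-(1 / (h : ℝ)))) := by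
      have h1 : (n : ℝ)⁻¹ ≤ (n : ℝ) ^ (-(1 / (h : ℝ))) := by
        rw [← Real.rpow_neg_one]
        refine Real.rpow_le_rpow_of_exponent_le hnR ?_
        rw [neg_le_neg_iff, div_le_one (by linarith)]
        linarith
      refine le_min h1 (h1.trans (Real.rpow_le_rpow_of_nonpos hest0 ?_ (by linarith)))
      nlinarith
    refine ⟨{ω | ∃ k < c.coinCount N, ∃ i, SoleTask (2 * b) ω k i},
      ((coinLaw_exists_soleTask n _ (2 * b) hp0 hp1 (by omega)).trans
        (hmany n _ est hest hcase' hL)).trans hmin, fun ω hω => ⟨fun hnear => ?_, fun _ => ?_⟩⟩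
    · exfalso
      have := hnear.1
      rw [div_le_iff₀ (by norm_num)] at this
      nlinarith
    · have hempty : takenIDs c (N := N) (2 * b) ω = ∅ := by
        refine Finset.eq_empty_of_forall_notMem fun k hk => hω ?_
        obtain ⟨i, hi⟩ := mem_takenIDs.1 hk
        exact exists_soleTask_of_assigned hi
      rw [hempty, Finset.card_empty, Nat.cast_zero]
      exact mul_pos (by linarith) hN0

/-- The energy on the ID space of the algorithm is within a constant factor of that on the
estimate. -/
lemma invAck_ceil_log_le {K est : ℝ} (hK : 0 < K) (hest : 100 ≤ est) :
    invAck ⌈K * Real.log est⌉₊ ≤ invAck (4 * (K + 1) ^ 2) * invAck est := by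
  have hest0 : 0 < est := by linarith
  have hlog := log_le_two_mul_sqrt hest0
  have hlog0 : 0 ≤ Real.log est := Real.log_nonneg (by linarith)
  have hs := Real.sq_sqrt hest0.le
  have hs1 : 1 ≤ √est := Real.one_le_sqrt.2 (by linarith)
  have hN : ((⌈K * Real.log est⌉₊ : ℕ) : ℝ) ≤ 2 * (K + 1) * √est := by
    refine (Nat.ceil_lt_add_one (by positivity)).le.trans ?_
    nlinarith
  have h1 := (invAck_spec est).1
  have h2 := (invAck_spec (4 * (K + 1) ^ 2)).1
  -- N is O(√est), so it is below est unless est is bounded in terms of K; the constant factor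
  -- covers the latter case.
  rcases le_total (2 * (K + 1)) √est with h | h
  · calc _ ≤ invAck est := invAck_mono (hN.trans (by nlinarith))
      _ ≤ _ := Nat.le_mul_of_pos_left _ h2
  · calc _ ≤ invAck (4 * (K + 1) ^ 2) := invAck_mono (hN.trans (by nlinarith))
      _ ≤ _ := Nat.le_mul_of_pos_right _ h1

end RadioNetwork

open RadioNetwork in
theorem mainTheorem9 (model : CDModel) :
    ∃ (M : Type) (D : CensusFamily M), IsDenseCensus model.density D ∧
    ∃ (K : ℝ) (β : ℕ) (C ε : ℝ), 0 < K ∧ 0 < C ∧ 0 < ε ∧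
    ∀ (n : ℕ) (est : ℝ), 1 ≤ n → 100 ≤ est →
      let N : ℕ := ⌈K * Real.log est⌉₊
      let P := testNetworkSize model N β D
      1 - min ((n : ℝ) ^ (-ε)) (est ^ (-ε)) ≤
        (coinLaw n (model.coinCount N) (1 / est)).real
          {ω | ∃ T : ℕ, (T : ℝ) ≤ C * Real.log est ∧
            (∀ i, ∃ r, P.OutputAt model ω T i r) ∧
            (∀ i, (P.energy model ω T i : ℝ) ≤ C * invAck est) ∧
            (n / 1.5 ≤ est ∧ est ≤ 1.5 * n → LeaderElected P model ω T) ∧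
            (1.9 * n ≤ est ∨ est ≤ n / 1.9 → NoLeaderElected P model ω T)} := by
  obtain ⟨K, β, ε, hK, hε, hwhp⟩ := exists_takenIDs_whp model
  set a : ℕ := invAck (4 * (K + 1) ^ 2) with ha
  set C : ℝ := 16 * (K + 1) + (8 * β + β * (3 * a + 251)) with hC
  have hC0 : 0 < C := by positivity
  refine ⟨Finset ℕ, denseCensus, isDenseCensus_denseCensus model.density_ge, K, β, C, ε, hK, hC0,
    hε, ?_⟩
  intro n est hn hest N P
  have hlog1 : 1 ≤ Real.log est := by
    rw [Real.le_log_iff_exp_le (by linarith)]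
    linarith [Real.exp_one_lt_d9]
  have hN1 : 1 ≤ N := Nat.ceil_pos.2 (by positivity)
  have hNle : (N : ℝ) ≤ (K + 1) * Real.log est := by
    have : (N : ℝ) ≤ K * Real.log est + 1 := (Nat.ceil_lt_add_one (by positivity)).le
    linarith
  obtain ⟨B, hB, hgood⟩ := hwhp n est hn hest N rfl
  calc 1 - min ((n : ℝ) ^ (-ε)) (est ^ (-ε))
      ≤ 1 - (coinLaw n (model.coinCount N) (1 / est)).real B := by linarith
    _ = (coinLaw n (model.coinCount N) (1 / est)).real Bᶜ :=
        (MeasureTheory.probReal_compl_eq_one_sub (Set.toFinite B).measurableSet).symm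
    _ ≤ _ := MeasureTheory.measureReal_mono fun ω hω => ?_
  obtain ⟨T, hT, hhalt, hE, hlead, hno⟩ := testNetworkSize_spec model hN1 β ω
  obtain ⟨hnear, hfar⟩ := hgood ω hω
  refine ⟨T, ?_, hhalt, fun i => ?_, fun h => hlead (hnear h), fun h => hno (hfar h)⟩
  · have hTR : (T : ℝ) ≤ ((16 * N : ℕ) : ℝ) := by exact_mod_cast hT
    push_cast at hTR
    have : 0 ≤ (8 * (β : ℝ) + β * (3 * a + 251)) * Real.log est := by positivity
    rw [hC, add_mul]
    linarith
  · have h1 : 1 ≤ invAck est := (invAck_spec est).1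
    have h2 : invAck N ≤ a * invAck est := invAck_ceil_log_le hK hest
    have h3 : P.energy model ω T i ≤ (8 * β + β * (3 * a + 251)) * invAck est := by
      refine (hE i).trans ?_
      have h5 : 3 * invAck N + 251 ≤ (3 * a + 251) * invAck est := by nlinarith
      calc 8 * β + β * (3 * invAck N + 251)
          ≤ 8 * β * invAck est + β * ((3 * a + 251) * invAck est) :=
            Nat.add_le_add (Nat.le_mul_of_pos_right _ h1) (Nat.mul_le_mul_left _ h5)
        _ = _ := by ring
    have h4 : ((P.energy model ω T i : ℕ) : ℝ) ≤
        (((8 * β + β * (3 * a + 251)) * invAck est : ℕ) : ℝ) := by exact_mod_cast h3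
    push_cast at h4
    have : 0 ≤ 16 * (K + 1) * (invAck est : ℝ) := by positivity
    rw [hC, add_mul]
    linarith
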